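/- Let $\mathcal A=\{H_1,\dots,H_n\}$ be an affine arrangement of $n$ distinct lines in $\mathbb C^2$, with complement $M=\mathbb C^2\setminus\bigcup_i H_i$. Let $K=H_1(M;\mathbb Z)$, which is free abelian on the classes $t_1,\dots,t_n$ of the positively oriented meridians of $H_1,\dots,H_n$, and let $M'\to M$ be the maximal abelian cover (the one belonging to the commutator subgroup of $\pi_1(M)$), on which $K$ acts by deck transformations. For $k\ge 1$, the characteristic variety $V_k(\mathcal A)\subseteq(\mathbb C^*)^n$ is the zero locus of the $k$-th Fitting ideal of the $\mathbb C[K]=\mathbb C[t_1^{\pm1},\dots,t_n^{\pm1}]$-module $H_1(M';\mathbb C)$. Here, for a module with a finite free presentation $R^p\xrightarrow{\Omega}R^q\to B\to 0$, the $k$-th Fitting ideal is generated by the $(q-k+1)\times(q-k+1)$ minors of $\Omega$ (it is $0$ if $k\le q-p$, and $R$ if $k>q$). For $\mathbf t\in(\mathbb C^*)^n$ let $\mathbb C_{\mathbf t}$ be the rank one local system on $M$ for which the positively oriented meridian of $H_i$ acts by $t_i$, and let $$W^1_k(M)=\{\mathbf t\in(\mathbb C^*)^n \mid \dim_{\mathbb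 C} H^1(M;\mathbb C_{\mathbf t})\ge k\}$$ be the cohomology support locus. Let $b_2(M)$ be the second Betti number of $M$ and $N=\min\{n,\binom n2-b_2(M)\}$. If $H_1(M';\mathbb Z)\ne0$, then $V_k(\mathcal A)=W^1_k(M)$ for all $1\le k\le N$. -/

import Mathlib

open CategoryTheory

noncomputable section

namespace CharVar

/-! ### Singular homology -/

/-- The `q`-th singular homology `H_q(X; R)` with constant coefficients, as an `R`-module. -/
abbrev singularHomology (R : Type) [CommRing R] (q : ℕ) (X : Type) [TopologicalSpace X] :
    ModuleCat.{0} R :=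
  ((AlgebraicTopology.singularHomologyFunctor (ModuleCat.{0} R) q).obj (ModuleCat.of R R)).obj
    (TopCat.of X)

/-- The map induced on singular homology by a continuous map. -/
def singularHomologyMap (R : Type) [CommRing R] (q : ℕ) {X Y : Type} [TopologicalSpace X]
    [TopologicalSpace Y] (f : C(X, Y)) :
    singularHomology R q X →ₗ[R] singularHomology R q Y :=
  (((AlgebraicTopology.singularHomologyFunctor (ModuleCat.{0} R) q).obj
    (ModuleCat.of R R)).map (TopCat.ofHom f)).hom

lemma singularHomologyMap_id (R : Type) [CommRing R] (q : ℕ) (X : Type) [TopologicalSpace X] :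
    singularHomologyMap R q (ContinuousMap.id X) = LinearMap.id :=
  congrArg ModuleCat.Hom.hom (((AlgebraicTopology.singularHomologyFunctor (ModuleCat.{0} R) q).obj
    (ModuleCat.of R R)).map_id (TopCat.of X))

lemma singularHomologyMap_comp (R : Type) [CommRing R] (q : ℕ) {X Y Z : Type} [TopologicalSpace X]
    [TopologicalSpace Y] [TopologicalSpace Z] (f : C(Y, Z)) (g : C(X, Y)) :
    singularHomologyMap R q (f.comp g) =
      (singularHomologyMap R q f).comp (singularHomologyMap R q g) :=
  congrArg ModuleCat.Hom.hom (((AlgebraicTopology.singularHomologyFunctor (ModuleCat.{0} R) q).obj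
    (ModuleCat.of R R)).map_comp (TopCat.ofHom g) (TopCat.ofHom f))

/-- The `q`-th Betti number: the rank of the abelian group `H_q(X; ℤ)`. -/
def bettiNumber (q : ℕ) (X : Type) [TopologicalSpace X] : ℕ :=
  Module.finrank ℤ (singularHomology ℤ q X)

/-! ### The maximal abelian cover -/

section MaximalAbelianCover

variable {X : Type} [TopologicalSpace X] (x₀ : X)

variable {x₀} in
/-- The loop `p · q⁻¹` as an element of the fundamental group. -/
def diffLoop {x : X} (p q : Path.Homotopic.Quotient x₀ x) : FundamentalGroup X x₀ :=
  FundamentalGroup.fromPath (p.trans q.symm)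

lemma diffLoop_self {x : X} (p : Path.Homotopic.Quotient x₀ x) : diffLoop p p = 1 :=
  Path.Homotopic.Quotient.trans_symm p

lemma diffLoop_mul {x : X} (p q r : Path.Homotopic.Quotient x₀ x) :
    diffLoop q r * diffLoop p q = diffLoop p r := by
  change (p.trans q.symm).trans (q.trans r.symm) = p.trans r.symm
  rw [Path.Homotopic.Quotient.trans_assoc, ← Path.Homotopic.Quotient.trans_assoc q.symm,
    Path.Homotopic.Quotient.symm_trans, Path.Homotopic.Quotient.refl_trans]

lemma diffLoop_inv {x : X} (p q : Path.Homotopic.Quotient x₀ x) :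
    (diffLoop p q)⁻¹ = diffLoop q p := by
  rw [inv_eq_iff_mul_eq_one, diffLoop_mul x₀, diffLoop_self]

variable {x₀} in
/-- The path class `g · p` for a loop `g` at the base point. -/
def loopTrans {x : X} (g : FundamentalGroup X x₀) (p : Path.Homotopic.Quotient x₀ x) :
    Path.Homotopic.Quotient x₀ x :=
  Path.Homotopic.Quotient.trans (FundamentalGroup.toPath g) p

lemma diffLoop_loopTrans {x : X} (g : FundamentalGroup X x₀)
    (p q : Path.Homotopic.Quotient x₀ x) :
    diffLoop (loopTrans g p) q = diffLoop p q * g :=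
  Path.Homotopic.Quotient.trans_assoc _ _ _

/-- Two homotopy classes of paths `p, q` from the base point to `x` give the same point of the
maximal abelian cover iff the loop `p · q⁻¹` lies in the commutator subgroup of `π₁`. -/
def pathSetoid (x : X) : Setoid (Path.Homotopic.Quotient x₀ x) where
  r p q := diffLoop p q ∈ commutator (FundamentalGroup X x₀)
  iseqv := by
    refine ⟨fun p => ?_, fun {p q} h => ?_, fun {p q r} h h' => ?_⟩
    · rw [diffLoop_self]
      exact one_mem _
    · rw [← diffLoop_inv]
      exact inv_mem h
    · rw [← diffLoop_mul x₀ p q r]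
      exact mul_mem h' h

variable (X) in
/-- The maximal abelian cover `X'` of a space `X` with base point `x₀`: the covering space
belonging to the commutator subgroup of `π₁(X, x₀)`. Its points over `x` are the classes of paths
from `x₀` to `x`. -/
def MaxAbCover : Type := Σ x : X, Quotient (pathSetoid x₀ x)

variable {x₀} in
/-- The point of the cover given by a homotopy class of paths. -/
def MaxAbCover.mk {x : X} (p : Path.Homotopic.Quotient x₀ x) : MaxAbCover X x₀ :=
  ⟨x, Quotient.mk (pathSetoid x₀ x) p⟩

variable {x₀} in
/-- The basic open set `U[p]`: all classes `[p · q]` with `q` a path in `U` that starts at the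
endpoint of `p`. -/
def MaxAbCover.basic {x : X} (p : Path.Homotopic.Quotient x₀ x) (U : Set X) :
    Set (MaxAbCover X x₀) :=
  {e | ∃ (y : X) (q : Path x y), (∀ s, q s ∈ U) ∧
    e = MaxAbCover.mk (p.trans (Path.Homotopic.Quotient.mk q))}

/-- The usual topology of a covering space built from path classes. -/
instance : TopologicalSpace (MaxAbCover X x₀) :=
  TopologicalSpace.generateFrom
    {S | ∃ (x : X) (p : Path.Homotopic.Quotient x₀ x) (U : Set X), IsOpen U ∧ x ∈ U ∧
      S = MaxAbCover.basic p U}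

variable (X) in
/-- `K = H₁(X; ℤ)`, as the abelianization of the fundamental group. -/
abbrev DeckGroup : Type := Abelianization (FundamentalGroup X x₀)

lemma loopTrans_rel {x : X} {g h : FundamentalGroup X x₀}
    (hgh : g⁻¹ * h ∈ commutator (FundamentalGroup X x₀)) {p q : Path.Homotopic.Quotient x₀ x}
    (hpq : diffLoop p q ∈ commutator (FundamentalGroup X x₀)) :
    diffLoop (loopTrans g p) (loopTrans h q) ∈ commutator (FundamentalGroup X x₀) := by
  have e : diffLoop (loopTrans g p) (loopTrans h q) =
      (h⁻¹ * diffLoop p q * h) * (g⁻¹ * h)⁻¹ := by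
    rw [← diffLoop_inv, diffLoop_loopTrans, mul_inv_rev, diffLoop_inv, diffLoop_loopTrans]
    group
  rw [e]
  refine mul_mem ?_ (inv_mem hgh)
  simpa using (inferInstance : (commutator (FundamentalGroup X x₀)).Normal).conj_mem _ hpq h⁻¹

variable {x₀} in
/-- The deck transformation belonging to `[g] ∈ K`: it maps `[p]` to `[g · p]`. -/
def deckFun (k : DeckGroup X x₀) (e : MaxAbCover X x₀) : MaxAbCover X x₀ :=
  ⟨e.1, Quotient.map₂ (sa := QuotientGroup.leftRel (commutator (FundamentalGroup X x₀)))
    (sb := pathSetoid x₀ e.1) (sc := pathSetoid x₀ e.1) loopTrans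
    (fun _ _ hgh _ _ hpq => loopTrans_rel x₀ (QuotientGroup.leftRel_apply.mp hgh) hpq) k e.2⟩

lemma deckFun_mk (g : FundamentalGroup X x₀) {x : X} (p : Path.Homotopic.Quotient x₀ x) :
    deckFun (Abelianization.of g) (MaxAbCover.mk p) = MaxAbCover.mk (loopTrans g p) := rfl

lemma MaxAbCover.ind {P : MaxAbCover X x₀ → Prop}
    (h : ∀ (x : X) (p : Path.Homotopic.Quotient x₀ x), P (MaxAbCover.mk p)) (e) : P e := by
  obtain ⟨x, p⟩ := e
  induction p using Quotient.ind with
  | _ p => exact h x p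

lemma deckFun_one (e : MaxAbCover X x₀) : deckFun 1 e = e := by
  induction e using MaxAbCover.ind with
  | h x p =>
    rw [← map_one Abelianization.of, deckFun_mk]
    exact congrArg MaxAbCover.mk (Path.Homotopic.Quotient.refl_trans p)

lemma deckFun_mul (k l : DeckGroup X x₀) (e : MaxAbCover X x₀) :
    deckFun (k * l) e = deckFun k (deckFun l e) := by
  induction e using MaxAbCover.ind with
  | h x p =>
    obtain ⟨g, rfl⟩ : ∃ g, Abelianization.of g = k := QuotientGroup.mk_surjective k
    obtain ⟨h, rfl⟩ : ∃ h, Abelianization.of h = l := QuotientGroup.mk_surjective l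
    rw [mul_comm, ← map_mul, deckFun_mk, deckFun_mk, deckFun_mk]
    exact congrArg MaxAbCover.mk (Path.Homotopic.Quotient.trans_assoc _ _ _)

lemma deckFun_basic (g : FundamentalGroup X x₀) {x : X} (p : Path.Homotopic.Quotient x₀ x)
    (U : Set X) {e : MaxAbCover X x₀} (he : e ∈ MaxAbCover.basic p U) :
    deckFun (Abelianization.of g) e ∈ MaxAbCover.basic (loopTrans g p) U := by
  obtain ⟨y, q, hq, rfl⟩ := he
  refine ⟨y, q, hq, ?_⟩
  rw [deckFun_mk]
  exact congrArg MaxAbCover.mk (Path.Homotopic.Quotient.trans_assoc _ _ _).symm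

lemma continuous_deckFun (k : DeckGroup X x₀) :
    Continuous (deckFun k : MaxAbCover X x₀ → MaxAbCover X x₀) := by
  obtain ⟨g, rfl⟩ : ∃ g, Abelianization.of g = k := QuotientGroup.mk_surjective k
  refine continuous_generateFrom_iff.mpr ?_
  rintro _ ⟨x, p, U, hU, hx, rfl⟩
  refine TopologicalSpace.isOpen_generateFrom_of_mem ⟨x, loopTrans g⁻¹ p, U, hU, hx, ?_⟩
  ext e
  constructor
  · intro he
    have := deckFun_basic x₀ g⁻¹ p U he
    rwa [← deckFun_mul, ← map_mul, inv_mul_cancel, map_one, deckFun_one] at this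
  · intro he
    have := deckFun_basic x₀ g _ U he
    have e' : loopTrans g (loopTrans g⁻¹ p) = p := by
      refine (Path.Homotopic.Quotient.trans_assoc _ _ _).symm.trans ?_
      exact (congrArg (fun r => Path.Homotopic.Quotient.trans r p)
        (Path.Homotopic.Quotient.trans_symm (FundamentalGroup.toPath g))).trans
          (Path.Homotopic.Quotient.refl_trans p)
    rwa [e'] at this

/-- The deck transformation of the maximal abelian cover belonging to `k ∈ K`. -/
def deck (k : DeckGroup X x₀) : C(MaxAbCover X x₀, MaxAbCover X x₀) :=
  ⟨deckFun k, continuous_deckFun x₀ k⟩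

/-- The action of `K` on `H₁(X'; ℂ)` through deck transformations. -/
def deckRep : Representation ℂ (DeckGroup X x₀) (singularHomology ℂ 1 (MaxAbCover X x₀)) where
  toFun k := singularHomologyMap ℂ 1 (deck x₀ k)
  map_one' := by
    have : deck x₀ (1 : DeckGroup X x₀) = ContinuousMap.id _ :=
      ContinuousMap.ext (deckFun_one x₀)
    rw [this]
    exact singularHomologyMap_id ℂ 1 _
  map_mul' k l := by
    have : deck x₀ (k * l) = (deck x₀ k).comp (deck x₀ l) :=
      ContinuousMap.ext (deckFun_mul x₀ k l)
    rw [this]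
    exact singularHomologyMap_comp ℂ 1 _ _

variable (X) in
/-- The complexified Alexander invariant `H₁(X'; ℂ)`, a module over the group ring `ℂ[K]`. -/
abbrev AlexanderInvariant : Type := (deckRep (X := X) x₀).asModule

end MaximalAbelianCover

/-! ### Fitting ideals and characteristic varieties -/

/-- The `k`-th Fitting ideal `F_k(A)`: for a free presentation `R^p → R^q → A → 0` with matrix `Ω`
(whose rows are the relations) it is generated by the `(q - k + 1)`-minors of `Ω`. All finite
presentations are used at once, since they give the same ideal. For `k > q` the truncated size is
`0`, the empty minor is `1` and the ideal is `R`; for `k = 0` or `k ≤ q - p` every such minor has a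
repeated row or column and the ideal is `0`. -/
def fittingIdeal (R : Type) [CommRing R] (A : Type) [AddCommGroup A] [Module R A] (k : ℕ) :
    Ideal R :=
  Ideal.span {d | ∃ (p q : ℕ) (Ω : Matrix (Fin p) (Fin q) R) (π : (Fin q → R) →ₗ[R] A),
    Function.Surjective π ∧ LinearMap.ker π = LinearMap.range Ω.vecMulLinear ∧
    ∃ (r : Fin (q + 1 - k) → Fin p) (c : Fin (q + 1 - k) → Fin q), d = (Ω.submatrix r c).det}

/-- The `k`-th characteristic variety of `X`: the zero locus of the `k`-th Fitting ideal of the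
Alexander invariant in the torus `Hom(K, ℂ*)`, whose coordinate ring is `ℂ[K]` when `K` is free
abelian. -/
def charVariety (X : Type) [TopologicalSpace X] (x₀ : X) (k : ℕ) :
    Set (DeckGroup X x₀ →* ℂˣ) :=
  {ρ | ∀ f ∈ fittingIdeal (MonoidAlgebra ℂ (DeckGroup X x₀)) (AlexanderInvariant X x₀) k,
    MonoidAlgebra.lift ℂ ℂ (DeckGroup X x₀) ((Units.coeHom ℂ).comp ρ) f = 0}

/-! ### Rank one local systems and their cohomology -/

/-- A rank one complex local system on `X`, with all fibres identified with `ℂ`: a functor from the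
fundamental groupoid to `ℂ*`. The value on a path class from `x` to `y` is the transport from the
fibre over `y` to the fibre over `x`. -/
abbrev RankOneLocalSystem (X : Type) [TopologicalSpace X] : Type :=
  FundamentalGroupoid X ⥤ SingleObj ℂˣ

namespace RankOneLocalSystem

variable {X : Type} [TopologicalSpace X] (L : RankOneLocalSystem X)

/-- The transport along a path class. -/
def transport {x y : X} (γ : Path.Homotopic.Quotient x y) : ℂˣ :=
  L.map (X := FundamentalGroupoid.mk x) (Y := FundamentalGroupoid.mk y) γ

lemma transport_trans {x y z : X} (γ : Path.Homotopic.Quotient x y)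
    (δ : Path.Homotopic.Quotient y z) :
    L.transport (γ.trans δ) = L.transport γ * L.transport δ :=
  (L.map_comp (X := FundamentalGroupoid.mk x) (Y := FundamentalGroupoid.mk y)
    (Z := FundamentalGroupoid.mk z) γ δ).trans
      (mul_comm (L.transport δ) (L.transport γ))

lemma transport_refl (x : X) : L.transport (Path.Homotopic.Quotient.refl x) = 1 :=
  L.map_id (FundamentalGroupoid.mk x)

/-- The character of `K = H₁(X; ℤ)` given by the monodromy of the local system. -/
def character (x₀ : X) : DeckGroup X x₀ →* ℂˣ :=
  Abelianization.lift
    { toFun := fun g => L.transport (FundamentalGroup.toPath g)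
      map_one' := L.transport_refl x₀
      map_mul' := fun _ _ => (L.transport_trans _ _).trans (mul_comm _ _) }

/-- Singular `q`-cochains with coefficients in the local system: the value on a simplex `σ` lies in
the fibre over the vertex `σ(e₀)`. -/
abbrev Cochain (_ : RankOneLocalSystem X) (q : ℕ) : Type :=
  C(stdSimplex ℝ (Fin (q + 1)), X) → ℂ

/-- The `i`-th face of a singular simplex. -/
def face {q : ℕ} (σ : C(stdSimplex ℝ (Fin (q + 2)), X)) (i : Fin (q + 2)) :
    C(stdSimplex ℝ (Fin (q + 1)), X) :=
  σ.comp ⟨stdSimplex.map i.succAbove, stdSimplex.continuous_map _⟩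

/-- The edge of the standard simplex from the vertex `e₀` to the vertex `e₁`. -/
def stdEdge (q : ℕ) : Path (stdSimplex.vertex (S := ℝ) (0 : Fin (q + 2)))
    (stdSimplex.vertex (S := ℝ) (1 : Fin (q + 2))) where
  toFun s := ⟨fun i => (1 - (s : ℝ)) * (stdSimplex.vertex (S := ℝ) (0 : Fin (q + 2))) i +
      (s : ℝ) * (stdSimplex.vertex (S := ℝ) (1 : Fin (q + 2))) i,
    (convex_stdSimplex ℝ (Fin (q + 2))) (stdSimplex.vertex (S := ℝ) (0 : Fin (q + 2))).2
      (stdSimplex.vertex (S := ℝ) (1 : Fin (q + 2))).2 (by simpa using s.2.2) s.2.1 (by ring)⟩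
  continuous_toFun := by
    refine Continuous.subtype_mk (continuous_pi fun i => ?_) _
    fun_prop
  source' := by ext i; simp
  target' := by ext i; simp

/-- The edge of a singular simplex from its vertex `0` to its vertex `1`. -/
def edge {q : ℕ} (σ : C(stdSimplex ℝ (Fin (q + 2)), X)) :
    Path (σ (stdSimplex.vertex 0)) (σ (stdSimplex.vertex 1)) :=
  (stdEdge q).map σ.continuous

/-- The coboundary
`(δc)(σ) = L(σ|[e₀,e₁]) · c(∂₀σ) + ∑_{i ≥ 1} (-1)^i c(∂ᵢσ)`. -/
def coboundary (q : ℕ) : L.Cochain q →ₗ[ℂ] L.Cochain (q + 1) where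
  toFun c σ := (L.transport (Path.Homotopic.Quotient.mk (edge σ)) : ℂ) * c (face σ 0) +
    ∑ i : Fin (q + 1), (-1) ^ ((i : ℕ) + 1) * c (face σ i.succ)
  map_add' c d := by
    funext σ
    simp only [Pi.add_apply, mul_add, Finset.sum_add_distrib]
    ring
  map_smul' a c := by
    funext σ
    simp only [Pi.smul_apply, smul_eq_mul, RingHom.id_apply, mul_add, Finset.mul_sum]
    congr 1
    · ring
    · exact Finset.sum_congr rfl fun i _ => by ring

/-- The first cohomology `H¹(X; L)` with coefficients in the local system. -/
abbrev H1 : Type :=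
  LinearMap.ker (L.coboundary 1) ⧸
    (LinearMap.range (L.coboundary 0)).submoduleOf (LinearMap.ker (L.coboundary 1))

end RankOneLocalSystem

/-! ### Winding numbers -/

/-- `exp : ℂ → ℂ \ {0}`. -/
abbrev expCover (z : ℂ) : {z : ℂ // z ≠ 0} := ⟨_, z.exp_ne_zero⟩

lemma expCover_cov : IsCoveringMap expCover := Complex.isCoveringMap_exp

lemma expCover_log (x : {z : ℂ // z ≠ 0}) : expCover (Complex.log x) = x :=
  Subtype.ext (Complex.exp_log x.2)

/-- The end value of the continuous branch of the logarithm along a path class from `x` to `y`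
that starts with the value `w` over `x`. -/
def logAlong {x y : {z : ℂ // z ≠ 0}} (γ : Path.Homotopic.Quotient x y) (w : expCover ⁻¹' {x}) :
    expCover ⁻¹' {y} :=
  expCover_cov.monodromy γ w

lemma logAlong_shift {x y : {z : ℂ // z ≠ 0}} (γ : Path.Homotopic.Quotient x y)
    (w w' : expCover ⁻¹' {x}) (n : ℤ) (h : (w' : ℂ) = w + n * (2 * Real.pi * Complex.I)) :
    (logAlong γ w' : ℂ) = logAlong γ w + n * (2 * Real.pi * Complex.I) := by
  obtain ⟨γ⟩ := γ
  have h0 : γ 0 = expCover (w : ℂ) := γ.source.trans w.2.symm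
  have h0' : γ 0 = expCover (w' : ℂ) := γ.source.trans w'.2.symm
  have key : (fun s => expCover_cov.liftPath γ.toContinuousMap (w : ℂ) h0 s +
      n * (2 * Real.pi * Complex.I)) = expCover_cov.liftPath γ.toContinuousMap (w' : ℂ) h0' := by
    rw [expCover_cov.eq_liftPath_iff]
    refine ⟨by fun_prop, ?_, by simp [expCover_cov.liftPath_zero, h]⟩
    funext s
    have hs := congrFun (expCover_cov.liftPath_lifts γ.toContinuousMap (w : ℂ) h0) s
    rw [← hs]
    exact Subtype.ext (by simp [Complex.exp_add, Complex.exp_int_mul_two_pi_mul_I])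
  exact (congrFun key 1).symm

lemma exists_wind {x y : {z : ℂ // z ≠ 0}} (γ : Path.Homotopic.Quotient x y) :
    ∃ n : ℤ, (logAlong γ ⟨Complex.log x, expCover_log x⟩ : ℂ) =
      Complex.log y + n * (2 * Real.pi * Complex.I) := by
  rw [← Complex.exp_eq_exp_iff_exists_int, Complex.exp_log y.2]
  exact congrArg Subtype.val (logAlong γ ⟨Complex.log x, expCover_log x⟩).2

lemma two_pi_I_cancel {m n : ℤ} {z : ℂ} (h : z + m * (2 * Real.pi * Complex.I) =
    z + n * (2 * Real.pi * Complex.I)) : m = n := by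
  have := mul_right_cancel₀ Complex.two_pi_I_ne_zero (add_left_cancel h)
  exact_mod_cast this

/-- The winding number around `0` of a path class in `ℂ \ {0}`. For a loop it is the usual winding
number; for a path from `x` to `y` it is the change of a continuous branch of the logarithm, minus
`Log y - Log x` for the principal value, in units of `2πi`. -/
def wind {x y : {z : ℂ // z ≠ 0}} (γ : Path.Homotopic.Quotient x y) : ℤ :=
  (exists_wind γ).choose

lemma wind_spec {x y : {z : ℂ // z ≠ 0}} (γ : Path.Homotopic.Quotient x y) :
    (logAlong γ ⟨Complex.log x, expCover_log x⟩ : ℂ) =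
      Complex.log y + wind γ * (2 * Real.pi * Complex.I) :=
  (exists_wind γ).choose_spec

lemma wind_refl (x : {z : ℂ // z ≠ 0}) : wind (Path.Homotopic.Quotient.refl x) = 0 := by
  refine two_pi_I_cancel (z := Complex.log x) ?_
  rw [← wind_spec, logAlong, expCover_cov.monodromy_refl]
  simp

lemma wind_trans {x y z : {z : ℂ // z ≠ 0}} (γ : Path.Homotopic.Quotient x y)
    (δ : Path.Homotopic.Quotient y z) : wind (γ.trans δ) = wind γ + wind δ := by
  refine two_pi_I_cancel (z := Complex.log z) ?_
  have h : logAlong (γ.trans δ) ⟨Complex.log x, expCover_log x⟩ =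
      logAlong δ (logAlong γ ⟨Complex.log x, expCover_log x⟩) :=
    expCover_cov.monodromy_trans_apply _ _ _
  rw [← wind_spec, h, logAlong_shift δ ⟨Complex.log y, expCover_log y⟩ _ _ (wind_spec γ),
    wind_spec δ]
  push_cast
  ring

/-! ### Line arrangements -/

/-- An affine arrangement of `n` lines in `ℂ²`: pairwise distinct lines
`Hᵢ = {a i * x + b i * y + c i = 0}`. -/
structure LineArrangement (n : ℕ) where
  a : Fin n → ℂ
  b : Fin n → ℂ
  c : Fin n → ℂ
  nontrivial : ∀ i, a i ≠ 0 ∨ b i ≠ 0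
  distinct : Function.Injective fun i => {v : ℂ × ℂ | a i * v.1 + b i * v.2 + c i = 0}

namespace LineArrangement

variable {n : ℕ} (A : LineArrangement n)

/-- The line `Hᵢ`. -/
def line (i : Fin n) : Set (ℂ × ℂ) := {v | A.a i * v.1 + A.b i * v.2 + A.c i = 0}

/-- The complement `M = ℂ² \ ⋃ Hᵢ`. -/
abbrev Complement : Type := {v : ℂ × ℂ // v ∉ ⋃ i, A.line i}

/-- The defining polynomial of `Hᵢ` as a map `M → ℂ \ {0}`. -/
def form (i : Fin n) : C(A.Complement, {z : ℂ // z ≠ 0}) where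
  toFun v := ⟨A.a i * v.1.1 + A.b i * v.1.2 + A.c i,
    fun h => v.2 (Set.mem_iUnion.mpr ⟨i, h⟩)⟩
  continuous_toFun := by fun_prop

/-- The rank one local system `ℂ_t` on the complement: a loop `γ` has the monodromy
`∏ tᵢ ^ nᵢ(γ)`, with `nᵢ(γ)` the winding number of `γ` around `Hᵢ`; so the positively oriented
meridian of `Hᵢ` has the monodromy `tᵢ`. -/
def localSystem (t : Fin n → ℂˣ) : RankOneLocalSystem A.Complement where
  obj _ := SingleObj.star ℂˣ
  map {x y} γ := (∏ i, t i ^ wind (Path.Homotopic.Quotient.map γ (A.form i)) : ℂˣ)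
  map_id x := by
    change ∏ i, t i ^ wind (Path.Homotopic.Quotient.refl (A.form i x.as)) = 1
    simp [wind_refl]
  map_comp {x y z} γ δ := by
    have h (i : Fin n) : Path.Homotopic.Quotient.map (γ ≫ δ) (A.form i) =
        (Path.Homotopic.Quotient.map γ (A.form i)).trans
          (Path.Homotopic.Quotient.map δ (A.form i)) :=
      (FundamentalGroupoid.map (A.form i)).map_comp γ δ
    rw [SingleObj.comp_as_mul]
    simp only [h, wind_trans, zpow_add, Finset.prod_mul_distrib]
    exact mul_comm (G := ℂˣ) _ _

/-- The `k`-th characteristic variety `V_k(A) ⊆ (ℂ*)ⁿ`. A point `t` is viewed as the character of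
`H₁(M; ℤ)` that maps the meridian of `Hᵢ` to `tᵢ`. -/
def V (x₀ : A.Complement) (k : ℕ) : Set (Fin n → ℂˣ) :=
  {t | (A.localSystem t).character x₀ ∈ charVariety A.Complement x₀ k}

/-- The cohomology support locus `W¹_k(M) = {t | rank H¹(M; ℂ_t) ≥ k}`. -/
def W (k : ℕ) : Set (Fin n → ℂˣ) :=
  {t | (k : Cardinal) ≤ Module.rank ℂ (A.localSystem t).H1}

end LineArrangement

end CharVar

end

/-!
Both varieties are compared with one space of linear forms. Let `X'` be the maximal abelian cover of
the complement `M`, let `K` be its deck group, and for a character `ρ` of `K` let `charDual ρ` be the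
space of linear forms on `H₁(X'; ℂ)` on which `K` acts through `ρ`.

*The Fitting side.* For a presentation matrix `Ω` of the Alexander invariant, `charDual ρ` is the
kernel of `Ω` at `ρ` (`exists_equiv_ker`), so the `k`-th Fitting ideal vanishes at `ρ` iff
`dim (charDual ρ) ≥ k` (`forall_fittingIdeal_iff`). This needs the Alexander invariant to be finitely
generated over the Noetherian ring `ℂ[K]`. The complement is a finite union of open convex sets (each
linear form takes its values in a half plane), and a Mayer–Vietoris induction
(`ChainSystem.fgHomology_union`), with the theorem on small simplices (`Chain.exists_small`) as its
input, shows that `H_q(M; ℤ)` is finitely generated over `ℤ` and `H₁(X'; ℂ)` over `ℂ[K]`.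

*Nontrivial characters.* A twisted cocycle on `M` pulls back to an equivariant cochain on `X'`. If
`ρ g ≠ 1`, an equivariant choice of paths from `x` to `g x` is a homotopy between `g` and `1`, and it
shows that `H¹(M; ℂ_ρ)` is isomorphic to `charDual ρ` (`rank_H1_eq_of_ne_one`). Hence the two loci
agree away from the trivial character, for all `k`.

*The trivial character.* It lies in both loci for `k ≤ min n (n.choose 2 - b₂)`. The winding numbers
around the `n` lines are dual to the meridians, so `dim H¹(M; ℂ) ≥ n`
(`le_rank_H1_of_transport_eq_one`). The cup products `χᵢ ∪ χⱼ` with `i < j` of the winding number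
cocycles span in `Hom(H₂(M; ℤ), ℂ)` a space of dimension at most `b₂`, so they satisfy at least
`n.choose 2 - b₂` linear relations `∑ αᵢⱼ χᵢ ∪ χⱼ = δc`. If `χᵢ = δfᵢ` on `X'`, the cochain
`c - ∑ αᵢⱼ fᵢ χⱼ` is a `K`-invariant linear form on `H₁(X'; ℂ)`, and its values on the cycles that lift
the commutators of meridians are the coefficients `αᵢⱼ` (`exists_commutator_classes`). So
`dim (charDual 1) ≥ n.choose 2 - b₂` (`le_rank_charDual_one`).
-/

noncomputable section

namespace CharVar

open RankOneLocalSystem (face edge stdEdge)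

/-! ### Singular chains as finitely supported functions -/

/-- The topological standard `q`-simplex. -/
abbrev Simplex (q : ℕ) : Type := stdSimplex ℝ (Fin (q + 1))

/-- Singular `q`-chains of `X` with coefficients in `R`. -/
abbrev Chain (R : Type) [CommRing R] (q : ℕ) (X : Type) [TopologicalSpace X] : Type :=
  C(Simplex q, X) →₀ R

namespace Chain

variable {R : Type} [CommRing R] {q : ℕ} {X Y : Type} [TopologicalSpace X] [TopologicalSpace Y]

variable (R q X) in
/-- The boundary operator on singular chains. -/
def bdry : Chain R (q + 1) X →ₗ[R] Chain R q X :=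
  Finsupp.linearCombination R fun σ => ∑ i : Fin (q + 2), Finsupp.single (face σ i) ((-1) ^ (i : ℕ))

lemma bdry_single (σ : C(Simplex (q + 1), X)) (r : R) : bdry R q X (Finsupp.single σ r) =
    ∑ i : Fin (q + 2), Finsupp.single (face σ i) (r * (-1) ^ (i : ℕ)) := by
  simp [bdry, Finsupp.linearCombination_single, Finset.smul_sum]

variable (R q) in
/-- The chain map induced by a continuous map. -/
def map (f : C(X, Y)) : Chain R q X →ₗ[R] Chain R q Y :=
  Finsupp.lmapDomain R R fun σ => f.comp σ

lemma map_single (f : C(X, Y)) (σ : C(Simplex q, X)) (r : R) :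
    map R q f (Finsupp.single σ r) = Finsupp.single (f.comp σ) r := by
  simp [map]

lemma bdry_map (f : C(X, Y)) (c : Chain R (q + 1) X) :
    bdry R q Y (map R (q + 1) f c) = map R q f (bdry R q X c) := by
  induction c using Finsupp.induction_linear with
  | zero => simp
  | add c d hc hd => simp [hc, hd]
  | single σ r =>
    simp only [map_single, bdry_single, map_sum]
    rfl

variable (R q X) in
/-- The comparison of explicit chains with the chain groups of Mathlib's singular chain complex. -/
def toMathlib : Chain R q X →ₗ[R]
    ((TopCat.toSSet.obj (TopCat.of X)).chainComplex (ModuleCat.of R R)).X q :=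
  Finsupp.lsum R fun σ => ((TopCat.toSSet.obj (TopCat.of X)).ιChainComplex (R := ModuleCat.of R R)
    (((TopCat.of X).toSSetObjEquiv (.op (.mk q))).symm σ)).hom

lemma toMathlib_single (σ : C(Simplex q, X)) (r : R) : toMathlib R q X (Finsupp.single σ r) =
    ((TopCat.toSSet.obj (TopCat.of X)).ιChainComplex (R := ModuleCat.of R R)
    (((TopCat.of X).toSSetObjEquiv (.op (.mk q))).symm σ)).hom r := by
  simp [toMathlib]

lemma toMathlib_bijective : Function.Bijective (toMathlib R q X) := by
  let S := TopCat.toSSet.obj (TopCat.of X)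
  let inv : (S.chainComplex (ModuleCat.of R R)).X q ⟶ ModuleCat.of R (Chain R q X) :=
    Limits.Cofan.IsColimit.desc (S.isColimitChainComplexXCofan (ModuleCat.of R R) q) fun x =>
      ModuleCat.ofHom (Finsupp.lsingle (((TopCat.of X).toSSetObjEquiv (.op (.mk q))) x))
  have hinv (x) : S.ιChainComplex (R := ModuleCat.of R R) x ≫ inv =
      ModuleCat.ofHom (Finsupp.lsingle (((TopCat.of X).toSSetObjEquiv (.op (.mk q))) x)) :=
    Limits.Cofan.IsColimit.fac (S.isColimitChainComplexXCofan (ModuleCat.of R R) q) _ x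
  refine Function.bijective_iff_has_inverse.mpr ⟨inv.hom, fun c => ?_, fun y => ?_⟩
  · induction c using Finsupp.induction_linear with
    | zero => simp
    | add c d hc hd => simp [hc, hd]
    | single σ r =>
      rw [toMathlib_single]
      have := congrArg (fun f => f.hom r)
          (hinv (((TopCat.of X).toSSetObjEquiv (.op (.mk q))).symm σ))
      simpa using this
  · have : inv ≫ ModuleCat.ofHom (toMathlib R q X) = 𝟙 _ := by
      apply SSet.chainComplex_hom_ext
      intro x
      rw [← Category.assoc, hinv]
      ext
      simp [toMathlib_single, S]
    exact congrArg (fun f => f.hom y) this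

lemma toMathlib_bdry (c : Chain R (q + 1) X) : toMathlib R q X (bdry R q X c) =
    (((TopCat.toSSet.obj (TopCat.of X)).chainComplex (ModuleCat.of R R)).d (q + 1) q).hom
      (toMathlib R (q + 1) X c) := by
  induction c using Finsupp.induction_linear with
  | zero => simp
  | add c d hc hd => simp [hc, hd]
  | single σ r =>
    have h := congrArg (fun f => f.hom r) ((TopCat.toSSet.obj (TopCat.of X)).ιChainComplex_d
      (ModuleCat.of R R) (((TopCat.of X).toSSetObjEquiv (.op (.mk (q + 1)))).symm σ))
    rw [bdry_single, toMathlib_single]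
    refine Eq.trans ?_ h.symm
    simp only [map_sum, toMathlib_single, ModuleCat.hom_sum, LinearMap.sum_apply]
    refine Finset.sum_congr rfl fun i _ => ?_
    have hδ : (TopCat.toSSet.obj (TopCat.of X)).δ i
        (((TopCat.of X).toSSetObjEquiv (.op (.mk (q + 1)))).symm σ) =
        ((TopCat.of X).toSSetObjEquiv (.op (.mk q))).symm (face σ i) := rfl
    rw [hδ, mul_comm]
    rcases neg_one_pow_eq_or R (i : ℕ) with h1 | h1 <;>
    rcases Nat.even_or_odd (i : ℕ) with h2 | h2 <;> simp [h2.neg_one_pow]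

/-- Singular cycles of positive degree. -/
abbrev cycles (R : Type) [CommRing R] (q : ℕ) (X : Type) [TopologicalSpace X] :
    Submodule R (Chain R (q + 1) X) :=
  LinearMap.ker (bdry R q X)

/-- A linear map to chains that is killed by the differential, as a map to cycles. -/
def liftToCycles {ι : Type} {c : ComplexShape ι} (K : HomologicalComplex (ModuleCat.{0} R) c)
    {A : Type} [AddCommGroup A] [Module R A] {i j : ι} (hj : c.next i = j) (f : A →ₗ[R] K.X i)
    (hf : ∀ a, (K.d i j).hom (f a) = 0) : A →ₗ[R] K.cycles i :=
  (K.liftCycles (ModuleCat.ofHom f) j hj (by ext a; exact hf a)).hom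

lemma iCycles_liftToCycles {ι : Type} {c : ComplexShape ι}
    (K : HomologicalComplex (ModuleCat.{0} R) c)
    {A : Type} [AddCommGroup A] [Module R A] {i j : ι} (hj : c.next i = j) (f : A →ₗ[R] K.X i)
    (hf : ∀ a, (K.d i j).hom (f a) = 0) (a : A) :
    (K.iCycles i).hom (liftToCycles K hj f hf a) = f a :=
  congrArg (fun f => f.hom a) (K.liftCycles_i (ModuleCat.ofHom f) j hj _)

variable (R q X) in
/-- Explicit cycles as cycles of Mathlib's singular chain complex. -/
def toMathlibCycles : cycles R q X →ₗ[R]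
    ((TopCat.toSSet.obj (TopCat.of X)).chainComplex (ModuleCat.of R R)).cycles (q + 1) :=
  liftToCycles ((TopCat.toSSet.obj (TopCat.of X)).chainComplex (ModuleCat.of R R))
    (A := cycles R q X) (j := q) (by simp) ((toMathlib R (q + 1) X).domRestrict _) fun c => by
      have : bdry R q X c = 0 := c.2
      refine (toMathlib_bdry (c : Chain R (q + 1) X)).symm.trans ?_
      rw [this, map_zero]

lemma iCycles_toMathlibCycles (z : cycles R q X) :
    (((TopCat.toSSet.obj (TopCat.of X)).chainComplex (ModuleCat.of R R)).iCycles (q + 1)).hom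
      (toMathlibCycles R q X z) = toMathlib R (q + 1) X z :=
  iCycles_liftToCycles (A := cycles R q X) _ _ _ _ z

variable (R q X) in
/-- The homology class of a singular cycle, in Mathlib's singular homology. -/
def toHomology : cycles R q X →ₗ[R] singularHomology R (q + 1) X :=
  (((TopCat.toSSet.obj (TopCat.of X)).chainComplex (ModuleCat.of R R)).homologyπ (q + 1)).hom.comp
    (toMathlibCycles R q X)

lemma iCycles_injective {ι : Type} {c : ComplexShape ι} (K : HomologicalComplex (ModuleCat.{0} R) c)
    (i : ι) : Function.Injective (K.iCycles i).hom :=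
  (ModuleCat.mono_iff_injective (K.iCycles i)).mp inferInstance

lemma homologyπ_eq_zero_iff {ι : Type} {c : ComplexShape ι}
    (K : HomologicalComplex (ModuleCat.{0} R) c) {i j : ι} (hj : c.prev j = i) (x : K.cycles j) :
    (K.homologyπ j).hom x = 0 ↔ ∃ y, (K.d i j).hom y = (K.iCycles j).hom x := by
  subst hj
  have h1 : (K.homologyπ j).hom x = 0 ↔ (K.pOpcycles j).hom ((K.iCycles j).hom x) = 0 := by
    have hinj : Function.Injective (K.homologyι j).hom :=
      (ModuleCat.mono_iff_injective (K.homologyι j)).mp inferInstance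
    have e : (K.homologyι j).hom ((K.homologyπ j).hom x) =
        (K.pOpcycles j).hom ((K.iCycles j).hom x) :=
      congrArg (fun f => f.hom x) (K.homology_π_ι j)
    rw [← e, map_eq_zero_iff _ hinj]
  rw [h1]
  exact (K.sc j).moduleCat_pOpcycles_eq_zero_iff _

lemma toHomology_surjective : Function.Surjective (toHomology R q X) := by
  intro y
  let K := (TopCat.toSSet.obj (TopCat.of X)).chainComplex (ModuleCat.of R R)
  obtain ⟨x, rfl⟩ := (ModuleCat.epi_iff_surjective (K.homologyπ (q + 1))).mp inferInstance y
  obtain ⟨c, hc⟩ := toMathlib_bijective.2 (K.iCycles (q + 1) x)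
  have hc0 : bdry R q X c = 0 := by
    apply toMathlib_bijective.1
    rw [toMathlib_bdry, hc, map_zero]
    exact congrArg (fun f => f.hom x) (K.iCycles_d (q + 1) q)
  refine ⟨⟨c, hc0⟩, congrArg (K.homologyπ (q + 1)).hom ?_⟩
  exact iCycles_injective K _ ((iCycles_toMathlibCycles _).trans hc)

lemma toHomology_eq_zero_iff (z : cycles R q X) :
    toHomology R q X z = 0 ↔ ∃ c, bdry R (q + 1) X c = z := by
  let K := (TopCat.toSSet.obj (TopCat.of X)).chainComplex (ModuleCat.of R R)
  refine (homologyπ_eq_zero_iff K (i := q + 2) (j := q + 1) (by simp) _).trans ?_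
  rw [iCycles_toMathlibCycles]
  constructor
  · rintro ⟨y, hy⟩
    obtain ⟨c, rfl⟩ := toMathlib_bijective.2 y
    exact ⟨c, toMathlib_bijective.1 ((toMathlib_bdry c).trans hy)⟩
  · rintro ⟨c, hc⟩
    exact ⟨toMathlib R (q + 2) X c, (toMathlib_bdry c).symm.trans (congrArg _ hc)⟩

lemma toMathlib_map (f : C(X, Y)) (c : Chain R q X) :
    ((SSet.chainComplexMap (TopCat.toSSet.map (TopCat.ofHom f)) (ModuleCat.of R R)).f q).hom
      (toMathlib R q X c) = toMathlib R q Y (map R q f c) := by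
  induction c using Finsupp.induction_linear with
  | zero => simp
  | add c d hc hd => simp only [map_add, hc, hd]
  | single σ r =>
    rw [map_single, toMathlib_single, toMathlib_single]
    exact congrArg (fun f => f.hom r) (SSet.ι_chainComplexMap_f _ _
      (TopCat.toSSet.map (TopCat.ofHom f)) (ModuleCat.of R R)
      (((TopCat.of X).toSSetObjEquiv (.op (.mk q))).symm σ))

lemma singularHomologyMap_toHomology (f : C(X, Y)) (z : cycles R q X) (z' : cycles R q Y)
    (h : map R (q + 1) f z = z') :
    singularHomologyMap R (q + 1) f (toHomology R q X z) = toHomology R q Y z' := by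
  let φ := SSet.chainComplexMap (TopCat.toSSet.map (TopCat.ofHom f)) (ModuleCat.of R R)
  let K := (TopCat.toSSet.obj (TopCat.of X)).chainComplex (ModuleCat.of R R)
  let L := (TopCat.toSSet.obj (TopCat.of Y)).chainComplex (ModuleCat.of R R)
  have h1 (x : K.cycles (q + 1)) : singularHomologyMap R (q + 1) f ((K.homologyπ (q + 1)).hom x) =
      (L.homologyπ (q + 1)).hom ((HomologicalComplex.cyclesMap φ (q + 1)).hom x) :=
    congrArg (fun f => f.hom x) (HomologicalComplex.homologyπ_naturality φ (q + 1))
  refine (h1 _).trans (congrArg (L.homologyπ (q + 1)).hom (iCycles_injective L _ ?_))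
  have h2 (x : K.cycles (q + 1)) : (L.iCycles (q + 1)).hom
      ((HomologicalComplex.cyclesMap φ (q + 1)).hom x) = (φ.f (q + 1)).hom
          ((K.iCycles (q + 1)).hom x) :=
    congrArg (fun f => f.hom x) (HomologicalComplex.cyclesMap_i φ (q + 1))
  rw [h2, iCycles_toMathlibCycles, iCycles_toMathlibCycles]
  exact (toMathlib_map f _).trans (congrArg _ h)

end Chain

/-- A linear map on finitely supported functions maps the functions supported in `S` into a
submodule as soon as it does so with the basis vectors from `S`. -/
lemma map_mem_of_mem_supported {R α M : Type} [CommRing R] [AddCommGroup M] [Module R M]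
    {L : (α →₀ R) →ₗ[R] M} {N : Submodule R M} {S : Set α}
    (h : ∀ a ∈ S, L (Finsupp.single a 1) ∈ N) {c : α →₀ R} (hc : c ∈ Finsupp.supported R R S) :
    L c ∈ N := by
  have : Finsupp.supported R R S ≤ N.comap L := by
    rw [Finsupp.supported_eq_span_single, Submodule.span_le]
    rintro _ ⟨a, ha, rfl⟩
    exact h a ha
  exact this hc

lemma Chain.bdry_bdry {R : Type} [CommRing R] {q : ℕ} {X : Type} [TopologicalSpace X]
    (c : Chain R (q + 2) X) : Chain.bdry R q X (Chain.bdry R (q + 1) X c) = 0 := by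
  apply Chain.toMathlib_bijective.1
  rw [Chain.toMathlib_bdry, Chain.toMathlib_bdry, map_zero]
  exact congrArg (fun f => f.hom (Chain.toMathlib R (q + 2) X c)) (HomologicalComplex.d_comp_d
    ((TopCat.toSSet.obj (TopCat.of X)).chainComplex (ModuleCat.of R R)) (q + 2) (q + 1) q)

/-! ### Affine simplices in a standard simplex -/

/-- The convex combination of the points `v i` of a standard simplex with weights `t`. -/
def comb {m n : ℕ} (v : Fin (m + 1) → Simplex n) (t : Simplex m) : Simplex n :=
  ⟨fun j => ∑ i, t i * v i j, fun j => Finset.sum_nonneg fun i _ =>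
      mul_nonneg (t.2.1 i) ((v i).2.1 j), by
    rw [Finset.sum_comm]
    simp [← Finset.mul_sum]⟩

lemma comb_apply {m n : ℕ} (v : Fin (m + 1) → Simplex n) (t : Simplex m) (j : Fin (n + 1)) :
    comb v t j = ∑ i, t i * v i j := rfl

lemma continuous_comb {m n : ℕ} (v : Fin (m + 1) → Simplex n) : Continuous (comb v) := by
  refine Continuous.subtype_mk (continuous_pi fun j => ?_) _
  refine continuous_finsetSum _ fun i _ => ?_
  exact ((continuous_apply i).comp continuous_subtype_val).mul continuous_const

lemma comb_vertex {m n : ℕ} (v : Fin (m + 1) → Simplex n) (i : Fin (m + 1)) :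
    comb v (stdSimplex.vertex i) = v i := by
  ext j
  rw [comb_apply, Finset.sum_eq_single i] <;> simp +contextual

lemma comb_vertices {n : ℕ} (t : Simplex n) : comb (fun i => stdSimplex.vertex i) t = t := by
  ext j
  rw [comb_apply, Finset.sum_eq_single j] <;> simp +contextual [eq_comm]

lemma comb_comb {l m n : ℕ} (v : Fin (m + 1) → Simplex n) (w : Fin (l + 1) → Simplex m)
    (t : Simplex l) : comb v (comb w t) = comb (fun i => comb v (w i)) t := by
  ext j
  simp only [comb_apply, Finset.sum_mul, Finset.mul_sum]
  rw [Finset.sum_comm]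
  simp only [mul_assoc]

lemma comb_map {l m n : ℕ} (v : Fin (m + 1) → Simplex n) (f : Fin (l + 1) → Fin (m + 1))
    (t : Simplex l) : comb v (stdSimplex.map f t) = comb (v ∘ f) t := by
  have h : stdSimplex.map f t = comb (fun i => stdSimplex.vertex (f i)) t := by
    ext j
    rw [comb_apply, stdSimplex.map_coe, FunOnFinite.linearMap_apply_apply]
    simp [Pi.single_apply, Finset.sum_ite, eq_comm]
  rw [h, comb_comb]
  simp only [comb_vertex]
  rfl

/-- `comb v` as a continuous map. -/
def combMap {m n : ℕ} (v : Fin (m + 1) → Simplex n) : C(Simplex m, Simplex n) :=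
  ⟨comb v, continuous_comb v⟩

lemma dist_comb_le {m n : ℕ} (v : Fin (m + 1) → Simplex n) (t : Simplex m) (x : Simplex n) {r : ℝ}
    (h : ∀ i, dist (v i) x ≤ r) : dist (comb v t) x ≤ r := by
  have hr : 0 ≤ r := dist_nonneg.trans (h 0)
  refine (dist_pi_le_iff hr).mpr fun j => ?_
  have h1 : (comb v t) j - x j = ∑ i, t i * (v i j - x j) := by
    simp [mul_sub, Finset.sum_sub_distrib, ← Finset.sum_mul, comb_apply]
  change dist ((comb v t) j) (x j) ≤ r
  rw [Real.dist_eq, h1]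
  refine (Finset.abs_sum_le_sum_abs _ _).trans ?_
  calc ∑ i, |t i * (v i j - x j)| ≤ ∑ i, t i * r := by
        refine Finset.sum_le_sum fun i _ => ?_
        rw [abs_mul, abs_of_nonneg (stdSimplex.zero_le t i)]
        refine mul_le_mul_of_nonneg_left ?_ (stdSimplex.zero_le t i)
        have := (dist_pi_le_iff hr).mp (h i) j
        rwa [Real.dist_eq] at this
    _ = r := by simp [← Finset.sum_mul]

/-- The barycenter of a tuple of points. -/
def bary {m n : ℕ} (v : Fin (m + 1) → Simplex n) : Simplex n := comb v stdSimplex.barycenter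

lemma dist_bary_le {m n : ℕ} (v : Fin (m + 1) → Simplex n) (i : Fin (m + 1)) {d : ℝ}
    (h : ∀ i j, dist (v i) (v j) ≤ d) : dist (bary v) (v i) ≤ m / (m + 1) * d := by
  have hd : 0 ≤ d := dist_nonneg.trans (h 0 0)
  refine (dist_pi_le_iff (by positivity)).mpr fun k => ?_
  change dist (bary v k) (v i k) ≤ _
  have h1 : bary v k - v i k = ∑ j, (m + 1 : ℝ)⁻¹ * (v j k - v i k) := by
    rw [bary, comb_apply]
    simp only [mul_sub, Finset.sum_sub_distrib]
    congr 1
    · refine Finset.sum_congr rfl fun j _ => ?_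
      have : (stdSimplex.barycenter : Simplex m) j = _ := stdSimplex.barycenter_apply j
      rw [this]
      simp
    · simp only [Finset.sum_const, Finset.card_univ, Fintype.card_fin, nsmul_eq_mul]
      push_cast
      field_simp
  rw [Real.dist_eq, h1]
  refine (Finset.abs_sum_le_sum_abs _ _).trans ?_
  rw [← Finset.add_sum_erase _ _ (Finset.mem_univ i)]
  simp only [sub_self, mul_zero, abs_zero, zero_add]
  calc _ ≤ ∑ j ∈ Finset.univ.erase i, (m + 1 : ℝ)⁻¹ * d := by
        refine Finset.sum_le_sum fun j _ => ?_
        rw [abs_mul, abs_of_nonneg (by positivity)]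
        refine mul_le_mul_of_nonneg_left ?_ (by positivity)
        have := (dist_pi_le_iff hd).mp (h j i) k
        rwa [Real.dist_eq] at this
    _ = _ := by
        simp [Finset.card_erase_of_mem]
        ring

/-- Affine `q`-chains in the standard `n`-simplex: an affine simplex is the tuple of its
vertices. -/
abbrev Lin (R : Type) [CommRing R] (q n : ℕ) : Type := (Fin (q + 1) → Simplex n) →₀ R

namespace Lin

variable {R : Type} [CommRing R] {q n : ℕ}

/-- The boundary of an affine chain. -/
def bdry : Lin R (q + 1) n →ₗ[R] Lin R q n :=
  Finsupp.linearCombination R fun v =>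
    ∑ i : Fin (q + 2), Finsupp.single (v ∘ i.succAbove) ((-1) ^ (i : ℕ))

lemma bdry_single (v : Fin (q + 2) → Simplex n) (r : R) : bdry (Finsupp.single v r) =
    ∑ i : Fin (q + 2), Finsupp.single (v ∘ i.succAbove) (r * (-1) ^ (i : ℕ)) := by
  simp [bdry, Finsupp.linearCombination_single, Finset.smul_sum]

/-- The singular chain obtained from an affine chain in the domain of a singular simplex. -/
def push {X : Type} [TopologicalSpace X] (σ : C(Simplex n, X)) : Lin R q n →ₗ[R] Chain R q X :=
  Finsupp.lmapDomain R R fun v => σ.comp (combMap v)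

lemma push_single {X : Type} [TopologicalSpace X] (σ : C(Simplex n, X))
    (v : Fin (q + 1) → Simplex n) (r : R) :
    push σ (Finsupp.single v r) = Finsupp.single (σ.comp (combMap v)) r := by
  simp [push]

lemma bdry_push {X : Type} [TopologicalSpace X] (σ : C(Simplex n, X)) (c : Lin R (q + 1) n) :
    Chain.bdry R q X (push σ c) = push σ (bdry c) := by
  induction c using Finsupp.induction_linear with
  | zero => simp
  | add c d hc hd => simp [hc, hd]
  | single v r =>
    rw [push_single, Chain.bdry_single, bdry_single, map_sum]
    refine Finset.sum_congr rfl fun i _ => ?_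
    rw [push_single]
    congr 1
    ext t
    exact congrArg σ (comb_map v i.succAbove t)

lemma push_injective : Function.Injective
    (push (R := R) (q := q) (ContinuousMap.id (Simplex n))) := by
  refine Finsupp.mapDomain_injective fun v w h => ?_
  funext i
  have := congrArg (fun f : C(Simplex q, Simplex n) => f (stdSimplex.vertex i)) h
  simpa [combMap, comb_vertex] using this

lemma bdry_bdry (c : Lin R (q + 2) n) : bdry (bdry c) = 0 := by
  apply push_injective
  rw [← bdry_push, ← bdry_push, Chain.bdry_bdry, map_zero]

/-- The cone with apex `b`. -/
def cone (b : Simplex n) : Lin R q n →ₗ[R] Lin R (q + 1) n :=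
  Finsupp.lmapDomain R R fun v => (Fin.cons b v : Fin (q + 2) → Simplex n)

lemma cone_single (b : Simplex n) (v : Fin (q + 1) → Simplex n) (r : R) :
    cone b (Finsupp.single v r) =
      Finsupp.single (Fin.cons b v : Fin (q + 2) → Simplex n) r := by
  simp [cone]

lemma bdry_cone (b : Simplex n) (c : Lin R (q + 1) n) :
    bdry (cone b c) = c - cone b (bdry c) := by
  induction c using Finsupp.induction_linear with
  | zero => simp
  | add c d hc hd => simp only [map_add, hc, hd]; abel
  | single v r =>
    rw [cone_single, bdry_single, Fin.sum_univ_succ, bdry_single, map_sum, sub_eq_add_neg,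
      ← Finset.sum_neg_distrib]
    congr 1
    · simp [Function.comp_def]
    · refine Finset.sum_congr rfl fun i _ => ?_
      rw [cone_single, ← Finsupp.single_neg]
      congr 1
      · funext j
        refine Fin.cases ?_ (fun j => ?_) j <;> simp
      · simp [pow_succ]

/-- The barycentric subdivision of affine chains. -/
def sd : ∀ q : ℕ, Lin R q n →ₗ[R] Lin R q n
  | 0 => LinearMap.id
  | q + 1 => Finsupp.linearCombination R fun v => cone (bary v) (sd q (bdry (Finsupp.single v 1)))

/-- The chain homotopy between barycentric subdivision and the identity. -/
def sdHtpy : ∀ q : ℕ, Lin R q n →ₗ[R] Lin R (q + 1) n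
  | 0 => 0
  | q + 1 => Finsupp.linearCombination R fun v =>
      cone (bary v) (Finsupp.single v 1 - sdHtpy q (bdry (Finsupp.single v 1)))

lemma sd_succ_single (v : Fin (q + 2) → Simplex n) :
    sd (q + 1) (Finsupp.single v (1 : R)) = cone (bary v) (sd q (bdry (Finsupp.single v 1))) := by
  simp [sd, Finsupp.linearCombination_single]

lemma sdHtpy_succ_single (v : Fin (q + 2) → Simplex n) :
    sdHtpy (q + 1) (Finsupp.single v (1 : R)) =
      cone (bary v) (Finsupp.single v 1 - sdHtpy q (bdry (Finsupp.single v 1))) := by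
  simp [sdHtpy, Finsupp.linearCombination_single]

lemma bdry_sdHtpy (c : Lin R (q + 1) n) :
    bdry (sdHtpy (q + 1) c) = c - sd (q + 1) c - sdHtpy q (bdry c) := by
  induction q with
  | zero =>
    induction c using Finsupp.induction_linear with
    | zero => simp
    | add c d hc hd => simp only [map_add, hc, hd]; abel
    | single v r =>
      rw [← mul_one r, ← smul_eq_mul, ← Finsupp.smul_single]
      simp only [map_smul, ← smul_sub]
      rw [sdHtpy_succ_single, bdry_cone, sd_succ_single]
      simp only [sdHtpy, sd, LinearMap.zero_apply, sub_zero, LinearMap.id_apply]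
  | succ q ih =>
    induction c using Finsupp.induction_linear with
    | zero => simp
    | add c d hc hd => simp only [map_add, hc, hd]; abel
    | single v r =>
      rw [← mul_one r, ← smul_eq_mul, ← Finsupp.smul_single]
      simp only [map_smul, ← smul_sub]
      rw [sdHtpy_succ_single, bdry_cone, sd_succ_single, map_sub, ih, bdry_bdry]
      simp only [map_sub, map_zero]
      congr 1
      abel

/-- The map of affine chains induced by an affine map. -/
def map {m : ℕ} (w : Fin (m + 1) → Simplex n) : Lin R q m →ₗ[R] Lin R q n :=
  Finsupp.lmapDomain R R fun v i => comb w (v i)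

lemma map_single {m : ℕ} (w : Fin (m + 1) → Simplex n) (v : Fin (q + 1) → Simplex m) (r : R) :
    map w (Finsupp.single v r) = Finsupp.single (fun i => comb w (v i)) r := by
  simp [map]

lemma bdry_map {m : ℕ} (w : Fin (m + 1) → Simplex n) (c : Lin R (q + 1) m) :
    bdry (map w c) = map w (bdry c) := by
  induction c using Finsupp.induction_linear with
  | zero => simp
  | add c d hc hd => simp [hc, hd]
  | single v r =>
    simp only [map_single, bdry_single, map_sum]
    rfl

lemma cone_map {m : ℕ} (w : Fin (m + 1) → Simplex n) (b : Simplex m) (c : Lin R q m) :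
    cone (comb w b) (map w c) = map w (cone b c) := by
  induction c using Finsupp.induction_linear with
  | zero => simp
  | add c d hc hd => simp [hc, hd]
  | single v r =>
    simp only [map_single, cone_single]
    congr 1
    funext j
    refine Fin.cases ?_ (fun j => ?_) j <;> simp

lemma bary_map {m : ℕ} (w : Fin (m + 1) → Simplex n) (v : Fin (q + 1) → Simplex m) :
    bary (fun i => comb w (v i)) = comb w (bary v) :=
  (comb_comb _ _ _).symm

lemma sd_map {m : ℕ} (w : Fin (m + 1) → Simplex n) (c : Lin R q m) :
    sd q (map w c) = map w (sd q c) := by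
  induction q with
  | zero => rfl
  | succ q ih =>
    induction c using Finsupp.induction_linear with
    | zero => simp
    | add c d hc hd => simp [hc, hd]
    | single v r =>
      rw [← mul_one r, ← smul_eq_mul, ← Finsupp.smul_single]
      simp only [map_smul]
      rw [map_single, sd_succ_single, ← map_single, bdry_map, ih, bary_map, cone_map,
          sd_succ_single]

lemma sdHtpy_map {m : ℕ} (w : Fin (m + 1) → Simplex n) (c : Lin R q m) :
    sdHtpy q (map w c) = map w (sdHtpy q c) := by
  induction q with
  | zero => simp [sdHtpy]
  | succ q ih =>
    induction c using Finsupp.induction_linear with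
    | zero => simp
    | add c d hc hd => simp [hc, hd]
    | single v r =>
      rw [← mul_one r, ← smul_eq_mul, ← Finsupp.smul_single]
      simp only [map_smul]
      rw [map_single, sdHtpy_succ_single, ← map_single, bdry_map, ih, bary_map, ← map_sub, cone_map,
        sdHtpy_succ_single]

/-- The subdivision of an affine simplex consists of simplices whose diameter has shrunk by the
factor `q / (q + 1)`, with vertices in the convex hull of the given simplex. -/
lemma sd_single_mem (v : Fin (q + 1) → Simplex n) {d : ℝ} (h : ∀ i j, dist (v i) (v j) ≤ d) :
    sd q (Finsupp.single v (1 : R)) ∈ Finsupp.supported R R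
      {w : Fin (q + 1) → Simplex n | (∀ i j, dist (w i) (w j) ≤ q / (q + 1) * d) ∧
        ∀ i, ∃ t, w i = comb v t} := by
  induction q with
  | zero =>
    refine Finsupp.single_mem_supported R 1 ⟨fun i j => ?_, fun i => ⟨stdSimplex.vertex i, ?_⟩⟩
    · simp [Subsingleton.elim (α := Fin 1) i j]
    · rw [comb_vertex]
  | succ q ih =>
    have hd : 0 ≤ d := dist_nonneg.trans (h 0 0)
    rw [sd_succ_single]
    have key : sd q (bdry (Finsupp.single v (1 : R))) ∈ Finsupp.supported R R
      {w : Fin (q + 1) → Simplex n | (∀ i j, dist (w i) (w j) ≤ q / (q + 1) * d) ∧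
        ∀ i, ∃ t, w i = comb v t} := by
      rw [bdry_single, map_sum]
      refine Submodule.sum_mem _ fun i _ => ?_
      rw [mul_comm (1 : R), ← smul_eq_mul ((-1 : R) ^ (i : ℕ)), ← Finsupp.smul_single, map_smul]
      refine Submodule.smul_mem _ _ (Finsupp.supported_mono ?_
        (ih (v ∘ i.succAbove) fun a b => h _ _))
      rintro w ⟨h1, h2⟩
      refine ⟨h1, fun j => ?_⟩
      obtain ⟨t, ht⟩ := h2 j
      exact ⟨stdSimplex.map i.succAbove t, by rw [ht, comb_map]⟩
    have hle : (q : ℝ) / (q + 1) * d ≤ (q + 1 : ℕ) / ((q + 1 : ℕ) + 1) * d := by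
      refine mul_le_mul_of_nonneg_right ?_ hd
      rw [div_le_div_iff₀ (by positivity) (by positivity)]
      push_cast
      nlinarith
    have hb (t : Simplex (q + 1)) :
        dist (comb v t) (bary v) ≤ (q + 1 : ℕ) / ((q + 1 : ℕ) + 1) * d :=
      dist_comb_le _ _ _ fun i => by
        rw [dist_comm]
        exact dist_bary_le v i h
    refine map_mem_of_mem_supported (fun w hw => ?_) key
    obtain ⟨h1, h2⟩ := hw
    rw [cone_single]
    refine Finsupp.single_mem_supported R 1 ⟨fun i j => ?_, fun i => ?_⟩
    · refine Fin.cases ?_ (fun i => ?_) i <;> refine Fin.cases ?_ (fun j => ?_) j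
      · simpa using by positivity
      · obtain ⟨t, ht⟩ := h2 j
        rw [Fin.cons_zero, Fin.cons_succ, ht, dist_comm]
        exact hb t
      · obtain ⟨t, ht⟩ := h2 i
        rw [Fin.cons_zero, Fin.cons_succ, ht]
        exact hb t
      · rw [Fin.cons_succ, Fin.cons_succ]
        exact (h1 i j).trans hle
    · refine Fin.cases ?_ (fun i => ?_) i
      · exact ⟨_, Fin.cons_zero _ _⟩
      · rw [Fin.cons_succ]
        exact h2 i

/-- Each subdivision shrinks the diameter of a `q`-simplex by the factor `q / (q + 1)`. -/
lemma sd_iterate_mem (k : ℕ) : (sd q)^[k] (Finsupp.single (fun i => stdSimplex.vertex i) (1 : R)) ∈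
    Finsupp.supported R R {w : Fin (q + 1) → Simplex q | ∀ i j, dist (w i) (w j) ≤
      ((q : ℝ) / (q + 1)) ^ k * Metric.diam (Set.univ : Set (Simplex q))} := by
  induction k with
  | zero =>
    refine Finsupp.single_mem_supported R 1 fun i j => ?_
    simpa using Metric.dist_le_diam_of_mem isCompact_univ.isBounded (Set.mem_univ _)
      (Set.mem_univ _)
  | succ k ih =>
    rw [Function.iterate_succ_apply']
    refine map_mem_of_mem_supported (fun w hw => ?_) ih
    refine Finsupp.supported_mono ?_ (sd_single_mem w hw)
    rintro u ⟨hu, -⟩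
    rwa [pow_succ', mul_assoc]

end Lin

/-! ### Small chains -/

namespace Chain

variable {R : Type} [CommRing R] {q : ℕ} {X : Type} [TopologicalSpace X]

variable (R q) in
/-- The chains whose simplices lie in `S`. -/
def within (S : Set X) : Submodule R (Chain R q X) :=
  Finsupp.supported R R {σ | ∀ t, σ t ∈ S}

lemma within_mono {S T : Set X} (h : S ⊆ T) : within R q S ≤ within R q T :=
  Finsupp.supported_mono fun _ hσ t => h (hσ t)

lemma single_mem_within {S : Set X} {σ : C(Simplex q, X)} (h : ∀ t, σ t ∈ S) (r : R) :
    Finsupp.single σ r ∈ within R q S :=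
  Finsupp.single_mem_supported R r h

lemma within_univ : within R q (Set.univ : Set X) = ⊤ := by
  simp [within]

lemma within_inter (S T : Set X) : within R q (S ∩ T) = within R q S ⊓ within R q T := by
  rw [within, within, within, ← Finsupp.supported_inter]
  congr 1
  ext σ
  simp [forall_and]

lemma bdry_mem_within {S : Set X} {c : Chain R (q + 1) X} (h : c ∈ within R (q + 1) S) :
    bdry R q X c ∈ within R q S := by
  refine map_mem_of_mem_supported (fun σ hσ => ?_) h
  rw [bdry_single]
  exact Submodule.sum_mem _ fun i _ => single_mem_within (σ := face σ i) (fun t => hσ _) _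

lemma push_mem_within {n : ℕ} {S : Set X} {σ : C(Simplex n, X)} (h : ∀ t, σ t ∈ S)
    (c : Lin R q n) : Lin.push σ c ∈ within R q S := by
  have : c ∈ Finsupp.supported R R (Set.univ : Set (Fin (q + 1) → Simplex n)) := by simp
  refine map_mem_of_mem_supported (L := Lin.push (R := R) (q := q) σ) (fun v _ => ?_) this
  rw [Lin.push_single]
  exact single_mem_within (σ := σ.comp (combMap v)) (fun t => h _) _

variable (R q X) in
/-- The barycentric subdivision of singular chains. -/
def sd : Chain R q X →ₗ[R] Chain R q X :=
  Finsupp.linearCombination R fun σ =>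
    Lin.push σ (Lin.sd q (Finsupp.single (fun i => stdSimplex.vertex i) 1))

variable (R q X) in
/-- The chain homotopy between barycentric subdivision and the identity. -/
def sdHtpy : Chain R q X →ₗ[R] Chain R (q + 1) X :=
  Finsupp.linearCombination R fun σ =>
    Lin.push σ (Lin.sdHtpy q (Finsupp.single (fun i => stdSimplex.vertex i) 1))

lemma push_comp {n m : ℕ} (σ : C(Simplex n, X)) (v : Fin (m + 1) → Simplex n) (c : Lin R q m) :
    Lin.push (σ.comp (combMap v)) c = Lin.push σ (Lin.map v c) := by
  induction c using Finsupp.induction_linear with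
  | zero => simp
  | add c d hc hd => simp [hc, hd]
  | single w r =>
    rw [Lin.map_single, Lin.push_single, Lin.push_single]
    congr 1
    ext t
    exact congrArg σ (comb_comb v w t)

lemma single_eq_push (σ : C(Simplex q, X)) (r : R) : Finsupp.single σ r =
    Lin.push σ (Finsupp.single (fun i => stdSimplex.vertex i) r) := by
  rw [Lin.push_single]
  congr 1
  ext t
  exact congrArg σ (comb_vertices t).symm

lemma map_vertex_single {m n : ℕ} (w : Fin (m + 1) → Simplex n) (r : R) :
    Lin.map w (Finsupp.single (fun i => stdSimplex.vertex i) r) = Finsupp.single w r := by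
  rw [Lin.map_single]
  simp only [comb_vertex]

lemma sd_push {n : ℕ} (σ : C(Simplex n, X)) (c : Lin R q n) :
    sd R q X (Lin.push σ c) = Lin.push σ (Lin.sd q c) := by
  induction c using Finsupp.induction_linear with
  | zero => simp
  | add c d hc hd => simp [hc, hd]
  | single w r =>
    rw [Lin.push_single, sd, Finsupp.linearCombination_single, push_comp, ← Lin.sd_map,
      map_vertex_single, ← map_smul, ← map_smul, Finsupp.smul_single, smul_eq_mul, mul_one]

lemma sdHtpy_push {n : ℕ} (σ : C(Simplex n, X)) (c : Lin R q n) :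
    sdHtpy R q X (Lin.push σ c) = Lin.push σ (Lin.sdHtpy q c) := by
  induction c using Finsupp.induction_linear with
  | zero => simp
  | add c d hc hd => simp [hc, hd]
  | single w r =>
    rw [Lin.push_single, sdHtpy, Finsupp.linearCombination_single, push_comp, ← Lin.sdHtpy_map,
      map_vertex_single, ← map_smul, ← map_smul, Finsupp.smul_single, smul_eq_mul, mul_one]

lemma bdry_sdHtpy (c : Chain R (q + 1) X) : bdry R (q + 1) X (sdHtpy R (q + 1) X c) =
    c - sd R (q + 1) X c - sdHtpy R q X (bdry R q X c) := by
  induction c using Finsupp.induction_linear with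
  | zero => simp
  | add c d hc hd => simp only [map_add, hc, hd]; abel
  | single σ r =>
    rw [single_eq_push, sdHtpy_push, Lin.bdry_push, Lin.bdry_sdHtpy, sd_push, Lin.bdry_push,
      sdHtpy_push, map_sub, map_sub]

lemma sdHtpy_mem_within {S : Set X} {c : Chain R q X} (h : c ∈ within R q S) :
    sdHtpy R q X c ∈ within R (q + 1) S := by
  refine map_mem_of_mem_supported (fun σ hσ => ?_) h
  rw [single_eq_push, sdHtpy_push]
  exact push_mem_within hσ _

lemma sd_mem_within {S : Set X} {c : Chain R q X} (h : c ∈ within R q S) :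
    sd R q X c ∈ within R q S := by
  refine map_mem_of_mem_supported (fun σ hσ => ?_) h
  rw [single_eq_push, sd_push]
  exact push_mem_within hσ _

lemma sd_iterate_push (σ : C(Simplex q, X)) (k : ℕ) (c : Lin R q q) :
    (sd R q X)^[k] (Lin.push σ c) = Lin.push σ ((Lin.sd q)^[k] c) := by
  induction k with
  | zero => rfl
  | succ k ih => rw [Function.iterate_succ_apply', ih, sd_push, Function.iterate_succ_apply']

/-- By the Lebesgue number lemma, the simplices of a fine enough subdivision are small. -/
lemma exists_sd_iterate_single_mem {U V : Set X} (hU : IsOpen U) (hV : IsOpen V)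
    {σ : C(Simplex q, X)} (hσ : ∀ t, σ t ∈ U ∪ V) : ∃ m, ∀ k ≥ m,
    (sd R q X)^[k] (Finsupp.single σ 1) ∈ within R q U ⊔ within R q V := by
  obtain ⟨δ, hδ, hball⟩ := lebesgue_number_lemma_of_metric (s := (Set.univ : Set (Simplex q)))
    (c := fun b : Bool => cond b (σ ⁻¹' U) (σ ⁻¹' V)) isCompact_univ
    (fun b => by cases b; exacts [hV.preimage σ.continuous, hU.preimage σ.continuous])
    (fun t _ => by
      rcases hσ t with h | h
      exacts [Set.mem_iUnion.mpr ⟨true, h⟩, Set.mem_iUnion.mpr ⟨false, h⟩])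
  have hlim : Filter.Tendsto (fun k : ℕ => ((q : ℝ) / (q + 1)) ^ k *
      Metric.diam (Set.univ : Set (Simplex q))) Filter.atTop (nhds (0 * _)) :=
    (tendsto_pow_atTop_nhds_zero_of_lt_one (by positivity)
      ((div_lt_one (by positivity)).mpr (by linarith))).mul_const _
  rw [zero_mul] at hlim
  obtain ⟨m, hm⟩ := Filter.eventually_atTop.mp (hlim.eventually_lt_const hδ)
  refine ⟨m, fun k hk => ?_⟩
  rw [single_eq_push, sd_iterate_push]
  refine map_mem_of_mem_supported (L := Lin.push (R := R) (q := q) σ) (fun w hw => ?_)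
      (Lin.sd_iterate_mem k)
  rw [Lin.push_single]
  have hw' (t : Simplex q) : comb w t ∈ Metric.ball (w 0) δ :=
    Metric.mem_ball.mpr ((dist_comb_le _ _ _ fun i => hw i 0).trans_lt (hm k hk))
  obtain ⟨b, hb⟩ := hball (w 0) (Set.mem_univ _)
  cases b
  · refine Submodule.mem_sup_right (single_mem_within (fun t => ?_) _)
    exact hb (hw' t)
  · refine Submodule.mem_sup_left (single_mem_within (fun t => ?_) _)
    exact hb (hw' t)

/-- A sufficiently often subdivided chain in `U ∪ V` is a sum of chains in `U` and in `V`. -/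
lemma exists_sd_iterate_mem {U V : Set X} (hU : IsOpen U) (hV : IsOpen V) {c : Chain R q X}
    (hc : c ∈ within R q (U ∪ V)) :
    ∃ m, ∀ k ≥ m, (sd R q X)^[k] c ∈ within R q U ⊔ within R q V := by
  rw [within, Finsupp.supported_eq_span_single] at hc
  induction hc using Submodule.span_induction with
  | mem x hx =>
    obtain ⟨σ, hσ, rfl⟩ := hx
    exact exists_sd_iterate_single_mem hU hV hσ
  | zero => exact ⟨0, fun k _ => by rw [iterate_map_zero]; exact zero_mem _⟩
  | add x y _ _ hx hy =>
    obtain ⟨m, hm⟩ := hx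
    obtain ⟨m', hm'⟩ := hy
    refine ⟨max m m', fun k hk => ?_⟩
    rw [iterate_map_add]
    exact add_mem (hm k (le_of_max_le_left hk)) (hm' k (le_of_max_le_right hk))
  | smul r x _ hx =>
    obtain ⟨m, hm⟩ := hx
    refine ⟨m, fun k hk => ?_⟩
    have : (sd R q X)^[k] (r • x) = r • (sd R q X)^[k] x := by
      rw [← Module.End.coe_pow, map_smul]
    rw [this]
    exact Submodule.smul_mem _ _ (hm k hk)

/-- The theorem on small simplices: a cycle in `U ∪ V` is homologous in `U ∪ V` to the sum of a
chain in `U` and a chain in `V`. -/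
lemma exists_small {U V : Set X} (hU : IsOpen U) (hV : IsOpen V) {z : Chain R (q + 1) X}
    (hz : z ∈ within R (q + 1) (U ∪ V)) (hz0 : bdry R q X z = 0) :
    ∃ a ∈ within R (q + 1) U, ∃ b ∈ within R (q + 1) V, ∃ c ∈ within R (q + 2) (U ∪ V),
      z = a + b + bdry R (q + 1) X c := by
  have key (k : ℕ) : (sd R (q + 1) X)^[k] z ∈ within R (q + 1) (U ∪ V) ∧
      bdry R q X ((sd R (q + 1) X)^[k] z) = 0 ∧
      ∃ c ∈ within R (q + 2) (U ∪ V), z = (sd R (q + 1) X)^[k] z + bdry R (q + 1) X c := by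
    induction k with
    | zero => exact ⟨hz, hz0, 0, zero_mem _, by simp⟩
    | succ k ih =>
      obtain ⟨h1, h2, c, hc, h3⟩ := ih
      have h4 := bdry_sdHtpy ((sd R (q + 1) X)^[k] z)
      rw [h2, map_zero, sub_zero] at h4
      rw [Function.iterate_succ_apply']
      refine ⟨sd_mem_within h1, ?_, c + sdHtpy R (q + 1) X ((sd R (q + 1) X)^[k] z),
        add_mem hc (sdHtpy_mem_within h1), ?_⟩
      · have h5 := congrArg (bdry R q X) h4
        rw [bdry_bdry, map_sub, h2, zero_sub] at h5
        exact neg_eq_zero.mp h5.symm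
      · rw [map_add, h4]
        conv_lhs => rw [h3]
        abel
  obtain ⟨m, hm⟩ := exists_sd_iterate_mem hU hV hz
  obtain ⟨a, ha, b, hb, hab⟩ := Submodule.mem_sup.mp (hm m le_rfl)
  obtain ⟨-, -, c, hc, h⟩ := key m
  exact ⟨a, ha, b, hb, c, hc, by rw [hab]; exact h⟩

end Chain

/-! ### Finite generation of homology by Mayer–Vietoris -/

/-- Chain modules `C q` over `R` with submodules `F S q` of chains in a subset `S` of a space `X`,
for which the theorem on small simplices holds. -/
structure ChainSystem (R : Type) [CommRing R] (X : Type) [TopologicalSpace X] (C : ℕ → Type)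
    [∀ q, AddCommGroup (C q)] [∀ q, Module R (C q)] where
  d : ∀ q, C (q + 1) →ₗ[R] C q
  d_d : ∀ q c, d q (d (q + 1) c) = 0
  F : Set X → ∀ q, Submodule R (C q)
  mono : ∀ {S T : Set X}, S ⊆ T → ∀ q, F S q ≤ F T q
  empty : ∀ q, F ∅ q = ⊥
  inter : ∀ S T q, F S q ⊓ F T q ≤ F (S ∩ T) q
  d_mem : ∀ {S : Set X} {q} {c : C (q + 1)}, c ∈ F S (q + 1) → d q c ∈ F S q
  zero_le : ∀ S T, F (S ∪ T) 0 ≤ F S 0 ⊔ F T 0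
  small : ∀ {U V : Set X} {q} {z : C (q + 1)}, IsOpen U → IsOpen V → z ∈ F (U ∪ V) (q + 1) →
    d q z = 0 → ∃ a ∈ F U (q + 1), ∃ b ∈ F V (q + 1), ∃ c ∈ F (U ∪ V) (q + 2),
      z = a + b + d (q + 1) c

namespace ChainSystem

variable {R : Type} [CommRing R] {X : Type} [TopologicalSpace X] {C : ℕ → Type}
  [∀ q, AddCommGroup (C q)] [∀ q, Module R (C q)] (E : ChainSystem R X C)

/-- The cycles in a subset; every `0`-chain is a cycle. -/
def cycles (S : Set X) : ∀ q, Submodule R (C q)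
  | 0 => E.F S 0
  | q + 1 => E.F S (q + 1) ⊓ LinearMap.ker (E.d q)

lemma cycles_le (S : Set X) (q : ℕ) : E.cycles S q ≤ E.F S q := by
  cases q with
  | zero => exact le_rfl
  | succ q => exact inf_le_left

lemma cycles_mono {S T : Set X} (h : S ⊆ T) (q : ℕ) : E.cycles S q ≤ E.cycles T q := by
  cases q with
  | zero => exact E.mono h 0
  | succ q => exact inf_le_inf_right _ (E.mono h _)

/-- The homology of `S` in degree `q` is finitely generated. -/
def FGHomology (S : Set X) (q : ℕ) : Prop :=
  ∃ N : Submodule R (C q), N.FG ∧ N ≤ E.cycles S q ∧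
    E.cycles S q ≤ N ⊔ (E.F S (q + 1)).map (E.d q)

lemma fgHomology_empty (q : ℕ) : E.FGHomology ∅ q :=
  ⟨⊥, Submodule.fg_bot, bot_le, ((E.cycles_le _ q).trans (E.empty q).le).trans bot_le⟩

lemma fgHomology_union_zero {U V : Set X} (hU : E.FGHomology U 0) (hV : E.FGHomology V 0) :
    E.FGHomology (U ∪ V) 0 := by
  obtain ⟨N, hN, h1, h2⟩ := hU
  obtain ⟨N', hN', h1', h2'⟩ := hV
  refine ⟨N ⊔ N', hN.sup hN', sup_le (h1.trans (E.cycles_mono Set.subset_union_left 0))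
    (h1'.trans (E.cycles_mono Set.subset_union_right 0)), (E.zero_le U V).trans (sup_le ?_ ?_)⟩
  · exact h2.trans (sup_le_sup le_sup_left (Submodule.map_mono (E.mono Set.subset_union_left _)))
  · exact h2'.trans (sup_le_sup le_sup_right (Submodule.map_mono (E.mono Set.subset_union_right _)))

/-- A finitely generated image of a submodule is already the image of a finitely generated
submodule. -/
lemma exists_fg_le_map_eq {M N : Type} [AddCommGroup M] [Module R M] [AddCommGroup N] [Module R N]
    (g : M →ₗ[R] N) (P : Submodule R M) (h : (P.map g).FG) :
    ∃ Q : Submodule R M, Q.FG ∧ Q ≤ P ∧ P.map g ≤ Q.map g := by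
  obtain ⟨s, hs⟩ := h
  have h1 : ∀ x : s, ∃ y ∈ P, g y = x := fun x => by
    have : (x : N) ∈ P.map g := hs ▸ Submodule.subset_span x.2
    exact this
  choose f hf hg using h1
  refine ⟨Submodule.span R (Set.range f), Submodule.fg_span (Set.finite_range f),
    Submodule.span_le.mpr ?_, ?_⟩
  · rintro _ ⟨x, rfl⟩
    exact hf x
  · rw [← hs, Submodule.span_le]
    intro x hx
    exact ⟨f ⟨x, hx⟩, Submodule.subset_span ⟨_, rfl⟩, hg _⟩

/-- The Mayer–Vietoris step. -/
lemma fgHomology_union_succ [IsNoetherianRing R] {U V : Set X} {q : ℕ} (hUo : IsOpen U)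
    (hVo : IsOpen V) (hU : E.FGHomology U (q + 1)) (hV : E.FGHomology V (q + 1))
    (hUV : E.FGHomology (U ∩ V) q) : E.FGHomology (U ∪ V) (q + 1) := by
  obtain ⟨N, hN, h1, h2⟩ := hU
  obtain ⟨N', hN', h1', h2'⟩ := hV
  obtain ⟨N'', hN'', h1'', h2''⟩ := hUV
  -- triples `(a, b, c)` with `∂a = -∂b` representing a class of `U ∩ V` up to the boundary of `c`
  let g : C (q + 1) × C (q + 1) × C (q + 1) →ₗ[R] C q :=
    (E.d q).comp (LinearMap.fst R _ _ + (LinearMap.snd R _ _).comp (LinearMap.snd R _ _))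
  let s : C (q + 1) × C (q + 1) × C (q + 1) →ₗ[R] C (q + 1) :=
    LinearMap.fst R _ _ + (LinearMap.fst R _ _).comp (LinearMap.snd R _ _)
  let P : Submodule R (C (q + 1) × C (q + 1) × C (q + 1)) :=
    ((E.F U (q + 1)).prod ((E.F V (q + 1)).prod (E.F (U ∩ V) (q + 1)))) ⊓
      LinearMap.ker ((E.d q).comp s) ⊓ N''.comap g
  have hPg : (P.map g).FG := Submodule.FG.of_le hN'' (by
    rintro _ ⟨x, hx, rfl⟩
    exact hx.2)
  obtain ⟨Q, hQ, hQP, hQg⟩ := exists_fg_le_map_eq g P hPg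
  refine ⟨N ⊔ N' ⊔ Q.map s, (hN.sup hN').sup (hQ.map s), sup_le (sup_le
    (h1.trans (E.cycles_mono Set.subset_union_left _))
    (h1'.trans (E.cycles_mono Set.subset_union_right _))) ?_, ?_⟩
  · rintro _ ⟨x, hx, rfl⟩
    obtain ⟨⟨⟨ha, hb, -⟩, hk⟩, -⟩ := hQP hx
    exact ⟨add_mem (E.mono Set.subset_union_left _ ha) (E.mono Set.subset_union_right _ hb), hk⟩
  · rintro z ⟨hz, hz0⟩
    obtain ⟨a, ha, b, hb, c, hc, rfl⟩ := E.small hUo hVo hz hz0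
    have hab : E.d q a + E.d q b = 0 := by
      have : E.d q (a + b + E.d (q + 1) c) = 0 := hz0
      rwa [map_add, E.d_d, add_zero, map_add] at this
    have hda : E.d q a ∈ E.cycles (U ∩ V) q := by
      have h3 : E.d q a ∈ E.F (U ∩ V) q := E.inter _ _ _ ⟨E.d_mem ha, by
        rw [eq_neg_of_add_eq_zero_left hab]
        exact neg_mem (E.d_mem hb)⟩
      cases q with
      | zero => exact h3
      | succ q => exact ⟨h3, E.d_d _ _⟩
    obtain ⟨w, hw, _, ⟨e, he, rfl⟩, hwe⟩ := Submodule.mem_sup.mp (h2'' hda)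
    have hP : (a, b, -e) ∈ P := by
      refine ⟨⟨⟨ha, hb, neg_mem he⟩, ?_⟩, ?_⟩
      · change E.d q (a + b) = 0
        rw [map_add, hab]
      · change E.d q (a + -e) ∈ N''
        rw [map_add, map_neg, ← hwe]
        simpa using hw
    obtain ⟨⟨a', b', e'⟩, hx, hxg⟩ := hQg ⟨_, hP, rfl⟩
    obtain ⟨⟨⟨ha', hb', he'⟩, hk'⟩, -⟩ := hQP hx
    have hk1 : E.d q a' + E.d q b' = 0 := by
      rw [← map_add]
      exact hk'
    have hg1 : E.d q a' + E.d q e' = E.d q a - E.d q e := by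
      have : E.d q (a' + e') = E.d q (a + -e) := hxg
      rw [map_add, map_add, map_neg] at this
      rw [this, sub_eq_add_neg]
    have hA : a - a' - e - e' ∈ E.cycles U (q + 1) := by
      refine ⟨sub_mem (sub_mem (sub_mem ha ha') (E.mono Set.inter_subset_left _ he))
        (E.mono Set.inter_subset_left _ he'), ?_⟩
      rw [SetLike.mem_coe, LinearMap.mem_ker, map_sub, map_sub, map_sub, sub_right_comm _ _
          (E.d q e),
        sub_sub, ← hg1, sub_self]
    have hB : b - b' + e + e' ∈ E.cycles V (q + 1) := by
      refine ⟨add_mem (add_mem (sub_mem hb hb') (E.mono Set.inter_subset_right _ he))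
        (E.mono Set.inter_subset_right _ he'), ?_⟩
      rw [SetLike.mem_coe, LinearMap.mem_ker, map_add, map_add, map_sub,
        eq_neg_of_add_eq_zero_right hab, eq_neg_of_add_eq_zero_right hk1,
        eq_sub_of_add_eq' hg1]
      abel
    have hsum : a + b + E.d (q + 1) c =
        ((a - a' - e - e') + (b - b' + e + e')) + (a' + b') + E.d (q + 1) c := by abel
    rw [hsum]
    refine add_mem (add_mem (add_mem ?_ ?_) ?_) ?_
    · exact h2.trans (sup_le_sup (le_sup_left.trans le_sup_left)
        (Submodule.map_mono (E.mono Set.subset_union_left _))) hA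
    · exact h2'.trans (sup_le_sup (le_sup_right.trans le_sup_left)
        (Submodule.map_mono (E.mono Set.subset_union_right _))) hB
    · exact Submodule.mem_sup_left (Submodule.mem_sup_right ⟨_, hx, rfl⟩)
    · exact Submodule.mem_sup_right ⟨c, hc, rfl⟩

/-- The homology of a finite union of open sets is finitely generated if this holds for a class of
open sets that contains the given ones and is closed under intersections. -/
theorem fgHomology_union [IsNoetherianRing R] {G : Set (Set X)} (hopen : ∀ U ∈ G, IsOpen U)
    (hinter : ∀ U ∈ G, ∀ V ∈ G, U ∩ V ∈ G) (hfg : ∀ U ∈ G, ∀ q, E.FGHomology U q) (q : ℕ)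
    (l : List (Set X)) (hl : ∀ U ∈ l, U ∈ G) : E.FGHomology (l.foldr (· ∪ ·) ∅) q := by
  have hlo (l : List (Set X)) (hl : ∀ U ∈ l, U ∈ G) : IsOpen (l.foldr (· ∪ ·) ∅) := by
    induction l with
    | nil => exact isOpen_empty
    | cons U l ih =>
      exact (hopen U (hl U (by simp))).union (ih fun V hV => hl V (by simp [hV]))
  have hdist (A : Set X) (l : List (Set X)) :
      A ∩ l.foldr (· ∪ ·) ∅ = (l.map (A ∩ ·)).foldr (· ∪ ·) ∅ := by
    induction l with
    | nil => simp
    | cons U l ih => simp [Set.inter_union_distrib_left, ih]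
  induction q generalizing l with
  | zero =>
    induction l with
    | nil => exact E.fgHomology_empty 0
    | cons U l ih =>
      exact E.fgHomology_union_zero (hfg U (hl U (by simp)) 0)
        (ih fun V hV => hl V (by simp [hV]))
  | succ q ihq =>
    induction l with
    | nil => exact E.fgHomology_empty _
    | cons U l ih =>
      have hU := hl U (by simp)
      have hl' : ∀ V ∈ l, V ∈ G := fun V hV => hl V (by simp [hV])
      refine E.fgHomology_union_succ (hopen U hU) (hlo l hl') (hfg U hU _) (ih hl') ?_
      rw [hdist]
      refine ihq _ fun V hV => ?_
      obtain ⟨W, hW, rfl⟩ := List.mem_map.mp hV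
      exact hinter U hU W (hl' W hW)

end ChainSystem

/-! ### Cones in convex sets -/

lemma map_apply_of_injective {m n : ℕ} {f : Fin (m + 1) → Fin (n + 1)} (hf : Function.Injective f)
    (t : Simplex m) (i : Fin (m + 1)) : stdSimplex.map f t (f i) = t i := by
  rw [stdSimplex.map_coe, FunOnFinite.linearMap_apply_apply]
  simp [hf.eq_iff, Finset.filter_eq']

lemma map_apply_of_notMem {m n : ℕ} {f : Fin (m + 1) → Fin (n + 1)}
    (t : Simplex m) (j : Fin (n + 1)) (hj : ∀ i, f i ≠ j) : stdSimplex.map f t j = 0 := by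
  rw [stdSimplex.map_coe, FunOnFinite.linearMap_apply_apply]
  simp [hj]

/-- The projection of a simplex from its vertex `0` onto the opposite face (with an irrelevant value
at the vertex itself). -/
def simplexTail {q : ℕ} (t : Simplex (q + 1)) : Simplex q :=
  open Classical in
  if h : t 0 = 1 then stdSimplex.vertex 0 else
    ⟨fun i => t i.succ / (1 - t 0), fun i => div_nonneg (stdSimplex.zero_le t _)
      (sub_nonneg.mpr (stdSimplex.le_one t 0)), by
      have h1 : t 0 + ∑ i : Fin (q + 1), t i.succ = 1 := by
        rw [← Fin.sum_univ_succ]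
        exact stdSimplex.sum_eq_one t
      rw [← Finset.sum_div, eq_sub_of_add_eq' h1, div_self (sub_ne_zero.mpr (Ne.symm h))]⟩

lemma simplexTail_apply {q : ℕ} {t : Simplex (q + 1)} (h : t 0 ≠ 1) (i : Fin (q + 1)) :
    simplexTail t i = t i.succ / (1 - t 0) := by
  rw [simplexTail, dif_neg h]
  rfl

lemma continuous_coord {q : ℕ} (i : Fin (q + 1)) : Continuous fun t : Simplex q => t i :=
  (continuous_apply i).comp continuous_subtype_val

lemma continuousAt_simplexTail {q : ℕ} {t : Simplex (q + 1)} (h : t 0 ≠ 1) :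
    ContinuousAt simplexTail t := by
  rw [Topology.IsInducing.subtypeVal.continuousAt_iff]
  refine continuousAt_pi.mpr fun i => ?_
  have h1 : ContinuousAt (fun u : Simplex (q + 1) => u i.succ / (1 - u 0)) t :=
    (continuous_coord _).continuousAt.div
      (continuousAt_const.sub (continuous_coord _).continuousAt) (sub_ne_zero.mpr (Ne.symm h))
  refine h1.congr ?_
  filter_upwards [(continuous_coord 0).continuousAt.eventually_ne h] with u hu
  exact (simplexTail_apply hu i).symm

lemma map_zero_succAbove {q : ℕ} (t : Simplex q) :
    stdSimplex.map (Fin.succAbove 0) t 0 = 0 ∧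
      simplexTail (stdSimplex.map (Fin.succAbove 0) t) = t := by
  have h0 : stdSimplex.map (Fin.succAbove 0) t 0 = 0 :=
    map_apply_of_notMem _ _ fun i => Fin.succAbove_ne 0 i
  refine ⟨h0, ?_⟩
  ext i
  rw [simplexTail_apply (by rw [h0]; exact zero_ne_one), h0, sub_zero, div_one]
  exact map_apply_of_injective Fin.succAbove_right_injective t i

lemma map_succ_succAbove_zero {q : ℕ} (t : Simplex (q + 1)) (i : Fin (q + 2)) :
    stdSimplex.map i.succ.succAbove t 0 = t 0 := by
  have := map_apply_of_injective (Fin.succAbove_right_injective (p := i.succ)) t 0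
  rwa [Fin.succ_succAbove_zero] at this

lemma simplexTail_map_succ_succAbove {q : ℕ} {t : Simplex (q + 1)} (h : t 0 ≠ 1)
    (i : Fin (q + 2)) : simplexTail (stdSimplex.map i.succ.succAbove t) =
      stdSimplex.map i.succAbove (simplexTail t) := by
  have h0 := map_succ_succAbove_zero t i
  ext j
  rw [simplexTail_apply (by rwa [h0]), h0]
  rcases Fin.eq_self_or_eq_succAbove i j with rfl | ⟨l, rfl⟩
  · rw [map_apply_of_notMem, map_apply_of_notMem, zero_div]
    · exact fun k => Fin.succAbove_ne _ _
    · exact fun k => Fin.succAbove_ne _ _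
  · rw [map_apply_of_injective Fin.succAbove_right_injective, simplexTail_apply h,
      ← Fin.succ_succAbove_succ, map_apply_of_injective Fin.succAbove_right_injective]

section Cone

variable {E : Type} [NormedAddCommGroup E] [NormedSpace ℝ E] {S : Set E}

/-- The cone with apex `b` over a singular simplex of a convex set. -/
def coneSimplex (hS : Convex ℝ S) (b : S) {q : ℕ} (σ : C(Simplex q, S)) :
    C(Simplex (q + 1), S) where
  toFun t := ⟨t 0 • (b : E) + (1 - t 0) • (σ (simplexTail t) : E),
    hS b.2 (σ _).2 (stdSimplex.zero_le t 0) (sub_nonneg.mpr (stdSimplex.le_one t 0))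
      (by ring)⟩
  continuous_toFun := by
    refine Continuous.subtype_mk (continuous_iff_continuousAt.mpr fun t => ?_) _
    have hc : ContinuousAt (fun u : Simplex (q + 1) => u 0) t := (continuous_coord 0).continuousAt
    by_cases h : t 0 = 1
    · obtain ⟨M, hM⟩ := (isCompact_range (continuous_subtype_val.comp σ.continuous)).isBounded
        |>.exists_norm_le
      have h2 : Filter.Tendsto (fun u : Simplex (q + 1) => (1 - u 0) • (σ (simplexTail u) : E))
          (nhds t) (nhds 0) := by
        rw [tendsto_zero_iff_norm_tendsto_zero]
        have h3 : Filter.Tendsto (fun u : Simplex (q + 1) => (1 - u 0) * M) (nhds t) (nhds 0) := by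
          have : Filter.Tendsto (fun u : Simplex (q + 1) => (1 - u 0) * M) (nhds t)
              (nhds ((1 - t 0) * M)) := (continuousAt_const.sub hc).mul_const M
          simpa [h] using this
        refine squeeze_zero (fun _ => norm_nonneg _) (fun u => ?_) h3
        rw [norm_smul, Real.norm_of_nonneg (sub_nonneg.mpr (stdSimplex.le_one u 0))]
        exact mul_le_mul_of_nonneg_left (hM _ ⟨_, rfl⟩) (sub_nonneg.mpr (stdSimplex.le_one u 0))
      have h4 := (hc.tendsto.smul_const (b : E)).add h2
      rw [ContinuousAt]
      simpa [h] using h4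
    · exact (hc.smul continuousAt_const).add ((continuousAt_const.sub hc).smul
        ((continuous_subtype_val.comp σ.continuous).continuousAt.comp
          (continuousAt_simplexTail h)))

lemma coneSimplex_apply (hS : Convex ℝ S) (b : S) {q : ℕ} (σ : C(Simplex q, S))
    (t : Simplex (q + 1)) :
    (coneSimplex hS b σ t : E) = t 0 • (b : E) + (1 - t 0) • (σ (simplexTail t) : E) := rfl

lemma face_zero_coneSimplex (hS : Convex ℝ S) (b : S) {q : ℕ} (σ : C(Simplex q, S)) :
    face (coneSimplex hS b σ) 0 = σ := by
  ext t
  obtain ⟨h1, h2⟩ := map_zero_succAbove t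
  refine (coneSimplex_apply hS b σ _).trans ?_
  change stdSimplex.map (Fin.succAbove 0) t 0 • (b : E) +
    (1 - stdSimplex.map (Fin.succAbove 0) t 0) •
      (σ (simplexTail (stdSimplex.map (Fin.succAbove 0) t)) : E) = _
  rw [h1, h2]
  simp

lemma face_succ_coneSimplex (hS : Convex ℝ S) (b : S) {q : ℕ} (σ : C(Simplex (q + 1), S))
    (i : Fin (q + 2)) : face (coneSimplex hS b σ) i.succ = coneSimplex hS b (face σ i) := by
  ext t
  refine (coneSimplex_apply hS b σ _).trans (Eq.trans ?_ (coneSimplex_apply hS b _ t).symm)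
  have h0 := map_succ_succAbove_zero t i
  change stdSimplex.map i.succ.succAbove t 0 • (b : E) +
    (1 - stdSimplex.map i.succ.succAbove t 0) •
      (σ (simplexTail (stdSimplex.map i.succ.succAbove t)) : E) =
    t 0 • (b : E) + (1 - t 0) • (σ (stdSimplex.map i.succAbove (simplexTail t)) : E)
  rw [h0]
  by_cases h : t 0 = 1
  · simp [h]
  · rw [simplexTail_map_succ_succAbove h]

lemma face_one_coneSimplex (hS : Convex ℝ S) (b : S) (σ : C(Simplex 0, S)) :
    face (coneSimplex hS b σ) 1 = ContinuousMap.const _ b := by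
  ext t
  refine (coneSimplex_apply hS b σ _).trans ?_
  have h0 : stdSimplex.map (Fin.succAbove (1 : Fin 2)) t 0 = 1 :=
    (map_apply_of_injective (Fin.succAbove_right_injective (p := (1 : Fin 2))) t 0).trans
      (stdSimplex.eq_one_of_unique (X := Fin 1) t 0)
  change stdSimplex.map (Fin.succAbove (1 : Fin 2)) t 0 • (b : E) +
    (1 - stdSimplex.map (Fin.succAbove (1 : Fin 2)) t 0) •
      (σ (simplexTail (stdSimplex.map (Fin.succAbove (1 : Fin 2)) t)) : E) = _
  rw [h0]
  simp

end Cone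

/-! ### Acyclicity of a disjoint union of copies of a convex set -/

variable {E : Type} [NormedAddCommGroup E] {S : Set E} {R : Type} [CommRing R] {K : Type}
    {T : Type} [TopologicalSpace T]

/-- Singular chains of `K × S` for a discrete space `K`. -/
abbrev SheetChain (R K : Type) [CommRing R] (q : ℕ) (S : Set E) : Type :=
  (K × C(Simplex q, S)) →₀ R

namespace SheetChain

/-- The boundary operator, sheet by sheet. -/
def bdry (q : ℕ) : SheetChain R K (q + 1) S →ₗ[R] SheetChain R K q S :=
  Finsupp.linearCombination R fun x =>
    ∑ i : Fin (q + 2), Finsupp.single (x.1, face x.2 i) ((-1) ^ (i : ℕ))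

lemma bdry_single (q : ℕ) (x : K × C(Simplex (q + 1), S)) (r : R) :
    bdry q (Finsupp.single x r) =
      ∑ i : Fin (q + 2), Finsupp.single (x.1, face x.2 i) (r * (-1) ^ (i : ℕ)) := by
  simp [bdry, Finsupp.linearCombination_single, Finset.smul_sum]

/-- The chain map induced by a family of maps `s k` from the sheets to `T`. -/
def map (s : K → C(S, T)) (q : ℕ) : SheetChain R K q S →ₗ[R] Chain R q T :=
  Finsupp.lmapDomain R R fun x => (s x.1).comp x.2

lemma map_single (s : K → C(S, T)) (q : ℕ) (x : K × C(Simplex q, S)) (r : R) :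
    map s q (Finsupp.single x r) = Finsupp.single ((s x.1).comp x.2) r := by
  simp [map]

lemma bdry_map (s : K → C(S, T)) (q : ℕ) (c : SheetChain R K (q + 1) S) :
    Chain.bdry R q T (map s (q + 1) c) = map s q (bdry q c) := by
  induction c using Finsupp.induction_linear with
  | zero => simp
  | add c d hc hd => simp [hc, hd]
  | single x r =>
    simp only [map_single, bdry_single, Chain.bdry_single, map_sum]
    rfl

lemma map_injective (s : K → C(S, T)) (hs : ∀ k l x y, s k x = s l y → k = l ∧ x = y) (q : ℕ) :
    Function.Injective (map (R := R) s q) := by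
  refine Finsupp.mapDomain_injective fun ⟨k, σ⟩ ⟨l, τ⟩ h => ?_
  have h1 (t : Simplex q) := hs k l (σ t) (τ t) (congrArg (fun f : C(Simplex q, T) => f t) h)
  obtain rfl := (h1 (stdSimplex.vertex 0)).1
  congr 1
  ext t
  exact congrArg _ (h1 t).2

/-- The sheetwise cone. -/
def cone [NormedSpace ℝ E] (hS : Convex ℝ S) (b : S) (q : ℕ) :
    SheetChain R K q S →ₗ[R] SheetChain R K (q + 1) S :=
  Finsupp.lmapDomain R R fun x => (x.1, coneSimplex hS b x.2)

lemma cone_single [NormedSpace ℝ E] (hS : Convex ℝ S) (b : S) (q : ℕ) (x : K × C(Simplex q, S))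
    (r : R) :
    cone hS b q (Finsupp.single x r) = Finsupp.single (x.1, coneSimplex hS b x.2) r := by
  simp [cone]

lemma bdry_cone [NormedSpace ℝ E] (hS : Convex ℝ S) (b : S) (q : ℕ) (c : SheetChain R K (q + 1) S) :
    bdry (q + 1) (cone hS b (q + 1) c) = c - cone hS b q (bdry q c) := by
  induction c using Finsupp.induction_linear with
  | zero => simp
  | add c d hc hd => simp only [map_add, hc, hd]; abel
  | single x r =>
    rw [cone_single, bdry_single, Fin.sum_univ_succ, bdry_single, map_sum, sub_eq_add_neg,
      ← Finset.sum_neg_distrib]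
    congr 1
    · simp [face_zero_coneSimplex]
    · refine Finset.sum_congr rfl fun i _ => ?_
      rw [cone_single, ← Finsupp.single_neg, face_succ_coneSimplex]
      simp [pow_succ]

lemma bdry_cone_zero_mem [NormedSpace ℝ E] (hS : Convex ℝ S) (b : S) (c : SheetChain R K 0 S) :
    c - bdry 0 (cone hS b 0 c) ∈ Submodule.span R
      (Set.range fun k : K => Finsupp.single (k, ContinuousMap.const (Simplex 0) b) (1 : R)) := by
  induction c using Finsupp.induction_linear with
  | zero => simp
  | add c d hc hd =>
    simp only [map_add]
    rw [add_sub_add_comm]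
    exact add_mem hc hd
  | single x r =>
    rw [cone_single, bdry_single, Fin.sum_univ_two, face_zero_coneSimplex, face_one_coneSimplex]
    have : Finsupp.single x r - (Finsupp.single (x.1, x.2) (r * (-1) ^ ((0 : Fin 2) : ℕ)) +
        Finsupp.single (x.1, ContinuousMap.const (Simplex 0) b) (r * (-1) ^ ((1 : Fin 2) : ℕ))) =
        r • Finsupp.single (x.1, ContinuousMap.const (Simplex 0) b) (1 : R) := by
      simp
    rw [this]
    exact Submodule.smul_mem _ _ (Submodule.subset_span ⟨x.1, rfl⟩)

/-- Chains in a subset that is evenly covered by the sheets come from the sheets. -/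
lemma exists_map_eq (s : K → C(S, T)) {W : Set T} {q : ℕ}
    (hs : ∀ σ : C(Simplex q, T), (∀ t, σ t ∈ W) → ∃ k τ, σ = (s k).comp τ) {c : Chain R q T}
    (hc : c ∈ Chain.within R q W) : ∃ x, map s q x = c := by
  have : LinearMap.id (R := R) c ∈ LinearMap.range (map (R := R) s q) := by
    refine map_mem_of_mem_supported (fun σ hσ => ?_) hc
    obtain ⟨k, τ, rfl⟩ := hs σ hσ
    exact ⟨Finsupp.single (k, τ) 1, map_single _ _ _ _⟩
  exact this

lemma map_mem_within (s : K → C(S, T)) {W : Set T} (hW : ∀ k x, s k x ∈ W) (q : ℕ)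
    (c : SheetChain R K q S) : map s q c ∈ Chain.within R q W := by
  induction c using Finsupp.induction_linear with
  | zero => simp
  | add c d hc hd => rw [map_add]; exact add_mem hc hd
  | single x r =>
    rw [map_single]
    exact Chain.single_mem_within (σ := (s x.1).comp x.2) (fun t => hW _ _) _

/-- Cycles of positive degree in a disjoint union of copies of a convex set are boundaries. -/
theorem exists_bdry_eq [NormedSpace ℝ E] (hS : Convex ℝ S) (b : S) (s : K → C(S, T))
    (hinj : ∀ k l x y, s k x = s l y → k = l ∧ x = y) {W : Set T} (hW : ∀ k x, s k x ∈ W) {q : ℕ}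
    (hs : ∀ σ : C(Simplex (q + 1), T), (∀ t, σ t ∈ W) → ∃ k τ, σ = (s k).comp τ)
    {z : Chain R (q + 1) T} (hz : z ∈ Chain.within R (q + 1) W) (hz0 : Chain.bdry R q T z = 0) :
    ∃ c ∈ Chain.within R (q + 2) W, Chain.bdry R (q + 1) T c = z := by
  obtain ⟨x, rfl⟩ := exists_map_eq s hs hz
  rw [bdry_map, ← map_zero (map s q)] at hz0
  have h0 := map_injective s hinj q hz0
  refine ⟨map s (q + 2) (cone hS b (q + 1) x), map_mem_within s hW _ _, ?_⟩
  rw [bdry_map, bdry_cone, h0, map_zero, sub_zero]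

/-- Every `0`-chain in a disjoint union of copies of a convex set is homologous to a combination of
the base points of the sheets. -/
theorem exists_sub_bdry_mem [NormedSpace ℝ E] (hS : Convex ℝ S) (b : S) (s : K → C(S, T))
    {W : Set T} (hW : ∀ k x, s k x ∈ W)
    (hs : ∀ σ : C(Simplex 0, T), (∀ t, σ t ∈ W) → ∃ k τ, σ = (s k).comp τ)
    {z : Chain R 0 T} (hz : z ∈ Chain.within R 0 W) : ∃ c ∈ Chain.within R 1 W,
      z - Chain.bdry R 0 T c ∈ Submodule.span R (Set.range fun k : K =>
        Finsupp.single (ContinuousMap.const (Simplex 0) (s k b)) (1 : R)) := by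
  obtain ⟨x, rfl⟩ := exists_map_eq s hs hz
  refine ⟨map s 1 (cone hS b 0 x), map_mem_within s hW _ _, ?_⟩
  rw [bdry_map, ← map_sub]
  have := Submodule.mem_map_of_mem (f := map s 0) (bdry_cone_zero_mem hS b x)
  rw [Submodule.map_span, ← Set.range_comp] at this
  convert this using 3
  funext k
  simp only [Function.comp_apply, map_single]
  rfl

end SheetChain

/-! ### Lifting to the maximal abelian cover -/

/-- Spaces in which every point has a neighbourhood such that paths in it with the same end points
are homotopic in the whole space. -/
class UniqueLocalPaths (X : Type) [TopologicalSpace X] : Prop where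
  exists_nhd : ∀ x : X, ∃ U, IsOpen U ∧ x ∈ U ∧ ∀ (y z : X) (p q : Path y z), (∀ s, p s ∈ U) →
    (∀ s, q s ∈ U) → Path.Homotopic p q

namespace MaxAbCover

variable {X : Type} [TopologicalSpace X] {x₀ : X}

lemma mk_eq_mk {x : X} {p q : Path.Homotopic.Quotient x₀ x} :
    (mk p = mk q) ↔ diffLoop p q ∈ commutator (FundamentalGroup X x₀) := by
  constructor
  · intro h
    exact Quotient.exact (s := pathSetoid x₀ x) (eq_of_heq (Sigma.mk.inj h).2)
  · intro h
    exact congrArg (Sigma.mk x) (Quotient.sound (s := pathSetoid x₀ x) h)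

lemma mk_trans_eq_mk_trans {x y : X} {p q : Path.Homotopic.Quotient x₀ x}
    (r : Path.Homotopic.Quotient x y) : (mk (p.trans r) = mk (q.trans r)) ↔ mk p = mk q := by
  have h : (q.trans r).symm = r.symm.trans q.symm := by
    obtain ⟨r, rfl⟩ := Path.Homotopic.Quotient.mk_surjective r
    obtain ⟨q, rfl⟩ := Path.Homotopic.Quotient.mk_surjective q
    rw [← Path.Homotopic.Quotient.mk_trans, ← Path.Homotopic.Quotient.mk_symm, Path.trans_symm]
    rfl
  have : diffLoop (p.trans r) (q.trans r) = diffLoop p q := by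
    change (p.trans r).trans (q.trans r).symm = p.trans q.symm
    rw [h, Path.Homotopic.Quotient.trans_assoc, ← Path.Homotopic.Quotient.trans_assoc r,
      Path.Homotopic.Quotient.trans_symm, Path.Homotopic.Quotient.refl_trans]
  rw [mk_eq_mk, mk_eq_mk, this]

lemma exists_mk (e : MaxAbCover X x₀) : ∃ p : Path.Homotopic.Quotient x₀ e.1, e = mk p := by
  obtain ⟨x, a⟩ := e
  obtain ⟨p, rfl⟩ := Quotient.exists_rep a
  exact ⟨p, rfl⟩

lemma mk_mem_basic {x : X} (p : Path.Homotopic.Quotient x₀ x) {U : Set X} (hx : x ∈ U) :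
    mk p ∈ basic p U := by
  refine ⟨x, Path.refl x, fun _ => hx, ?_⟩
  rw [Path.Homotopic.Quotient.mk_refl, Path.Homotopic.Quotient.trans_refl]

lemma isOpen_basic {x : X} (p : Path.Homotopic.Quotient x₀ x) {U : Set X} (hU : IsOpen U)
    (hx : x ∈ U) :
    IsOpen (basic p U) :=
  TopologicalSpace.isOpen_generateFrom_of_mem ⟨x, p, U, hU, hx, rfl⟩

variable (X x₀) in
/-- The covering map. -/
def proj : C(MaxAbCover X x₀, X) where
  toFun e := e.1
  continuous_toFun := by
    refine continuous_def.mpr fun U hU => isOpen_iff_mem_nhds.mpr fun e he => ?_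
    obtain ⟨p, hp⟩ := exists_mk e
    have hmem : e ∈ basic p U := by
      have := mk_mem_basic p (U := U) he
      rwa [← hp] at this
    refine Filter.mem_of_superset ((isOpen_basic p hU he).mem_nhds hmem) ?_
    rintro _ ⟨y, q, hq, rfl⟩
    have := hq 1
    rwa [q.target] at this

lemma proj_comp_deck (k : DeckGroup X x₀) : (proj X x₀).comp (deck x₀ k) = proj X x₀ := rfl

lemma exists_deck_eq {e e' : MaxAbCover X x₀} (h : proj X x₀ e = proj X x₀ e') :
    ∃ k, deck x₀ k e = e' := by
  obtain ⟨x, a⟩ := e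
  obtain ⟨x', a'⟩ := e'
  obtain rfl : x = x' := h
  obtain ⟨p, hp⟩ := exists_mk ⟨x, a⟩
  obtain ⟨q, hq⟩ := exists_mk ⟨x, a'⟩
  rw [hp, hq]
  refine ⟨Abelianization.of (diffLoop q p), ?_⟩
  refine (deckFun_mk x₀ _ p).trans (congrArg mk ?_)
  refine (Path.Homotopic.Quotient.trans_assoc _ _ _).trans ?_
  rw [Path.Homotopic.Quotient.symm_trans, Path.Homotopic.Quotient.trans_refl]

lemma deck_injective {k l : DeckGroup X x₀} {e : MaxAbCover X x₀}
    (h : deck x₀ k e = deck x₀ l e) : k = l := by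
  obtain ⟨p, hp⟩ := exists_mk e
  obtain ⟨g, rfl⟩ : ∃ g, Abelianization.of g = k := QuotientGroup.mk_surjective k
  obtain ⟨g', rfl⟩ : ∃ g', Abelianization.of g' = l := QuotientGroup.mk_surjective l
  rw [hp] at h
  have h1 := mk_eq_mk.mp (((deckFun_mk x₀ g p).symm.trans h).trans (deckFun_mk x₀ g' p))
  have h2 : diffLoop (loopTrans g p) (loopTrans g' p) = g'⁻¹ * g := by
    rw [diffLoop_loopTrans, ← diffLoop_inv, diffLoop_loopTrans, diffLoop_self, one_mul]
  rw [h2] at h1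
  exact (QuotientGroup.eq.mpr h1).symm

lemma deck_mul_apply (k l : DeckGroup X x₀) (e : MaxAbCover X x₀) :
    deck x₀ (k * l) e = deck x₀ k (deck x₀ l e) := deckFun_mul x₀ k l e

lemma deck_one_apply (e : MaxAbCover X x₀) : deck x₀ 1 e = e := deckFun_one x₀ e

section Lift

variable {Z : Type} [TopologicalSpace Z]

/-- The lift of a map `f` on a simply connected space that starts at the point `[p]`. -/
def liftFun [SimplyConnectedSpace Z] (f : C(Z, X)) (z₀ : Z) (p : Path.Homotopic.Quotient x₀ (f z₀))
    (z : Z) :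
    MaxAbCover X x₀ :=
  mk (p.trans ((Path.Homotopic.Quotient.mk (PathConnectedSpace.somePath z₀ z)).map f))

lemma liftFun_eq [SimplyConnectedSpace Z] (f : C(Z, X)) (z₀ : Z)
    (p : Path.Homotopic.Quotient x₀ (f z₀)) {z : Z}
    (γ : Path z₀ z) : liftFun f z₀ p z = mk (p.trans ((Path.Homotopic.Quotient.mk γ).map f)) := by
  rw [liftFun, Path.Homotopic.Quotient.eq.mpr (SimplyConnectedSpace.paths_homotopic _ γ)]

lemma map_trans {x y z : Z} (γ : Path.Homotopic.Quotient x y) (δ : Path.Homotopic.Quotient y z)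
    (f : C(Z, X)) :
    (γ.trans δ).map f = (γ.map f).trans (δ.map f) :=
  (FundamentalGroupoid.map f).map_comp γ δ

lemma continuous_liftFun [SimplyConnectedSpace Z] [LocallyPathConnectedSpace Z] (f : C(Z, X))
    (z₀ : Z) (p : Path.Homotopic.Quotient x₀ (f z₀)) : Continuous (liftFun f z₀ p) := by
  refine continuous_generateFrom_iff.mpr ?_
  rintro _ ⟨x, p', U, hU, hx, rfl⟩
  refine isOpen_iff_mem_nhds.mpr fun z hz => ?_
  obtain ⟨y, q, hq, he⟩ := hz
  obtain rfl : f z = y := congrArg Sigma.fst he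
  have hfz : f z ∈ U := by simpa using hq 1
  obtain ⟨V, ⟨hV, hVc⟩, hVU⟩ := (LocallyPathConnectedSpace.path_connected_basis z).mem_iff.mp
    ((hU.preimage f.continuous).mem_nhds hfz)
  refine Filter.mem_of_superset hV fun z' hz' => ?_
  obtain ⟨δ, hδ⟩ := hVc.joinedIn z (mem_of_mem_nhds hV) z' hz'
  let γ := PathConnectedSpace.somePath z₀ z
  refine ⟨f z', q.trans (δ.map f.continuous), fun s => ?_, ?_⟩
  · have : q.trans (δ.map f.continuous) s ∈ Set.range q ∪ Set.range (δ.map f.continuous) := by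
      rw [← Path.trans_range]
      exact ⟨s, rfl⟩
    rcases this with ⟨s, hs⟩ | ⟨s, hs⟩
    · rw [← hs]
      exact hq s
    · rw [← hs]
      exact hVU (hδ s)
  · rw [liftFun_eq f z₀ p (γ.trans δ), Path.Homotopic.Quotient.mk_trans, map_trans,
      ← Path.Homotopic.Quotient.trans_assoc,
      Path.Homotopic.Quotient.mk_trans, ← Path.Homotopic.Quotient.trans_assoc,
          Path.Homotopic.Quotient.mk_map δ f]
    rw [mk_trans_eq_mk_trans]
    exact (liftFun_eq f z₀ p γ).symm.trans he

/-- `liftFun` as a continuous map. -/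
def lift [SimplyConnectedSpace Z] [LocallyPathConnectedSpace Z] (f : C(Z, X))
    (z₀ : Z) (p : Path.Homotopic.Quotient x₀ (f z₀)) : C(Z, MaxAbCover X x₀) :=
  ⟨liftFun f z₀ p, continuous_liftFun f z₀ p⟩

lemma lift_apply [SimplyConnectedSpace Z] [LocallyPathConnectedSpace Z] (f : C(Z, X))
    (z₀ : Z) (p : Path.Homotopic.Quotient x₀ (f z₀)) {z : Z} (γ : Path z₀ z) :
    lift f z₀ p z = mk (p.trans ((Path.Homotopic.Quotient.mk γ).map f)) := liftFun_eq f z₀ p γ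

lemma lift_base [SimplyConnectedSpace Z] [LocallyPathConnectedSpace Z] (f : C(Z, X))
    (z₀ : Z) (p : Path.Homotopic.Quotient x₀ (f z₀)) : lift f z₀ p z₀ = mk p := by
  rw [lift_apply f z₀ p (Path.refl z₀), Path.Homotopic.Quotient.mk_refl]
  exact congrArg mk (Path.Homotopic.Quotient.trans_refl p)

lemma proj_comp_lift [SimplyConnectedSpace Z] [LocallyPathConnectedSpace Z] (f : C(Z, X))
    (z₀ : Z) (p : Path.Homotopic.Quotient x₀ (f z₀)) : (proj X x₀).comp (lift f z₀ p) = f := rfl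

/-- Over a set `U` in which any two paths with the same endpoints are homotopic, a basic neighbourhood
has at most one point over each point of the base, and different centres over the same point have
disjoint basic neighbourhoods. -/
lemma eq_iff_of_mem_basic {x : X} {p p' : Path.Homotopic.Quotient x₀ x} {U : Set X}
    (hU : ∀ (y z : X) (p q : Path y z), (∀ s, p s ∈ U) → (∀ s, q s ∈ U) → Path.Homotopic p q)
    {w w' : MaxAbCover X x₀} (hw : w ∈ basic p U) (hw' : w' ∈ basic p' U)
    (h : proj X x₀ w = proj X x₀ w') : w = w' ↔ mk p = mk p' := by
  obtain ⟨y, q, hq, rfl⟩ := hw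
  obtain ⟨y', q', hq', rfl⟩ := hw'
  obtain rfl : y = y' := h
  rw [Path.Homotopic.Quotient.eq.mpr (hU _ _ q q' hq hq'), mk_trans_eq_mk_trans]

/-- Lifts are unique. -/
lemma eq_of_proj_comp_eq [UniqueLocalPaths X] [PreconnectedSpace Z] {f g : C(Z, MaxAbCover X x₀)}
    (h : (proj X x₀).comp f = (proj X x₀).comp g) {z₀ : Z} (h₀ : f z₀ = g z₀) : f = g := by
  have hfg (z : Z) : proj X x₀ (f z) = proj X x₀ (g z) := congrArg (fun φ : C(Z, X) => φ z) h
  have hloc : IsLocallyConstant fun z => f z = g z := by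
    refine (IsLocallyConstant.iff_eventually_eq _).mpr fun z => ?_
    obtain ⟨x, p, hp⟩ : ∃ (x : X) (p : Path.Homotopic.Quotient x₀ x), f z = mk p :=
        ⟨_, exists_mk (f z)⟩
    obtain ⟨x', p', hp'⟩ : ∃ (x : X) (p : Path.Homotopic.Quotient x₀ x), g z = mk p :=
        ⟨_, exists_mk (g z)⟩
    obtain rfl : x = x' := by
      have := hfg z
      rwa [hp, hp'] at this
    obtain ⟨U, hUo, hx, hU⟩ := UniqueLocalPaths.exists_nhd x
    have h1 : ∀ᶠ z' in nhds z, f z' ∈ basic p U :=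
      f.continuous.continuousAt.eventually ((isOpen_basic p hUo hx).mem_nhds
        (hp ▸ mk_mem_basic p hx))
    have h2 : ∀ᶠ z' in nhds z, g z' ∈ basic p' U :=
      g.continuous.continuousAt.eventually ((isOpen_basic p' hUo hx).mem_nhds
        (hp' ▸ mk_mem_basic p' hx))
    filter_upwards [h1, h2] with z' h1 h2
    rw [eq_iff_of_mem_basic hU h1 h2 (hfg z'), hp, hp']
  ext1 z
  have := hloc.apply_eq_of_preconnectedSpace z z₀
  exact this.mpr h₀

lemma eq_lift [UniqueLocalPaths X] [SimplyConnectedSpace Z] [LocallyPathConnectedSpace Z]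
    (f : C(Z, MaxAbCover X x₀)) (z₀ : Z) (p : Path.Homotopic.Quotient x₀ (proj X x₀ (f z₀)))
        (h : f z₀ = mk p) :
    f = lift ((proj X x₀).comp f) z₀ p :=
  eq_of_proj_comp_eq (proj_comp_lift _ _ _).symm (z₀ := z₀) (by rw [lift_base]; exact h)

end Lift

end MaxAbCover

lemma Convex.locallyPathConnectedSpace {E : Type} [NormedAddCommGroup E] [NormedSpace ℝ E]
    {S : Set E} (hS : Convex ℝ S) : LocallyPathConnectedSpace S := by
  refine LocallyPathConnectedSpace.of_bases (fun x => Metric.nhds_basis_ball) fun x r hr => ?_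
  rw [Topology.IsInducing.subtypeVal.isPathConnected_iff]
  have : (Subtype.val '' Metric.ball x r) = S ∩ Metric.ball (x : E) r := by
    ext y
    constructor
    · rintro ⟨z, hz, rfl⟩
      exact ⟨z.2, hz⟩
    · rintro ⟨h1, h2⟩
      exact ⟨⟨y, h1⟩, h2, rfl⟩
  rw [this]
  exact (hS.inter (convex_ball _ _)).isPathConnected ⟨x, x.2, Metric.mem_ball_self hr⟩

lemma Convex.simplyConnectedSpace {E : Type} [NormedAddCommGroup E] [NormedSpace ℝ E]
    {S : Set E} (hS : Convex ℝ S) (hne : S.Nonempty) : SimplyConnectedSpace S :=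
  have := hS.contractibleSpace hne
  inferInstance

instance (q : ℕ) : SimplyConnectedSpace (Simplex q) :=
  Convex.simplyConnectedSpace (convex_stdSimplex ℝ _) ⟨_, (stdSimplex.vertex (0 : Fin (q + 1))).2⟩

instance (q : ℕ) : LocallyPathConnectedSpace (Simplex q) :=
  Convex.locallyPathConnectedSpace (convex_stdSimplex ℝ _)

instance : SimplyConnectedSpace unitInterval :=
  Convex.simplyConnectedSpace (convex_Icc (0 : ℝ) 1) ⟨0, by simp⟩

instance : LocallyPathConnectedSpace unitInterval :=
  Convex.locallyPathConnectedSpace (convex_Icc (0 : ℝ) 1)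

/-! ### Path characters and functions on the maximal abelian cover -/

/-- A homomorphism from the fundamental groupoid of `X` to a commutative group. -/
structure PathCharacter (X A : Type) [TopologicalSpace X] [CommGroup A] where
  val : ∀ {x y : X}, Path.Homotopic.Quotient x y → A
  val_trans : ∀ {x y z : X} (γ : Path.Homotopic.Quotient x y) (δ : Path.Homotopic.Quotient y z),
    val (γ.trans δ) = val γ * val δ

namespace PathCharacter

variable {X A : Type} [TopologicalSpace X] [CommGroup A] (χ : PathCharacter X A) (x₀ : X)

lemma val_refl (x : X) : χ.val (Path.Homotopic.Quotient.refl x) = 1 := by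
  have := χ.val_trans (Path.Homotopic.Quotient.refl x) (Path.Homotopic.Quotient.refl x)
  rw [Path.Homotopic.Quotient.refl_trans] at this
  exact left_eq_mul.mp this

lemma val_symm {x y : X} (γ : Path.Homotopic.Quotient x y) : χ.val γ.symm = (χ.val γ)⁻¹ := by
  rw [eq_inv_iff_mul_eq_one, ← χ.val_trans, Path.Homotopic.Quotient.symm_trans, χ.val_refl]

/-- The restriction to loops at `x₀`. -/
def loopHom : FundamentalGroup X x₀ →* A where
  toFun g := χ.val (FundamentalGroup.toPath g)
  map_one' := χ.val_refl x₀
  map_mul' _ _ := (χ.val_trans _ _).trans (mul_comm _ _)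

/-- The induced character of `K = H₁(X; ℤ)`. -/
def deckHom : DeckGroup X x₀ →* A := Abelianization.lift (χ.loopHom x₀)

variable {x₀}

lemma val_eq_of_mk_eq {x : X} {p q : Path.Homotopic.Quotient x₀ x}
    (h : diffLoop p q ∈ commutator (FundamentalGroup X x₀)) : χ.val p = χ.val q := by
  have h1 : χ.loopHom x₀ (diffLoop p q) = 1 :=
    Abelianization.commutator_subset_ker (χ.loopHom x₀) h
  have h2 : χ.val (p.trans q.symm) = 1 := h1
  rwa [χ.val_trans, χ.val_symm, mul_inv_eq_one] at h2

/-- The function on the cover whose value at `[p]` is the value of the character on `p`. -/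
def onCover (e : MaxAbCover X x₀) : A :=
  Quotient.lift (s := pathSetoid x₀ e.1) (fun p => χ.val p)
    (fun _ _ h => χ.val_eq_of_mk_eq h) e.2

lemma onCover_deck (k : DeckGroup X x₀) (e : MaxAbCover X x₀) :
    χ.onCover (deck x₀ k e) = χ.deckHom x₀ k * χ.onCover e := by
  obtain ⟨p, hp⟩ := MaxAbCover.exists_mk e
  obtain ⟨g, rfl⟩ : ∃ g, Abelianization.of g = k := QuotientGroup.mk_surjective k
  rw [hp]
  exact χ.val_trans _ _

lemma onCover_path [UniqueLocalPaths X] {Z : Type} [TopologicalSpace Z] [SimplyConnectedSpace Z]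
    [LocallyPathConnectedSpace Z] (f : C(Z, MaxAbCover X x₀)) {z₀ z : Z} (γ : Path z₀ z) :
    χ.onCover (f z) = χ.onCover (f z₀) *
      χ.val ((Path.Homotopic.Quotient.mk γ).map ((MaxAbCover.proj X x₀).comp f)) := by
  obtain ⟨p, hp⟩ := MaxAbCover.exists_mk (f z₀)
  have h1 := MaxAbCover.eq_lift f z₀ p hp
  have h2 : f z = _ := (congrArg (fun φ : C(Z, MaxAbCover X x₀) => φ z) h1).trans
    (MaxAbCover.lift_apply ((MaxAbCover.proj X x₀).comp f) z₀ p γ)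
  rw [h2, hp]
  exact χ.val_trans _ _

end PathCharacter

/-! ### Vertices and edges -/

section Vertices

variable {X : Type} [TopologicalSpace X]

lemma face_vertex {q : ℕ} (σ : C(Simplex (q + 1), X)) (i : Fin (q + 2)) (j : Fin (q + 1)) :
    face σ i (stdSimplex.vertex j) = σ (stdSimplex.vertex (i.succAbove j)) :=
  congrArg σ (stdSimplex.map_vertex i.succAbove j)

/-- A point as a singular `0`-simplex. -/
def pt (x : X) : C(Simplex 0, X) := ContinuousMap.const _ x

lemma eq_pt (σ : C(Simplex 0, X)) : σ = pt (σ (stdSimplex.vertex 0)) := by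
  ext t
  exact congrArg σ (Subsingleton.elim (α := stdSimplex ℝ (Fin 1)) _ _)

lemma bdry_edge {R : Type} [CommRing R] (σ : C(Simplex 1, X)) (r : R) :
    Chain.bdry R 0 X (Finsupp.single σ r) =
      Finsupp.single (pt (σ (stdSimplex.vertex 1))) r -
        Finsupp.single (pt (σ (stdSimplex.vertex 0))) r := by
  rw [Chain.bdry_single, Fin.sum_univ_two, eq_pt (face σ 0), eq_pt (face σ 1), face_vertex,
    face_vertex, sub_eq_add_neg, ← Finsupp.single_neg]
  simp

/-- A path as a singular `1`-simplex. -/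
def simplexOfPath {x y : X} (γ : Path x y) : C(Simplex 1, X) where
  toFun t := γ ⟨t 1, stdSimplex.zero_le t 1, stdSimplex.le_one t 1⟩
  continuous_toFun := γ.continuous.comp (Continuous.subtype_mk (continuous_coord 1) _)

lemma simplexOfPath_vertex_zero {x y : X} (γ : Path x y) :
    simplexOfPath γ (stdSimplex.vertex 0) = x := by
  refine Eq.trans (congrArg γ (Subtype.ext ?_)) γ.source
  simp

lemma simplexOfPath_vertex_one {x y : X} (γ : Path x y) :
    simplexOfPath γ (stdSimplex.vertex 1) = y := by
  refine Eq.trans (congrArg γ (Subtype.ext ?_)) γ.target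
  simp

lemma Chain.map_comp {R : Type} [CommRing R] {q : ℕ} {Y Z : Type} [TopologicalSpace Y]
    [TopologicalSpace Z] (f : C(Y, Z)) (g : C(X, Y)) (c : Chain R q X) :
    Chain.map R q (f.comp g) c = Chain.map R q f (Chain.map R q g c) := by
  induction c using Finsupp.induction_linear with
  | zero => simp
  | add c d hc hd => simp [hc, hd]
  | single σ r =>
    simp only [Chain.map_single]
    rfl

end Vertices

namespace MaxAbCover

variable {X : Type} [TopologicalSpace X] {x₀ : X}

lemma joined_mk {x : X} (p : Path x₀ x) :
    Joined (mk (Path.Homotopic.Quotient.refl x₀)) (mk (Path.Homotopic.Quotient.mk p)) := by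
  obtain ⟨f, rfl, rfl⟩ := p
  let γ : Path (0 : unitInterval) 1 := ⟨ContinuousMap.id _, rfl, rfl⟩
  refine ⟨⟨lift f 0 (Path.Homotopic.Quotient.refl _), lift_base _ _ _, ?_⟩⟩
  refine (lift_apply f 0 (Path.Homotopic.Quotient.refl _) γ).trans ?_
  rw [Path.Homotopic.Quotient.refl_trans]
  rfl

instance : PathConnectedSpace (MaxAbCover X x₀) := by
  have h (e : MaxAbCover X x₀) : Joined (mk (Path.Homotopic.Quotient.refl x₀)) e := by
    obtain ⟨p, hp⟩ := exists_mk e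
    obtain ⟨p, rfl⟩ := Path.Homotopic.Quotient.mk_surjective p
    rw [hp]
    exact joined_mk p
  exact ⟨⟨mk (Path.Homotopic.Quotient.refl x₀)⟩, fun e e' => (h e).symm.trans (h e')⟩

lemma exists_lift_simplex [PathConnectedSpace X] {q : ℕ} (σ : C(Simplex q, X)) :
    ∃ σ' : C(Simplex q, MaxAbCover X x₀), (proj X x₀).comp σ' = σ :=
  ⟨lift σ (stdSimplex.vertex 0) (Path.Homotopic.Quotient.mk (PathConnectedSpace.somePath _ _)),
    proj_comp_lift _ _ _⟩

lemma exists_deck_comp_eq [UniqueLocalPaths X] {Z : Type} [TopologicalSpace Z]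
    [PreconnectedSpace Z] [Nonempty Z]
    {f g : C(Z, MaxAbCover X x₀)} (h : (proj X x₀).comp f = (proj X x₀).comp g) :
    ∃ k, (deck x₀ k).comp f = g := by
  obtain ⟨z⟩ := ‹Nonempty Z›
  obtain ⟨k, hk⟩ := exists_deck_eq (congrArg (fun φ : C(Z, X) => φ z) h)
  exact ⟨k, eq_of_proj_comp_eq h hk⟩

end MaxAbCover

/-! ### Equivariant cochains on the cover -/

section Pull

variable {X : Type} [TopologicalSpace X] {x₀ : X}

variable (x₀) in
/-- The deck transformation `k` on singular chains of the cover. -/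
abbrev deckChain (q : ℕ) (k : DeckGroup X x₀) :
    Chain ℂ q (MaxAbCover X x₀) →ₗ[ℂ] Chain ℂ q (MaxAbCover X x₀) :=
  Chain.map ℂ q (deck x₀ k)

lemma deckChain_mul (q : ℕ) (k l : DeckGroup X x₀) (c : Chain ℂ q (MaxAbCover X x₀)) :
    deckChain x₀ q (k * l) c = deckChain x₀ q k (deckChain x₀ q l c) := by
  rw [← Chain.map_comp]
  congr 1
  exact congrArg _ (ContinuousMap.ext (deckFun_mul x₀ k l))

variable (χ : PathCharacter X ℂˣ)

/-- A twisted cochain of `X`, pulled back to the cover, where the local system is trivialized, as a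
linear form on singular chains. -/
def pull (q : ℕ) (c : C(Simplex q, X) → ℂ) : Chain ℂ q (MaxAbCover X x₀) →ₗ[ℂ] ℂ :=
  Finsupp.linearCombination ℂ fun σ =>
    (χ.onCover (σ (stdSimplex.vertex 0)) : ℂ) * c ((MaxAbCover.proj X x₀).comp σ)

lemma pull_single (q : ℕ) (c : C(Simplex q, X) → ℂ) (σ : C(Simplex q, MaxAbCover X x₀)) (r : ℂ) :
    pull χ q c (Finsupp.single σ r) = r * ((χ.onCover (σ (stdSimplex.vertex 0)) : ℂ) *
      c ((MaxAbCover.proj X x₀).comp σ)) := by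
  simp [pull, Finsupp.linearCombination_single]

lemma pull_deck (q : ℕ) (c : C(Simplex q, X) → ℂ) (k : DeckGroup X x₀)
    (z : Chain ℂ q (MaxAbCover X x₀)) :
    pull χ q c (deckChain x₀ q k z) = χ.deckHom x₀ k * pull χ q c z := by
  induction z using Finsupp.induction_linear with
  | zero => simp
  | add c d hc hd => simp only [map_add, hc, hd, mul_add]
  | single σ r =>
    rw [Chain.map_single, pull_single, pull_single, ← ContinuousMap.comp_assoc,
      MaxAbCover.proj_comp_deck]
    have : ((deck x₀ k).comp σ) (stdSimplex.vertex 0) = deck x₀ k (σ (stdSimplex.vertex 0)) := rfl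
    rw [this, χ.onCover_deck]
    push_cast
    ring

lemma pull_injective [PathConnectedSpace X] {q : ℕ} {c d : C(Simplex q, X) → ℂ}
    (h : pull (x₀ := x₀) χ q c = pull χ q d) : c = d := by
  funext σ
  obtain ⟨σ', rfl⟩ := MaxAbCover.exists_lift_simplex (x₀ := x₀) σ
  have := congrArg (fun f : Chain ℂ q (MaxAbCover X x₀) →ₗ[ℂ] ℂ => f (Finsupp.single σ' 1)) h
  simpa [pull_single] using this

/-- An equivariant cochain of the cover is the pullback of a twisted cochain of `X`. -/
lemma exists_pull_eq [PathConnectedSpace X] [UniqueLocalPaths X] {q : ℕ}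
    (H : Chain ℂ q (MaxAbCover X x₀) →ₗ[ℂ] ℂ)
    (hH : ∀ k z, H (deckChain x₀ q k z) = χ.deckHom x₀ k * H z) : ∃ c, pull χ q c = H := by
  choose s hs using fun σ : C(Simplex q, X) => MaxAbCover.exists_lift_simplex (x₀ := x₀) σ
  refine ⟨fun σ => H (Finsupp.single (s σ) 1) / χ.onCover (s σ (stdSimplex.vertex 0)), ?_⟩
  refine Finsupp.lhom_ext' fun σ => LinearMap.ext_ring ?_
  obtain ⟨k, hk⟩ := MaxAbCover.exists_deck_comp_eq (hs ((MaxAbCover.proj X x₀).comp σ))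
  have h1 : H (Finsupp.single σ 1) =
      χ.deckHom x₀ k * H (Finsupp.single (s ((MaxAbCover.proj X x₀).comp σ)) 1) := by
    rw [← hH, Chain.map_single, hk]
  have h2 : χ.onCover (σ (stdSimplex.vertex 0)) =
      χ.deckHom x₀ k * χ.onCover (s ((MaxAbCover.proj X x₀).comp σ) (stdSimplex.vertex 0)) := by
    conv_lhs => rw [← hk]
    exact χ.onCover_deck k _
  simp only [LinearMap.comp_apply, Finsupp.lsingle_apply]
  rw [pull_single, h1, h2]
  push_cast
  field_simp

end Pull

/-! ### First cohomology of a nontrivial rank one local system -/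

section LocalSystem

variable {X : Type} [TopologicalSpace X] {x₀ : X} (L : RankOneLocalSystem X)

/-- The transport of a local system as a path character. -/
def RankOneLocalSystem.pathCharacter : PathCharacter X ℂˣ := ⟨L.transport, L.transport_trans⟩

lemma pull_coboundary [UniqueLocalPaths X] (q : ℕ) (c : L.Cochain q)
    (z : Chain ℂ (q + 1) (MaxAbCover X x₀)) :
    pull L.pathCharacter (q + 1) (L.coboundary q c) z =
      pull L.pathCharacter q c (Chain.bdry ℂ q _ z) := by
  induction z using Finsupp.induction_linear with
  | zero => simp
  | add c d hc hd => simp only [map_add, hc, hd]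
  | single σ r =>
    rw [pull_single, Chain.bdry_single, map_sum, Fin.sum_univ_succ, pull_single]
    have h1 : L.pathCharacter.onCover (face σ 0 (stdSimplex.vertex 0)) =
        L.pathCharacter.onCover (σ (stdSimplex.vertex 0)) *
        L.transport (Path.Homotopic.Quotient.mk
          (RankOneLocalSystem.edge ((MaxAbCover.proj X x₀).comp σ))) := by
      rw [face_vertex]
      exact L.pathCharacter.onCover_path σ (RankOneLocalSystem.stdEdge q)
    have h2 (i : Fin (q + 1)) : L.pathCharacter.onCover (face σ i.succ (stdSimplex.vertex 0)) =
        L.pathCharacter.onCover (σ (stdSimplex.vertex 0)) := by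
      rw [face_vertex, Fin.succ_succAbove_zero]
    simp only [pull_single, h1, h2]
    have h3 (i : Fin (q + 2)) : (MaxAbCover.proj X x₀).comp (face σ i) =
        face ((MaxAbCover.proj X x₀).comp σ) i := rfl
    simp only [h3, RankOneLocalSystem.coboundary, LinearMap.coe_mk, AddHom.coe_mk]
    rw [mul_add, mul_add, Finset.mul_sum, Finset.mul_sum]
    congr 1
    · push_cast
      simp only [Fin.val_zero, pow_zero, mul_one]
      ring
    · refine Finset.sum_congr rfl fun i _ => ?_
      simp
      ring

end LocalSystem

/-! ### Linear forms on the Alexander invariant -/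

section CharDual

variable {X : Type} [TopologicalSpace X] (x₀ : X)

/-- The linear forms on `H₁(X'; ℂ)` on which `K` acts through the character `ρ`. This is the dual of
the fibre at `ρ` of the Alexander invariant. -/
def charDual (ρ : DeckGroup X x₀ →* ℂˣ) :
    Submodule ℂ (Module.Dual ℂ (singularHomology ℂ 1 (MaxAbCover X x₀))) where
  carrier := {φ | ∀ k b, φ (deckRep x₀ k b) = ρ k * φ b}
  add_mem' := fun {φ ψ} hφ hψ k b => by
    rw [LinearMap.add_apply, LinearMap.add_apply, hφ, hψ, mul_add]
  zero_mem' := fun k b => by simp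
  smul_mem' := fun a φ hφ k b => by
    rw [LinearMap.smul_apply, LinearMap.smul_apply, hφ, smul_eq_mul, smul_eq_mul]
    ring

/-- The homology class of a `1`-cycle. -/
abbrev homologyClass (T : Type) [TopologicalSpace T] :
    Chain.cycles ℂ 0 T →ₗ[ℂ] singularHomology ℂ 1 T := Chain.toHomology ℂ 0 T

lemma homologyClass_surjective (T : Type) [TopologicalSpace T] :
    Function.Surjective (homologyClass T) := Chain.toHomology_surjective

lemma exists_factor_of_surjective {R M M' N : Type} [CommRing R] [AddCommGroup M] [Module R M]
    [AddCommGroup M'] [Module R M'] [AddCommGroup N] [Module R N] {f : M →ₗ[R] M'}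
    (hf : Function.Surjective f) (ψ : M →ₗ[R] N) (h : ∀ z, f z = 0 → ψ z = 0) :
    ∃ φ : M' →ₗ[R] N, ∀ z, φ (f z) = ψ z := by
  refine ⟨((LinearMap.ker f).liftQ ψ h).comp
    (f.quotKerEquivOfSurjective hf).symm.toLinearMap, fun z => ?_⟩
  have : (f.quotKerEquivOfSurjective hf).symm (f z) = Submodule.Quotient.mk z := by
    rw [LinearEquiv.symm_apply_eq]
    rfl
  simp only [LinearMap.comp_apply, LinearEquiv.coe_coe, this]
  rfl

/-- A linear map on chains that vanishes on boundaries descends to homology. -/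
lemma exists_descend {R : Type} [CommRing R] {N : Type} [AddCommGroup N] [Module R N] {q : ℕ}
    {T : Type} [TopologicalSpace T] (ψ : Chain R (q + 1) T →ₗ[R] N)
    (hψ : ∀ c, ψ (Chain.bdry R (q + 1) T c) = 0) :
    ∃ φ : singularHomology R (q + 1) T →ₗ[R] N, ∀ z, φ (Chain.toHomology R q T z) = ψ z := by
  have hs := Chain.toHomology_surjective (R := R) (q := q) (X := T)
  have h : ∀ z, Chain.toHomology R q T z = 0 → (ψ.domRestrict (Chain.cycles R q T)) z = 0 := by
    intro z hz
    obtain ⟨c, hc⟩ := (Chain.toHomology_eq_zero_iff z).mp hz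
    rw [LinearMap.domRestrict_apply, ← hc, hψ]
  generalize Chain.toHomology R q T = f at *
  exact exists_factor_of_surjective (M := Chain.cycles R q T) (M' := singularHomology R (q + 1) T)
    (N := N) (f := f) hs (ψ.domRestrict (Chain.cycles R q T)) h

variable {x₀}

/-- The action of a deck transformation on cycles. -/
def deckCycle (k : DeckGroup X x₀) (z : Chain.cycles ℂ 0 (MaxAbCover X x₀)) :
    Chain.cycles ℂ 0 (MaxAbCover X x₀) :=
  ⟨deckChain x₀ 1 k z, by
    have h : Chain.bdry ℂ 0 _ (z : Chain ℂ 1 (MaxAbCover X x₀)) = 0 := z.2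
    rw [LinearMap.mem_ker, Chain.bdry_map, h, map_zero]⟩

lemma deckRep_homologyClass (k : DeckGroup X x₀) (z : Chain.cycles ℂ 0 (MaxAbCover X x₀)) :
    deckRep x₀ k (homologyClass _ z) = homologyClass _ (deckCycle k z) :=
  Chain.singularHomologyMap_toHomology (deck x₀ k) z (deckCycle k z) rfl

lemma mem_charDual_iff {ρ : DeckGroup X x₀ →* ℂˣ}
    {φ : Module.Dual ℂ (singularHomology ℂ 1 (MaxAbCover X x₀))} :
    φ ∈ charDual x₀ ρ ↔
      ∀ k z, φ (homologyClass _ (deckCycle k z)) = ρ k * φ (homologyClass _ z) := by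
  constructor
  · intro h k z
    rw [← deckRep_homologyClass]
    exact h k _
  · intro h k b
    obtain ⟨z, rfl⟩ := homologyClass_surjective _ b
    rw [deckRep_homologyClass]
    exact h k z

lemma homologyClass_bdry (T : Type) [TopologicalSpace T] (c : Chain ℂ 2 T)
    (h : Chain.bdry ℂ 1 T c ∈ Chain.cycles ℂ 0 T) : homologyClass T ⟨_, h⟩ = 0 :=
  (Chain.toHomology_eq_zero_iff _).mpr ⟨c, rfl⟩

end CharDual

section Twisted

variable {X : Type} [TopologicalSpace X] [UniqueLocalPaths X] {x₀ : X} (L : RankOneLocalSystem X)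

variable (x₀) in
/-- The evaluation of twisted `1`-cocycles on the homology of the cover. -/
lemma exists_cocycleToDual : ∃ Ψ : LinearMap.ker (L.coboundary 1) →ₗ[ℂ]
    charDual x₀ (L.character x₀), ∀ c z,
      (Ψ c).1 (homologyClass _ z) = pull L.pathCharacter 1 c.1 z.1 := by
  have h0 (c : LinearMap.ker (L.coboundary 1)) (d) :
      pull (x₀ := x₀) L.pathCharacter 1 c.1 (Chain.bdry ℂ 1 _ d) = 0 := by
    have : L.coboundary 1 c.1 = 0 := c.2
    rw [← pull_coboundary, this]
    induction d using Finsupp.induction_linear with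
    | zero => simp
    | add c d hc hd => simp only [map_add, hc, hd, add_zero]
    | single σ r => simp [pull_single]
  choose φ hφ using fun c => exists_descend _ (h0 c)
  have hmem (c) : φ c ∈ charDual x₀ (L.character x₀) := by
    rw [mem_charDual_iff]
    intro k z
    rw [hφ, hφ]
    exact pull_deck L.pathCharacter 1 _ k _
  have hext (φ ψ : charDual x₀ (L.character x₀))
      (h : ∀ z, φ.1 (homologyClass _ z) = ψ.1 (homologyClass _ z)) : φ = ψ := by
    refine Subtype.ext (LinearMap.ext fun b => ?_)
    obtain ⟨z, rfl⟩ := homologyClass_surjective _ b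
    exact h z
  have hadd (c d) : (⟨φ (c + d), hmem _⟩ : charDual x₀ (L.character x₀)) =
      ⟨φ c, hmem c⟩ + ⟨φ d, hmem d⟩ := by
    refine hext _ _ fun z => ?_
    change φ (c + d) _ = φ c _ + φ d _
    rw [hφ, hφ, hφ]
    generalize (z : Chain ℂ 1 (MaxAbCover X x₀)) = z'
    induction z' using Finsupp.induction_linear with
    | zero => simp
    | add z w hz hw => rw [map_add, map_add, map_add, hz, hw]; ring
    | single σ r =>
      rw [pull_single, pull_single, pull_single, Submodule.coe_add, Pi.add_apply]
      ring
  have hsmul (r : ℂ) (c) : (⟨φ (r • c), hmem _⟩ : charDual x₀ (L.character x₀)) =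
      r • ⟨φ c, hmem c⟩ := by
    refine hext _ _ fun z => ?_
    change φ (r • c) _ = r * φ c _
    rw [hφ, hφ]
    generalize (z : Chain ℂ 1 (MaxAbCover X x₀)) = z'
    induction z' using Finsupp.induction_linear with
    | zero => simp
    | add z w hz hw => rw [map_add, map_add, hz, hw]; ring
    | single σ s =>
      rw [pull_single, pull_single, SetLike.val_smul, Pi.smul_apply, smul_eq_mul]
      ring
  exact ⟨{ toFun := fun c => ⟨φ c, hmem c⟩, map_add' := hadd, map_smul' := hsmul }, hφ⟩

variable [PathConnectedSpace X]

/-- For every `g` in the deck group there is an equivariant choice of a path from `x` to `g x`. -/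
lemma exists_equivariant_section (g : DeckGroup X x₀) :
    ∃ S : Chain ℂ 0 (MaxAbCover X x₀) →ₗ[ℂ] Chain ℂ 1 (MaxAbCover X x₀),
      (∀ c, Chain.bdry ℂ 0 _ (S c) = deckChain x₀ 0 g c - c) ∧
      ∀ k c, S (deckChain x₀ 0 k c) = deckChain x₀ 1 k (S c) := by
  choose s hs using fun σ : C(Simplex 0, X) => MaxAbCover.exists_lift_simplex (x₀ := x₀) σ
  choose κ hκ using fun σ : C(Simplex 0, MaxAbCover X x₀) =>
    MaxAbCover.exists_deck_comp_eq (hs ((MaxAbCover.proj X x₀).comp σ))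
  let b (σ : C(Simplex 0, X)) : MaxAbCover X x₀ := s σ (stdSimplex.vertex 0)
  let e (σ : C(Simplex 0, X)) : C(Simplex 1, MaxAbCover X x₀) :=
    simplexOfPath (PathConnectedSpace.somePath (b σ) (deck x₀ g (b σ)))
  let S : Chain ℂ 0 (MaxAbCover X x₀) →ₗ[ℂ] Chain ℂ 1 (MaxAbCover X x₀) :=
    Finsupp.linearCombination ℂ fun σ =>
      deckChain x₀ 1 (κ σ) (Finsupp.single (e ((MaxAbCover.proj X x₀).comp σ)) 1)
  have hS (σ) (r : ℂ) : S (Finsupp.single σ r) =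
      r • deckChain x₀ 1 (κ σ) (Finsupp.single (e ((MaxAbCover.proj X x₀).comp σ)) 1) := by
    simp only [S, Finsupp.linearCombination_single]
  refine ⟨S, fun c => ?_, fun k c => ?_⟩
  · induction c using Finsupp.induction_linear with
    | zero => simp
    | add c d hc hd => simp only [map_add, hc, hd]; abel
    | single σ r =>
      have h1 : Finsupp.single (pt (b ((MaxAbCover.proj X x₀).comp σ))) (1 : ℂ) =
          Finsupp.single (s ((MaxAbCover.proj X x₀).comp σ)) 1 := by
        rw [eq_pt (s _)]
      have h2 : pt (deck x₀ g (b ((MaxAbCover.proj X x₀).comp σ))) =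
          (deck x₀ g).comp (pt (b ((MaxAbCover.proj X x₀).comp σ))) := rfl
      have h3 : deckChain x₀ 0 (κ σ) (Finsupp.single (s ((MaxAbCover.proj X x₀).comp σ)) (1 : ℂ)) =
          Finsupp.single σ 1 := by
        rw [Chain.map_single, hκ]
      rw [hS, map_smul, Chain.bdry_map, bdry_edge, simplexOfPath_vertex_zero,
        simplexOfPath_vertex_one, h2, ← Chain.map_single, h1, map_sub, ← deckChain_mul,
        mul_comm, deckChain_mul, h3, smul_sub, ← map_smul, Finsupp.smul_single, smul_eq_mul,
        mul_one]
  · induction c using Finsupp.induction_linear with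
    | zero => simp
    | add c d hc hd => simp only [map_add, hc, hd]
    | single σ r =>
      have h4 : κ ((deck x₀ k).comp σ) = k * κ σ := by
        refine MaxAbCover.deck_injective (e := b ((MaxAbCover.proj X x₀).comp σ)) ?_
        rw [MaxAbCover.deck_mul_apply]
        have h5 := congrArg (fun φ : C(Simplex 0, MaxAbCover X x₀) => φ (stdSimplex.vertex 0))
          (hκ ((deck x₀ k).comp σ))
        have h6 := congrArg (fun φ : C(Simplex 0, MaxAbCover X x₀) =>
          deck x₀ k (φ (stdSimplex.vertex 0))) (hκ σ)
        exact h5.trans h6.symm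
      rw [Chain.map_single, hS, hS, map_smul, h4, deckChain_mul]
      rfl

/-- For a nontrivial rank one local system, `H¹(X; L)` is the dual of the fibre of the Alexander
invariant. -/
theorem rank_H1_eq_of_ne_one (h : L.character x₀ ≠ 1) :
    Module.rank ℂ L.H1 = Module.rank ℂ (charDual x₀ (L.character x₀)) := by
  obtain ⟨g, hg⟩ : ∃ g, L.character x₀ g ≠ 1 := by
    by_contra! hg
    exact h (MonoidHom.ext hg)
  have hg' : (L.character x₀ g : ℂ) - 1 ≠ 0 := by
    rw [sub_ne_zero]
    exact fun h => hg (Units.ext h)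
  set a : ℂ := (L.character x₀ g : ℂ) - 1 with ha
  obtain ⟨S, hS, hSk⟩ := exists_equivariant_section g
  obtain ⟨Ψ, hΨ⟩ := exists_cocycleToDual x₀ L
  -- `W` maps chains to cycles and is `g - 1` on cycles
  let W : Chain ℂ 1 (MaxAbCover X x₀) →ₗ[ℂ] Chain ℂ 1 (MaxAbCover X x₀) :=
    deckChain x₀ 1 g - LinearMap.id - S.comp (Chain.bdry ℂ 0 _)
  have hW (c) : W c = deckChain x₀ 1 g c - c - S (Chain.bdry ℂ 0 _ c) := rfl
  have hWc (c) : Chain.bdry ℂ 0 _ (W c) = 0 := by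
    rw [hW, map_sub, map_sub, hS, Chain.bdry_map, sub_self]
  have hsurj : Function.Surjective Ψ := by
    rintro ⟨φ, hφ⟩
    rw [mem_charDual_iff] at hφ
    let φW : Chain ℂ 1 (MaxAbCover X x₀) →ₗ[ℂ] ℂ :=
      a⁻¹ • φ.comp ((homologyClass _).comp (W.codRestrict _ hWc))
    have hφW (c) : φW c = a⁻¹ * φ (homologyClass _ ⟨W c, hWc c⟩) := rfl
    obtain ⟨c, hc⟩ := exists_pull_eq L.pathCharacter φW (fun k z => by
      rw [hφW, hφW]
      have : (⟨W (deckChain x₀ 1 k z), hWc _⟩ : Chain.cycles ℂ 0 (MaxAbCover X x₀)) =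
          deckCycle k ⟨W z, hWc z⟩ := by
        refine Subtype.ext ?_
        change W (deckChain x₀ 1 k z) = deckChain x₀ 1 k (W z)
        rw [hW, hW, map_sub, map_sub, Chain.bdry_map, hSk, ← deckChain_mul, ← deckChain_mul,
          mul_comm]
      rw [this, hφ]
      change _ = (L.character x₀ k : ℂ) * _
      ring)
    have hδ : L.coboundary 1 c = 0 := by
      refine pull_injective (x₀ := x₀) L.pathCharacter (LinearMap.ext fun z => ?_)
      have h0 : pull (x₀ := x₀) L.pathCharacter 2 (0 : L.Cochain 2) z = 0 := by
        induction z using Finsupp.induction_linear with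
        | zero => simp
        | add c d hc hd => simp only [map_add, hc, hd, add_zero]
        | single σ r => simp [pull_single]
      rw [h0, pull_coboundary, hc, hφW]
      have : (⟨W (Chain.bdry ℂ 1 _ z), hWc _⟩ : Chain.cycles ℂ 0 (MaxAbCover X x₀)) =
          ⟨Chain.bdry ℂ 1 _ (deckChain x₀ 2 g z - z), Chain.bdry_bdry _⟩ := by
        refine Subtype.ext ?_
        change W (Chain.bdry ℂ 1 _ z) = Chain.bdry ℂ 1 _ (deckChain x₀ 2 g z - z)
        rw [hW, Chain.bdry_bdry, map_zero, sub_zero, map_sub, Chain.bdry_map]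
      rw [this, show homologyClass _ _ = 0 from
        homologyClass_bdry _ (deckChain x₀ 2 g z - z) (Chain.bdry_bdry _), map_zero, mul_zero]
    refine ⟨⟨c, hδ⟩, Subtype.ext (LinearMap.ext fun b => ?_)⟩
    obtain ⟨z, rfl⟩ := homologyClass_surjective _ b
    rw [hΨ, hc, hφW]
    have : (⟨W z, hWc _⟩ : Chain.cycles ℂ 0 (MaxAbCover X x₀)) = deckCycle g z - z := by
      refine Subtype.ext ?_
      change W z = deckChain x₀ 1 g z - z
      have hz : Chain.bdry ℂ 0 _ (z : Chain ℂ 1 (MaxAbCover X x₀)) = 0 := z.2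
      rw [hW, hz, map_zero, sub_zero]
    rw [this, map_sub, map_sub, hφ, ← sub_one_mul, ← mul_assoc, inv_mul_cancel₀ hg', one_mul]
  have hker : LinearMap.ker Ψ =
      (LinearMap.range (L.coboundary 0)).submoduleOf (LinearMap.ker (L.coboundary 1)) := by
    ext c
    rw [LinearMap.mem_ker, Submodule.submoduleOf, Submodule.mem_comap]
    constructor
    · intro hc0
      have hc (z : Chain.cycles ℂ 0 (MaxAbCover X x₀)) : pull L.pathCharacter 1 c.1 z.1 = 0 := by
        rw [← hΨ, hc0]
        rfl
      obtain ⟨d, hd⟩ := exists_pull_eq L.pathCharacter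
        (a⁻¹ • (pull (x₀ := x₀) L.pathCharacter 1 c.1).comp S) (fun k z => by
          simp only [LinearMap.smul_apply, LinearMap.comp_apply, hSk, pull_deck, smul_eq_mul]
          ring)
      refine ⟨d, pull_injective (x₀ := x₀) L.pathCharacter (LinearMap.ext fun z => ?_)⟩
      rw [pull_coboundary, hd]
      have h1 := hc ⟨W z, hWc z⟩
      change pull L.pathCharacter 1 c.1 (W z) = 0 at h1
      rw [hW, map_sub, map_sub, pull_deck, sub_eq_zero] at h1
      simp only [LinearMap.smul_apply, LinearMap.comp_apply, ← h1, smul_eq_mul]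
      rw [← sub_one_mul, ← mul_assoc]
      change a⁻¹ * a * _ = _
      rw [inv_mul_cancel₀ hg', one_mul]
      rfl
    · rintro ⟨d, hd⟩
      refine Subtype.ext (LinearMap.ext fun b => ?_)
      obtain ⟨z, rfl⟩ := homologyClass_surjective _ b
      have hz : Chain.bdry ℂ 0 _ (z : Chain ℂ 1 (MaxAbCover X x₀)) = 0 := z.2
      have hd' : L.coboundary 0 d = c.1 := hd
      rw [hΨ, ← hd', pull_coboundary, hz, map_zero]
      rfl
  exact ((Submodule.quotEquivOfEq _ _ hker.symm).trans
    (Ψ.quotKerEquivOfSurjective hsurj)).rank_eq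

end Twisted

/-! ### Convex charts of a line arrangement complement -/

section OpenSubspace

variable {E : Type} [NormedAddCommGroup E] [NormedSpace ℝ E] {P : E → Prop}

lemma homotopic_of_convex {S : Set E} (hS : Convex ℝ S) (hP : ∀ v ∈ S, P v) {y z : {v // P v}}
    (p q : Path y z) (hp : ∀ s, (p s : E) ∈ S) (hq : ∀ s, (q s : E) ∈ S) :
    Path.Homotopic p q := by
  have hy : (y : E) ∈ S := by simpa using hp 0
  have hz : (z : E) ∈ S := by simpa using hp 1
  have := Convex.simplyConnectedSpace hS ⟨_, hy⟩
  let ι : C(S, {v // P v}) := ⟨fun v => ⟨v, hP v v.2⟩, by fun_prop⟩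
  let p' : Path (⟨y, hy⟩ : S) ⟨z, hz⟩ :=
    { toFun := fun s => ⟨p s, hp s⟩
      continuous_toFun := by fun_prop
      source' := by simp
      target' := by simp }
  let q' : Path (⟨y, hy⟩ : S) ⟨z, hz⟩ :=
    { toFun := fun s => ⟨q s, hq s⟩
      continuous_toFun := by fun_prop
      source' := by simp
      target' := by simp }
  exact (SimplyConnectedSpace.paths_homotopic p' q').map ι

lemma uniqueLocalPaths_subtype (h : IsOpen {v | P v}) : UniqueLocalPaths {v // P v} where
  exists_nhd x := by
    obtain ⟨r, hr, hball⟩ := Metric.isOpen_iff.mp h x x.2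
    exact ⟨Subtype.val ⁻¹' Metric.ball (x : E) r,
        Metric.isOpen_ball.preimage continuous_subtype_val,
      Metric.mem_ball_self hr, fun y z p q hp hq =>
        homotopic_of_convex (convex_ball _ _) hball p q hp hq⟩

variable (P) in
/-- The traces on an open subspace of the open convex sets contained in it. -/
def convexCharts : Set (Set {v // P v}) :=
  {U | ∃ S : Set E, Convex ℝ S ∧ IsOpen S ∧ (∀ v ∈ S, P v) ∧ U = Subtype.val ⁻¹' S}

lemma isOpen_of_mem_convexCharts {U : Set {v // P v}} (h : U ∈ convexCharts P) : IsOpen U := by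
  obtain ⟨S, -, hS, -, rfl⟩ := h
  exact hS.preimage continuous_subtype_val

lemma inter_mem_convexCharts {U V : Set {v // P v}} (hU : U ∈ convexCharts P)
    (hV : V ∈ convexCharts P) : U ∩ V ∈ convexCharts P := by
  obtain ⟨S, h1, h2, h3, rfl⟩ := hU
  obtain ⟨T, h1', h2', -, rfl⟩ := hV
  exact ⟨S ∩ T, h1.inter h1', h2.inter h2', fun v hv => h3 v hv.1, rfl⟩

end OpenSubspace

namespace LineArrangement

variable {n : ℕ} (A : LineArrangement n)

lemma notMem_iUnion_line (v : ℂ × ℂ) :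
    v ∉ ⋃ i, A.line i ↔ ∀ i, A.a i * v.1 + A.b i * v.2 + A.c i ≠ 0 := by
  simp [line]

lemma isOpen_compl : IsOpen {v : ℂ × ℂ | v ∉ ⋃ i, A.line i} := by
  simp only [notMem_iUnion_line, Set.ofPred_forall]
  refine isOpen_iInter_of_finite fun i => ?_
  exact isOpen_ne_fun (by fun_prop) continuous_const

instance : UniqueLocalPaths A.Complement := uniqueLocalPaths_subtype A.isOpen_compl

/-- Points of the complement are joined inside the complex line through them, which meets the
arrangement in finitely many points. -/
lemma joined (v w : A.Complement) : Joined v w := by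
  have hv := (A.notMem_iUnion_line _).mp v.2
  have hw := (A.notMem_iUnion_line _).mp w.2
  let l (i : Fin n) (u : ℂ × ℂ) : ℂ := A.a i * u.1 + A.b i * u.2 + A.c i
  let f (z : ℂ) : ℂ × ℂ := v.1 + z • (w.1 - v.1)
  have hf (i z) : l i (f z) = l i v + z * (l i w - l i v) := by
    simp only [l, f, Prod.fst_add, Prod.snd_add, Prod.smul_fst, Prod.smul_snd, Prod.fst_sub,
      Prod.snd_sub, smul_eq_mul]
    ring
  let B : Set ℂ := ⋃ i, {z | l i (f z) = 0}
  have hB : B.Countable := by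
    refine Set.countable_iUnion fun i => Set.Subsingleton.countable ?_
    intro z hz z' hz'
    simp only [Set.mem_ofPred_eq, hf] at hz hz'
    by_contra hne
    have h0 : (z - z') * (l i w - l i v) = 0 := by linear_combination hz - hz'
    have h1 := (mul_eq_zero.mp h0).resolve_left (sub_ne_zero.mpr hne)
    rw [h1, mul_zero, add_zero] at hz
    exact hv i hz
  have hpc : IsPathConnected Bᶜ :=
    hB.isPathConnected_compl_of_one_lt_rank (by rw [Complex.rank_real_complex]; norm_num)
  have h0 : (0 : ℂ) ∈ Bᶜ := by simpa [B, f] using hv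
  have h1 : (1 : ℂ) ∈ Bᶜ := by simpa [B, f] using hw
  obtain ⟨γ, hγ⟩ := hpc.joinedIn 0 h0 1 h1
  refine ⟨⟨⟨fun s => ⟨f (γ s), ?_⟩, ?_⟩, ?_, ?_⟩⟩
  · rw [notMem_iUnion_line]
    intro i hi
    exact hγ s (Set.mem_iUnion.mpr ⟨i, hi⟩)
  · fun_prop
  · ext <;> simp [f]
  · ext <;> simp [f]

instance [h : Nonempty A.Complement] : PathConnectedSpace A.Complement := ⟨h, A.joined⟩

/-- The points of `ℂ²` at which each linear form has its value in a prescribed one of the half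
planes `Re > 0`, `Im < 0`, `Re < 0`, `Im > 0`. -/
def halfPlaneChart (s : Fin n → Fin 4) : Set (ℂ × ℂ) :=
  {v | ∀ i, 0 < (Complex.I ^ (s i : ℕ) * (A.a i * v.1 + A.b i * v.2 + A.c i)).re}

lemma halfPlaneChart_mem (s : Fin n → Fin 4) :
    (Subtype.val ⁻¹' A.halfPlaneChart s : Set A.Complement) ∈
      convexCharts fun v => v ∉ ⋃ i, A.line i := by
  refine ⟨A.halfPlaneChart s, ?_, ?_, fun v hv => ?_, rfl⟩
  · intro v hv w hw p q hp hq hpq i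
    have key : (Complex.I ^ (s i : ℕ) * (A.a i * (p • v + q • w).1 + A.b i * (p • v + q • w).2 +
        A.c i)) = p • (Complex.I ^ (s i : ℕ) * (A.a i * v.1 + A.b i * v.2 + A.c i)) +
        q • (Complex.I ^ (s i : ℕ) * (A.a i * w.1 + A.b i * w.2 + A.c i)) := by
      have h1 : (p : ℂ) + q = 1 := by exact_mod_cast hpq
      simp only [Prod.fst_add, Prod.snd_add, Prod.smul_fst, Prod.smul_snd, Complex.real_smul]
      linear_combination -(Complex.I ^ (s i : ℕ) * A.c i * h1)
    rw [key, Complex.add_re, Complex.smul_re, Complex.smul_re]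
    exact (convex_Ioi (0 : ℝ)) (hv i) (hw i) hp hq hpq
  · rw [halfPlaneChart, Set.ofPred_forall]
    exact isOpen_iInter_of_finite fun i => isOpen_lt continuous_const (by fun_prop)
  · refine (A.notMem_iUnion_line v).mpr fun i hi => ?_
    have := hv i
    rw [hi, mul_zero] at this
    exact lt_irrefl _ this

lemma exists_mem_halfPlaneChart (v : A.Complement) : ∃ s, (v : ℂ × ℂ) ∈ A.halfPlaneChart s := by
  have hv := (A.notMem_iUnion_line _).mp v.2
  have key (z : ℂ) (hz : z ≠ 0) : ∃ j : Fin 4, 0 < (Complex.I ^ (j : ℕ) * z).re := by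
    by_contra! h
    have h0 := h 0
    have h1 := h 1
    have h2 := h 2
    have h3 := h 3
    simp [Complex.I_sq, Complex.I_pow_three] at h0 h1 h2 h3
    exact hz (Complex.ext (le_antisymm h0 h2) (le_antisymm h3 h1))
  choose s hs using fun i => key _ (hv i)
  exact ⟨s, hs⟩

/-- The complement has a finite good cover. -/
lemma exists_convexCharts : ∃ l : List (Set A.Complement),
    (∀ U ∈ l, U ∈ convexCharts fun v => v ∉ ⋃ i, A.line i) ∧
      l.foldr (· ∪ ·) ∅ = Set.univ := by
  refine ⟨(Finset.univ : Finset (Fin n → Fin 4)).toList.map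
    fun s => Subtype.val ⁻¹' A.halfPlaneChart s, ?_, Set.eq_univ_of_forall fun v => ?_⟩
  · intro U hU
    obtain ⟨s, -, rfl⟩ := List.mem_map.mp hU
    exact A.halfPlaneChart_mem s
  · obtain ⟨s, hs⟩ := A.exists_mem_halfPlaneChart v
    have hmem (l : List (Set A.Complement)) (U) (hU : U ∈ l) : U ⊆ l.foldr (· ∪ ·) ∅ := by
      induction l with
      | nil => simp at hU
      | cons V l ih =>
        rcases List.mem_cons.mp hU with rfl | h
        · exact Set.subset_union_left
        · exact (ih h).trans Set.subset_union_right
    exact hmem _ _ (List.mem_map.mpr ⟨s, by simp, rfl⟩) hs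

end LineArrangement

/-! ### Finite generation of homology and of the Alexander invariant -/

namespace Chain

variable {R : Type} [CommRing R] {X : Type} [TopologicalSpace X]

lemma within_empty (q : ℕ) : within R q (∅ : Set X) = ⊥ := by
  have : {σ : C(Simplex q, X) | ∀ t, σ t ∈ (∅ : Set X)} = ∅ :=
    Set.eq_empty_of_forall_notMem fun σ hσ => hσ (stdSimplex.vertex 0)
  rw [within, this, Finsupp.supported_empty]

lemma within_zero_union_le (S T : Set X) : within R 0 (S ∪ T) ≤ within R 0 S ⊔ within R 0 T := by
  rw [within, within, within, ← Finsupp.supported_union]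
  refine Finsupp.supported_mono fun σ hσ => ?_
  have h (t : Simplex 0) : t = stdSimplex.vertex 0 :=
    Subsingleton.elim (α := stdSimplex ℝ (Fin 1)) _ _
  rcases hσ (stdSimplex.vertex 0) with h0 | h0
  · exact Or.inl fun t => (h t).symm ▸ h0
  · exact Or.inr fun t => (h t).symm ▸ h0

end Chain

/-- The singular chains of a space as a chain system. -/
def singularSystem (R : Type) [CommRing R] (X : Type) [TopologicalSpace X] :
    ChainSystem R X fun q => Chain R q X where
  d q := Chain.bdry R q X
  d_d _ c := Chain.bdry_bdry c
  F S q := Chain.within R q S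
  mono h _ := Chain.within_mono h
  empty q := Chain.within_empty q
  inter S T _ := (Chain.within_inter S T).ge
  d_mem h := Chain.bdry_mem_within h
  zero_le S T := Chain.within_zero_union_le S T
  small hU hV hz hz0 := Chain.exists_small hU hV hz hz0

section Finite

variable {E : Type} [NormedAddCommGroup E] [NormedSpace ℝ E] {P : E → Prop}

lemma singularSystem_fgHomology {R : Type} [CommRing R] {U : Set {v // P v}}
    (hU : U ∈ convexCharts P) (q : ℕ) : (singularSystem R {v // P v}).FGHomology U q := by
  obtain ⟨S, hS, -, hP, rfl⟩ := hU
  rcases S.eq_empty_or_nonempty with rfl | ⟨b, hb⟩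
  · exact ChainSystem.fgHomology_empty _ q
  let s : Unit → C(S, {v // P v}) := fun _ => ⟨fun v => ⟨v, hP v v.2⟩, by fun_prop⟩
  have hsm (k x) : s k x ∈ (Subtype.val ⁻¹' S : Set {v // P v}) := x.2
  have hs (q) (σ : C(Simplex q, {v // P v})) (h : ∀ t, σ t ∈ (Subtype.val ⁻¹' S : Set {v // P v})) :
      ∃ k τ, σ = (s k).comp τ :=
    ⟨(), ⟨fun t => ⟨σ t, h t⟩, by fun_prop⟩, rfl⟩
  cases q with
  | zero =>
    refine ⟨Submodule.span R {Finsupp.single (ContinuousMap.const (Simplex 0) (s () ⟨b, hb⟩)) 1},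
      Submodule.fg_span_singleton _, ?_, fun z hz => ?_⟩
    · rw [Submodule.span_singleton_le_iff_mem]
      exact Chain.single_mem_within (σ := ContinuousMap.const (Simplex 0) (s () ⟨b, hb⟩))
        (fun _ => hb) _
    · obtain ⟨c, hc, h⟩ := SheetChain.exists_sub_bdry_mem hS ⟨b, hb⟩ s hsm (hs 0) hz
      rw [Set.range_unique] at h
      rw [← sub_add_cancel z (Chain.bdry R 0 _ c)]
      exact Submodule.add_mem_sup h ⟨c, hc, rfl⟩
  | succ q =>
    refine ⟨⊥, Submodule.fg_bot, bot_le, fun z hz => Submodule.mem_sup_right ?_⟩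
    obtain ⟨c, hc, h⟩ := SheetChain.exists_bdry_eq hS ⟨b, hb⟩ s
      (fun k l x y h => ⟨rfl, Subtype.ext (congrArg (fun v : {v // P v} => (v : E)) h)⟩)
      hsm (hs (q + 1)) hz.1 hz.2
    exact ⟨c, hc, h⟩

lemma finite_singularHomology {R : Type} [CommRing R] {X : Type} [TopologicalSpace X] {q : ℕ}
    (h : (singularSystem R X).FGHomology Set.univ (q + 1)) :
    Module.Finite R (singularHomology R (q + 1) X) := by
  obtain ⟨N, hN, hNc, hle⟩ := h
  have hNc' : N ≤ Chain.cycles R q X := hNc.trans inf_le_right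
  have hfg : (N.submoduleOf (Chain.cycles R q X)).FG := by
    refine Submodule.fg_of_fg_map_injective (Chain.cycles R q X).subtype Subtype.val_injective ?_
    rwa [Submodule.submoduleOf, Submodule.map_comap_subtype, inf_eq_right.mpr hNc']
  refine ⟨?_⟩
  have : (N.submoduleOf (Chain.cycles R q X)).map (Chain.toHomology R q X) = ⊤ := by
    refine Submodule.eq_top_iff'.mpr fun a => ?_
    obtain ⟨z, rfl⟩ := Chain.toHomology_surjective a
    have hz : (z : Chain R (q + 1) X) ∈ (singularSystem R X).cycles Set.univ (q + 1) :=
      ⟨(Chain.within_univ (R := R) (X := X)).ge Submodule.mem_top, z.2⟩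
    obtain ⟨y, hy, w, ⟨c, -, rfl⟩, hyw⟩ := Submodule.mem_sup.mp (hle hz)
    refine ⟨⟨y, hNc' hy⟩, hy, ?_⟩
    rw [← sub_eq_zero, ← map_sub, Chain.toHomology_eq_zero_iff]
    refine ⟨-c, ?_⟩
    rw [map_neg, Submodule.coe_sub, ← hyw]
    change -(Chain.bdry R (q + 1) X c) = y - (y + Chain.bdry R (q + 1) X c)
    abel
  exact this ▸ hfg.map _

end Finite

/-! ### The Alexander invariant as the homology of a complex of `ℂ[K]`-modules -/

section Representation

variable {G V W : Type} [Group G] [AddCommGroup V] [Module ℂ V] [AddCommGroup W] [Module ℂ W]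
  (ρ : Representation ℂ G V) (σ : Representation ℂ G W)

lemma asAlgebraHom_mem (N : Submodule ℂ V) (h : ∀ g, ∀ v ∈ N, ρ g v ∈ N) (r : MonoidAlgebra ℂ G)
    {v : V} (hv : v ∈ N) : ρ.asAlgebraHom r v ∈ N := by
  induction r using MonoidAlgebra.induction_on with
  | of g => rw [Representation.asAlgebraHom_of]; exact h g v hv
  | add a b ha hb => rw [map_add]; exact N.add_mem ha hb
  | smul a b hb => rw [map_smul]; exact N.smul_mem a hb

lemma map_asAlgebraHom (f : V →ₗ[ℂ] W) (h : ∀ g v, f (ρ g v) = σ g (f v)) (r : MonoidAlgebra ℂ G)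
    (v : V) : f (ρ.asAlgebraHom r v) = σ.asAlgebraHom r (f v) := by
  induction r using MonoidAlgebra.induction_on with
  | of g => rw [Representation.asAlgebraHom_of, Representation.asAlgebraHom_of]; exact h g v
  | add a b ha hb => rw [map_add, map_add, LinearMap.add_apply, map_add, ha, hb]; rfl
  | smul a b hb => rw [map_smul, map_smul, LinearMap.smul_apply, map_smul, hb]; rfl

/-- An equivariant linear map as a map of `ℂ[G]`-modules. -/
def equivariantMap (f : V →ₗ[ℂ] W) (h : ∀ g v, f (ρ g v) = σ g (f v)) :
    ρ.asModule →ₗ[MonoidAlgebra ℂ G] σ.asModule where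
  toFun := f
  map_add' := map_add f
  map_smul' := map_asAlgebraHom ρ σ f h

/-- An invariant subspace as a `ℂ[G]`-submodule. -/
def invariantSubmodule (N : Submodule ℂ V) (h : ∀ g, ∀ v ∈ N, ρ g v ∈ N) :
    Submodule (MonoidAlgebra ℂ G) ρ.asModule where
  carrier := {v | ρ.asModuleEquiv v ∈ N}
  add_mem' := N.add_mem
  zero_mem' := N.zero_mem
  smul_mem' r _ hv := asAlgebraHom_mem ρ N h r hv

lemma mem_invariantSubmodule {N : Submodule ℂ V} {h : ∀ g, ∀ v ∈ N, ρ g v ∈ N}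
    {v : ρ.asModule} : v ∈ invariantSubmodule ρ N h ↔ ρ.asModuleEquiv v ∈ N := Iff.rfl

end Representation

section Cover

variable {X : Type} [TopologicalSpace X] (x₀ : X)

/-- The action of the deck group on the singular chains of the maximal abelian cover. -/
def chainRep (q : ℕ) : Representation ℂ (DeckGroup X x₀) (Chain ℂ q (MaxAbCover X x₀)) where
  toFun k := deckChain x₀ q k
  map_one' := by
    refine Finsupp.lhom_ext fun σ r => ?_
    rw [Chain.map_single, Module.End.one_apply]
    congr 1
    ext t
    exact MaxAbCover.deck_one_apply _
  map_mul' k l := LinearMap.ext fun c => deckChain_mul q k l c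

lemma chainRep_apply (q : ℕ) (k : DeckGroup X x₀) (c : Chain ℂ q (MaxAbCover X x₀)) :
    chainRep x₀ q k c = deckChain x₀ q k c := rfl

lemma deckChain_mem_within {S : Set X} {q : ℕ} (k : DeckGroup X x₀)
    {c : Chain ℂ q (MaxAbCover X x₀)}
    (hc : c ∈ Chain.within ℂ q (MaxAbCover.proj X x₀ ⁻¹' S)) :
    deckChain x₀ q k c ∈ Chain.within ℂ q (MaxAbCover.proj X x₀ ⁻¹' S) := by
  refine map_mem_of_mem_supported (fun σ hσ => ?_) hc
  rw [Chain.map_single]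
  exact Chain.single_mem_within (σ := (deck x₀ k).comp σ) (fun t => hσ t) _

/-- The singular chains of the maximal abelian cover as a chain system over `ℂ[K]`; the chains in a
subset of the base are the chains in its preimage. -/
def coverSystem : ChainSystem (MonoidAlgebra ℂ (DeckGroup X x₀)) X
    fun q => (chainRep x₀ q).asModule where
  d q := equivariantMap (chainRep x₀ (q + 1)) (chainRep x₀ q) (Chain.bdry ℂ q (MaxAbCover X x₀))
    fun _ _ => Chain.bdry_map _ _
  d_d _ c := Chain.bdry_bdry c
  F S q := invariantSubmodule (chainRep x₀ q)
    (Chain.within ℂ q (MaxAbCover.proj X x₀ ⁻¹' S)) fun g _ hv => deckChain_mem_within x₀ g hv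
  mono h _ _ hc := (mem_invariantSubmodule _).mpr <|
    Chain.within_mono (Set.preimage_mono h) ((mem_invariantSubmodule _).mp hc)
  empty q := le_bot_iff.mp fun c hc => by
    have h := (mem_invariantSubmodule _).mp hc
    rw [Set.preimage_empty, Chain.within_empty] at h
    exact (Submodule.mem_bot ℂ).mp h
  inter S T q c hc := (mem_invariantSubmodule _).mpr <|
    (Chain.within_inter (MaxAbCover.proj X x₀ ⁻¹' S) (MaxAbCover.proj X x₀ ⁻¹' T)).ge
      ⟨(mem_invariantSubmodule _).mp hc.1, (mem_invariantSubmodule _).mp hc.2⟩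
  d_mem h := Chain.bdry_mem_within ((mem_invariantSubmodule _).mp h)
  zero_le S T z hz := by
    obtain ⟨a, ha, b, hb, h⟩ := Submodule.mem_sup.mp (Chain.within_zero_union_le
      (MaxAbCover.proj X x₀ ⁻¹' S) (MaxAbCover.proj X x₀ ⁻¹' T) ((mem_invariantSubmodule _).mp hz))
    exact Submodule.mem_sup.mpr ⟨a, (mem_invariantSubmodule _).mpr ha, b,
      (mem_invariantSubmodule _).mpr hb, h⟩
  small hU hV hz hz0 := by
    obtain ⟨a, ha, b, hb, c, hc, h⟩ := Chain.exists_small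
      (hU.preimage (MaxAbCover.proj X x₀).continuous)
      (hV.preimage (MaxAbCover.proj X x₀).continuous) ((mem_invariantSubmodule _).mp hz) hz0
    exact ⟨a, (mem_invariantSubmodule _).mpr ha, b, (mem_invariantSubmodule _).mpr hb, c,
      (mem_invariantSubmodule _).mpr hc, h⟩

lemma mem_coverSystem {S : Set X} {q : ℕ} {c : (chainRep x₀ q).asModule} :
    c ∈ (coverSystem x₀).F S q ↔
      (chainRep x₀ q).asModuleEquiv c ∈ Chain.within ℂ q (MaxAbCover.proj X x₀ ⁻¹' S) := Iff.rfl

end Cover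

section CoverFinite

variable {E : Type} [NormedAddCommGroup E] [NormedSpace ℝ E] {P : E → Prop}
  [UniqueLocalPaths {v // P v}] [PathConnectedSpace {v // P v}] (x₀ : {v // P v})

lemma coverSystem_fgHomology {U : Set {v // P v}} (hU : U ∈ convexCharts P) (q : ℕ) :
    (coverSystem x₀).FGHomology U q := by
  obtain ⟨S, hS, -, hP, rfl⟩ := hU
  rcases S.eq_empty_or_nonempty with rfl | ⟨b, hb⟩
  · exact ChainSystem.fgHomology_empty _ q
  have := Convex.simplyConnectedSpace hS ⟨b, hb⟩
  have := Convex.locallyPathConnectedSpace hS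
  let ι : C(S, {v // P v}) := ⟨fun v => ⟨v, hP v v.2⟩, by fun_prop⟩
  let s₁ : C(S, MaxAbCover {v // P v} x₀) := MaxAbCover.lift ι ⟨b, hb⟩
    (Path.Homotopic.Quotient.mk (PathConnectedSpace.somePath _ _))
  have hs₁ : (MaxAbCover.proj _ x₀).comp s₁ = ι := MaxAbCover.proj_comp_lift _ _ _
  let s (k : DeckGroup {v // P v} x₀) : C(S, MaxAbCover {v // P v} x₀) := (deck x₀ k).comp s₁
  have hps (k x) : MaxAbCover.proj _ x₀ (s k x) = ι x :=
    congrArg (fun f : C(S, {v // P v}) => f x) hs₁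
  have hsm (k x) : s k x ∈ MaxAbCover.proj _ x₀ ⁻¹' (Subtype.val ⁻¹' S : Set {v // P v}) := by
    rw [Set.mem_preimage, hps]
    exact x.2
  have hinj (k l x y) (h : s k x = s l y) : k = l ∧ x = y := by
    have hxy : ι x = ι y := by rw [← hps k, ← hps l, h]
    obtain rfl : x = y := Subtype.ext (congrArg (fun v : {v // P v} => (v : E)) hxy)
    exact ⟨MaxAbCover.deck_injective h, rfl⟩
  have hs (q) (σ : C(Simplex q, MaxAbCover {v // P v} x₀))
      (h : ∀ t, σ t ∈ MaxAbCover.proj _ x₀ ⁻¹' (Subtype.val ⁻¹' S : Set {v // P v})) :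
      ∃ k τ, σ = (s k).comp τ := by
    let τ : C(Simplex q, S) := ⟨fun t => ⟨(MaxAbCover.proj _ x₀ (σ t)).1, h t⟩, by fun_prop⟩
    have hτ : (MaxAbCover.proj _ x₀).comp (s₁.comp τ) = (MaxAbCover.proj _ x₀).comp σ := by
      rw [← ContinuousMap.comp_assoc, hs₁]
      rfl
    obtain ⟨k, hk⟩ := MaxAbCover.exists_deck_comp_eq hτ
    exact ⟨k, τ, hk.symm⟩
  cases q with
  | zero =>
    let e (k : DeckGroup {v // P v} x₀) : Chain ℂ 0 (MaxAbCover {v // P v} x₀) :=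
      Finsupp.single (ContinuousMap.const (Simplex 0) (s k ⟨b, hb⟩)) 1
    have he (k) : e k = deckChain x₀ 0 k (e 1) := by
      simp only [e]
      rw [Chain.map_single]
      congr 1
      ext t
      change deck x₀ k _ = deck x₀ k (deck x₀ 1 _)
      rw [MaxAbCover.deck_one_apply]
    refine ⟨Submodule.span _ {(chainRep x₀ 0).asModuleEquiv.symm (e 1)},
      Submodule.fg_span_singleton _, ?_, fun z hz => ?_⟩
    · rw [Submodule.span_singleton_le_iff_mem]
      exact (mem_coverSystem x₀).mpr <| Chain.single_mem_within
        (σ := ContinuousMap.const (Simplex 0) (s 1 ⟨b, hb⟩)) (fun _ => hsm _ _) _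
    · obtain ⟨c, hc, h⟩ := SheetChain.exists_sub_bdry_mem hS ⟨b, hb⟩ s hsm (hs 0)
        ((mem_coverSystem x₀).mp hz)
      rw [← sub_add_cancel z ((coverSystem x₀).d 0 ((chainRep x₀ 1).asModuleEquiv.symm c))]
      refine Submodule.add_mem_sup ?_ ⟨_, (mem_coverSystem x₀).mpr hc, rfl⟩
      have hle : ∀ x ∈ Submodule.span ℂ (Set.range e), (chainRep x₀ 0).asModuleEquiv.symm x ∈
          Submodule.span (MonoidAlgebra ℂ (DeckGroup {v // P v} x₀))
            {(chainRep x₀ 0).asModuleEquiv.symm (e 1)} := by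
        intro x hx
        induction hx using Submodule.span_induction with
        | mem x hx =>
          obtain ⟨k, rfl⟩ := hx
          rw [he k, ← chainRep_apply, Representation.asModuleEquiv_symm_map_rho]
          exact Submodule.smul_mem _ _ (Submodule.mem_span_singleton_self _)
        | zero => rw [map_zero]; exact zero_mem _
        | add x y _ _ hx hy => rw [map_add]; exact add_mem hx hy
        | smul r x _ hx =>
          rw [Representation.asModuleEquiv_symm_map_smul]
          exact Submodule.smul_mem _ _ hx
      exact hle _ h
  | succ q =>
    refine ⟨⊥, Submodule.fg_bot, bot_le, fun z hz => Submodule.mem_sup_right ?_⟩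
    obtain ⟨c, hc, h⟩ := SheetChain.exists_bdry_eq hS ⟨b, hb⟩ s hinj hsm (hs (q + 1))
      ((mem_coverSystem x₀).mp hz.1) hz.2
    exact ⟨(chainRep x₀ (q + 2)).asModuleEquiv.symm c, (mem_coverSystem x₀).mpr hc, h⟩

end CoverFinite

/-! ### Path characters and integral homology -/

namespace PathCharacter

variable {X A : Type} [TopologicalSpace X] [CommGroup A] (χ : PathCharacter X A)

lemma val_congr {x y x' y' : X} (γ : Path x y) (γ' : Path x' y') (h : ∀ s, γ s = γ' s) :
    χ.val (Path.Homotopic.Quotient.mk γ) = χ.val (Path.Homotopic.Quotient.mk γ') := by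
  obtain rfl : x = x' := by simpa using h 0
  obtain rfl : y = y' := by simpa using h 1
  obtain rfl : γ = γ' := Path.ext (funext h)
  rfl

/-- On a simply connected space a path character is the difference of a function. -/
lemma exists_primitive {Z : Type} [TopologicalSpace Z] [SimplyConnectedSpace Z] (f : C(Z, X)) :
    ∃ u : Z → A, ∀ {x y : Z} (γ : Path x y),
      χ.val (Path.Homotopic.Quotient.mk (γ.map f.continuous)) = u y / u x := by
  let z₀ : Z := Classical.arbitrary Z
  refine ⟨fun z => χ.val ((Path.Homotopic.Quotient.mk (PathConnectedSpace.somePath z₀ z)).map f),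
    fun {x y} γ => ?_⟩
  rw [eq_div_iff_mul_eq']
  have h : (Path.Homotopic.Quotient.mk (PathConnectedSpace.somePath z₀ x)).trans
      (Path.Homotopic.Quotient.mk γ) =
      Path.Homotopic.Quotient.mk (PathConnectedSpace.somePath z₀ y) := by
    rw [← Path.Homotopic.Quotient.mk_trans]
    exact Path.Homotopic.Quotient.eq.mpr (SimplyConnectedSpace.paths_homotopic _ _)
  change χ.val ((Path.Homotopic.Quotient.mk γ).map f) * χ.val
    ((Path.Homotopic.Quotient.mk (PathConnectedSpace.somePath z₀ x)).map f) =
      χ.val ((Path.Homotopic.Quotient.mk (PathConnectedSpace.somePath z₀ y)).map f)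
  rw [← h, MaxAbCover.map_trans, χ.val_trans, mul_comm]

/-- The value of a path character on the edge of a simplex. -/
def onEdge {q : ℕ} (σ : C(Simplex (q + 1), X)) : A := χ.val (Path.Homotopic.Quotient.mk (edge σ))

lemma exists_onEdge_comp {q : ℕ} (σ : C(Simplex q, X)) : ∃ u : Simplex q → A,
    ∀ {m : ℕ} (g : C(Simplex (m + 1), Simplex q)),
      χ.onEdge (σ.comp g) = u (g (stdSimplex.vertex 1)) / u (g (stdSimplex.vertex 0)) := by
  obtain ⟨u, hu⟩ := χ.exists_primitive σ
  exact ⟨u, fun {m} g => hu ((stdEdge m).map g.continuous)⟩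

lemma onEdge_face (σ : C(Simplex 2, X)) :
    χ.onEdge (face σ 1) = χ.onEdge (face σ 2) * χ.onEdge (face σ 0) := by
  obtain ⟨u, hu⟩ := χ.exists_onEdge_comp σ
  have h (i : Fin 3) : χ.onEdge (face σ i) =
      u (stdSimplex.vertex (i.succAbove 1)) / u (stdSimplex.vertex (i.succAbove 0)) := by
    refine (hu (face (ContinuousMap.id (Simplex 2)) i)).trans ?_
    rw [face_vertex, face_vertex]
    rfl
  rw [h, h, h]
  change u (stdSimplex.vertex 2) / u (stdSimplex.vertex 0) = u (stdSimplex.vertex 1) /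
    u (stdSimplex.vertex 0) * (u (stdSimplex.vertex 2) / u (stdSimplex.vertex 1))
  rw [mul_comm, div_mul_div_cancel]

lemma edge_simplexOfPath_apply {x y : X} (γ : Path x y) (s : unitInterval) :
    edge (simplexOfPath γ) s = γ s := by
  refine congrArg γ (Subtype.ext ?_)
  change (1 - (s : ℝ)) * (stdSimplex.vertex (S := ℝ) (0 : Fin 2)) 1 +
      (s : ℝ) * (stdSimplex.vertex (S := ℝ) (1 : Fin 2)) 1 = s
  simp

lemma onEdge_simplexOfPath {x y : X} (γ : Path x y) :
    χ.onEdge (simplexOfPath γ) = χ.val (Path.Homotopic.Quotient.mk γ) :=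
  χ.val_congr _ _ (edge_simplexOfPath_apply γ)

/-- A path character is additive on the edges of a triangle, so it descends to first integral
homology. -/
lemma exists_homologyMap : ∃ φ : singularHomology ℤ 1 X →ₗ[ℤ] Additive A,
    ∀ (x : X) (γ : Path x x), ∃ a, φ a = Additive.ofMul (χ.val (Path.Homotopic.Quotient.mk γ)) := by
  let ψ : Chain ℤ 1 X →ₗ[ℤ] Additive A :=
    Finsupp.linearCombination ℤ fun σ => Additive.ofMul (χ.onEdge σ)
  have hψ (σ) (r : ℤ) : ψ (Finsupp.single σ r) = r • Additive.ofMul (χ.onEdge σ) := by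
    simp only [ψ, Finsupp.linearCombination_single]
  obtain ⟨φ, hφ⟩ := exists_descend ψ fun c => by
    induction c using Finsupp.induction_linear with
    | zero => simp
    | add c d hc hd => rw [map_add, map_add, hc, hd, add_zero]
    | single σ r =>
      rw [Chain.bdry_single, map_sum, Fin.sum_univ_three, hψ, hψ, hψ, χ.onEdge_face, ofMul_mul]
      simp
  refine ⟨φ, fun x γ => ?_⟩
  have hz : Finsupp.single (simplexOfPath γ) 1 ∈ Chain.cycles ℤ 0 X := by
    rw [Chain.cycles, LinearMap.mem_ker, bdry_edge, simplexOfPath_vertex_zero,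
      simplexOfPath_vertex_one, sub_self]
  refine ⟨Chain.toHomology ℤ 0 X ⟨_, hz⟩, ?_⟩
  rw [hφ, hψ, one_smul, χ.onEdge_simplexOfPath]

end PathCharacter

section DeckGroup

variable {X : Type} [TopologicalSpace X] (x₀ : X)

/-- The path character with values in `K` given by a choice of paths from the base point. -/
def baseCharacter (p : ∀ x : X, Path.Homotopic.Quotient x₀ x) :
    PathCharacter X (DeckGroup X x₀) where
  val {x y} γ := Abelianization.of (diffLoop ((p x).trans γ) (p y))
  val_trans {x y z} γ δ := by
    rw [mul_comm, ← map_mul]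
    congr 1
    change ((p x).trans (γ.trans δ)).trans (p z).symm =
      (((p x).trans γ).trans (p y).symm).trans (((p y).trans δ).trans (p z).symm)
    have h : (p y).symm.trans ((p y).trans (δ.trans (p z).symm)) = δ.trans (p z).symm := by
      rw [← Path.Homotopic.Quotient.trans_assoc, Path.Homotopic.Quotient.symm_trans,
        Path.Homotopic.Quotient.refl_trans]
    simp only [Path.Homotopic.Quotient.trans_assoc, h]

/-- The surjective half of the Hurewicz isomorphism is enough: the path character given by a choice of
paths from the base point induces a surjection of `H₁(X; ℤ)` onto the deck group. -/
lemma deckGroup_fg [PathConnectedSpace X] [Module.Finite ℤ (singularHomology ℤ 1 X)] :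
    Group.FG (DeckGroup X x₀) := by
  let p (x : X) : Path.Homotopic.Quotient x₀ x :=
    Path.Homotopic.Quotient.mk (PathConnectedSpace.somePath x₀ x)
  obtain ⟨φ, hφ⟩ := (baseCharacter x₀ p).exists_homologyMap
  have hs : Function.Surjective φ := by
    intro k
    obtain ⟨g, hg⟩ : ∃ g, Abelianization.of g = k.toMul := QuotientGroup.mk_surjective k.toMul
    obtain ⟨γ, hγ⟩ := Path.Homotopic.Quotient.mk_surjective (FundamentalGroup.toPath g)
    obtain ⟨a, ha⟩ := hφ x₀ γ
    refine ⟨a, ha.trans ?_⟩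
    rw [hγ]
    let P : FundamentalGroup X x₀ := FundamentalGroup.fromPath (p x₀)
    have h : Abelianization.of (P⁻¹ * (g * P)) = k.toMul := by
      rw [map_mul, map_mul, map_inv, mul_comm, mul_inv_cancel_right, hg]
    exact h
  rw [GroupFG.iff_add_fg, ← Module.Finite.iff_addGroup_fg]
  exact Module.Finite.of_surjective φ hs

lemma isNoetherianRing_monoidAlgebra [Group.FG (DeckGroup X x₀)] :
    IsNoetherianRing (MonoidAlgebra ℂ (DeckGroup X x₀)) := by
  have : Monoid.FG (DeckGroup X x₀) := Group.fg_iff_monoid_fg.mp inferInstance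
  exact Algebra.FiniteType.isNoetherianRing ℂ _

end DeckGroup

section AlexanderFinite

lemma homologyClass_eq_of_eq_add {T : Type} [TopologicalSpace T] {y z : Chain.cycles ℂ 0 T}
    {c : Chain ℂ 2 T} (h : (z : Chain ℂ 1 T) = y + Chain.bdry ℂ 1 T c) :
    homologyClass T y = homologyClass T z := by
  rw [eq_comm, ← sub_eq_zero, ← map_sub, Chain.toHomology_eq_zero_iff]
  exact ⟨c, by rw [Submodule.coe_sub, h]; abel⟩

variable {X : Type} [TopologicalSpace X] (x₀ : X)

/-- The action of the deck group on the `1`-cycles of the maximal abelian cover. -/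
def cycleRep : Representation ℂ (DeckGroup X x₀) (Chain.cycles ℂ 0 (MaxAbCover X x₀)) where
  toFun k := (deckChain x₀ 1 k).restrict fun _ hz => (deckCycle k ⟨_, hz⟩).2
  map_one' := LinearMap.ext fun z => Subtype.ext <|
    congrArg (fun f => f (z : Chain ℂ 1 (MaxAbCover X x₀))) (chainRep x₀ 1).map_one
  map_mul' k l := LinearMap.ext fun _ => Subtype.ext (deckChain_mul 1 k l _)

/-- The Alexander invariant is finitely generated if the homology of the complex of `ℂ[K]`-modules
is. -/
lemma finite_alexanderInvariant (h : (coverSystem x₀).FGHomology Set.univ 1) :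
    Module.Finite (MonoidAlgebra ℂ (DeckGroup X x₀)) (AlexanderInvariant X x₀) := by
  obtain ⟨N, hN, hNc, hle⟩ := h
  let incl := equivariantMap (cycleRep x₀) (chainRep x₀ 1)
    (Chain.cycles ℂ 0 (MaxAbCover X x₀)).subtype fun _ _ => rfl
  let cls := equivariantMap (cycleRep x₀) (deckRep x₀) (homologyClass (MaxAbCover X x₀))
    fun g z => (deckRep_homologyClass g z).symm
  have hfg : (N.comap incl).FG := by
    refine Submodule.fg_of_fg_map_injective incl Subtype.val_injective ?_
    rwa [Submodule.map_comap_eq_of_le]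
    intro z hz
    exact ⟨⟨z, (hNc hz).2⟩, rfl⟩
  refine ⟨?_⟩
  have : (N.comap incl).map cls = ⊤ := by
    refine Submodule.eq_top_iff'.mpr fun a => ?_
    obtain ⟨z, hza⟩ := homologyClass_surjective (MaxAbCover X x₀) a
    have hz : (chainRep x₀ 1).asModuleEquiv.symm z ∈ (coverSystem x₀).cycles Set.univ 1 :=
      ⟨(Chain.within_univ (R := ℂ) (X := MaxAbCover X x₀)).ge Submodule.mem_top, z.2⟩
    obtain ⟨y, hy, w, ⟨c, -, rfl⟩, hyw⟩ := Submodule.mem_sup.mp (hle hz)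
    refine ⟨⟨y, (hNc hy).2⟩, hy, ?_⟩
    exact (homologyClass_eq_of_eq_add (c := (chainRep x₀ 2).asModuleEquiv c) hyw.symm).trans hza
  exact this ▸ hfg.map _

end AlexanderFinite

namespace LineArrangement

variable {n : ℕ} (A : LineArrangement n)

lemma finite_singularHomology (q : ℕ) :
    Module.Finite ℤ (singularHomology ℤ (q + 1) A.Complement) := by
  obtain ⟨l, hl, hu⟩ := A.exists_convexCharts
  refine CharVar.finite_singularHomology (hu ▸ ?_)
  exact ChainSystem.fgHomology_union _ (fun U => isOpen_of_mem_convexCharts)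
    (fun U hU V => inter_mem_convexCharts hU) (fun U => singularSystem_fgHomology) _ l hl

instance (x₀ : A.Complement) : Group.FG (DeckGroup A.Complement x₀) :=
  have : Nonempty A.Complement := ⟨x₀⟩
  have := A.finite_singularHomology 0
  deckGroup_fg x₀

instance (x₀ : A.Complement) :
    IsNoetherianRing (MonoidAlgebra ℂ (DeckGroup A.Complement x₀)) :=
  isNoetherianRing_monoidAlgebra x₀

instance finite_alexanderInvariant (x₀ : A.Complement) :
    Module.Finite (MonoidAlgebra ℂ (DeckGroup A.Complement x₀))
      (AlexanderInvariant A.Complement x₀) := by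
  have : Nonempty A.Complement := ⟨x₀⟩
  obtain ⟨l, hl, hu⟩ := A.exists_convexCharts
  refine CharVar.finite_alexanderInvariant x₀ (hu ▸ ?_)
  exact ChainSystem.fgHomology_union _ (fun U => isOpen_of_mem_convexCharts)
    (fun U hU V => inter_mem_convexCharts hU) (fun U => coverSystem_fgHomology x₀) _ l hl

end LineArrangement

/-! ### Minors, rank, and the Fitting ideals at a character -/

section Minors

variable {F : Type} [Field F] {p q m : ℕ}

lemma exists_linearIndependent_rows (M : Matrix (Fin p) (Fin q) F) (h : m ≤ M.rank) :
    ∃ r : Fin m → Fin p, LinearIndependent F (M.submatrix r id).row := by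
  obtain ⟨κ, a, ha, hspan, hli⟩ := exists_linearIndependent' F M.row
  have := Finite.of_injective a ha
  have := Fintype.ofFinite κ
  have hcard : M.rank = Fintype.card κ := by
    rw [Matrix.rank_eq_finrank_span_row, ← hspan, finrank_span_eq_card hli]
  obtain ⟨f⟩ : Nonempty (Fin m ↪ κ) := Function.Embedding.nonempty_of_card_le (by simpa [← hcard])
  exact ⟨a ∘ f, hli.comp f f.injective⟩

/-- The rank of a matrix is less than `m` iff all its `m`-minors vanish. -/
lemma rank_lt_iff_forall_minor (M : Matrix (Fin p) (Fin q) F) :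
    M.rank < m ↔ ∀ (r : Fin m → Fin p) (c : Fin m → Fin q), (M.submatrix r c).det = 0 := by
  constructor
  · intro h r c
    by_contra hdet
    have h1 := Matrix.rank_of_det_ne_zero hdet
    have h2 := Matrix.rank_submatrix_le M r c
    rw [h1, Fintype.card_fin] at h2
    omega
  · intro h
    by_contra! hle
    obtain ⟨r, hr⟩ := exists_linearIndependent_rows M hle
    have h1 : m ≤ (M.submatrix r id).transpose.rank := by
      rw [Matrix.rank_transpose, hr.rank_matrix, Fintype.card_fin]
    obtain ⟨c, hc⟩ := exists_linearIndependent_rows _ h1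
    have h2 := (Matrix.isUnit_iff_isUnit_det _).mp (Matrix.linearIndependent_rows_iff_isUnit.mp hc)
    have h3 : ((M.submatrix r id).transpose.submatrix c id) = (M.submatrix r c).transpose := rfl
    rw [h3, Matrix.det_transpose, h r c] at h2
    exact not_isUnit_zero h2

end Minors

section Fitting

variable {G V : Type} [CommGroup G] [AddCommGroup V] [Module ℂ V] (τ : Representation ℂ G V)
  (χ : G →* ℂˣ)

/-- The extension of a character to the group ring. -/
abbrev evalAt : MonoidAlgebra ℂ G →ₐ[ℂ] ℂ := MonoidAlgebra.lift ℂ ℂ G ((Units.coeHom ℂ).comp χ)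

lemma map_asAlgebraHom_eq {φ : Module.Dual ℂ V} (hφ : ∀ g v, φ (τ g v) = χ g * φ v)
    (r : MonoidAlgebra ℂ G) (v : V) : φ (τ.asAlgebraHom r v) = evalAt χ r * φ v := by
  induction r using MonoidAlgebra.induction_on with
  | of g =>
    rw [Representation.asAlgebraHom_of, hφ]
    simp [evalAt]
  | add a b ha hb => rw [map_add, map_add, LinearMap.add_apply, map_add, ha, hb, add_mul]
  | smul a b hb => rw [map_smul, map_smul, LinearMap.smul_apply, map_smul, hb, smul_mul_assoc]

/-- For a presentation of a representation over the group ring, the linear forms on which `G` acts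
through `χ` are given by the kernel of the presentation matrix at `χ`. -/
lemma exists_equiv_ker {p q : ℕ} (Ω : Matrix (Fin p) (Fin q) (MonoidAlgebra ℂ G))
    (π : (Fin q → MonoidAlgebra ℂ G) →ₗ[MonoidAlgebra ℂ G] τ.asModule)
    (hπ : Function.Surjective π) (hker : LinearMap.ker π = LinearMap.range Ω.vecMulLinear)
    (D : Submodule ℂ (Module.Dual ℂ V)) (hD : ∀ φ, φ ∈ D ↔ ∀ g v, φ (τ g v) = χ g * φ v) :
    Nonempty (D ≃ₗ[ℂ] LinearMap.ker (Ω.map (evalAt χ)).mulVecLin) := by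
  let e (j : Fin q) : Fin q → MonoidAlgebra ℂ G := Pi.single j 1
  have hφπ (φ : D) (x : Fin q → MonoidAlgebra ℂ G) :
      φ.1 (τ.asModuleEquiv (π x)) = ∑ j, evalAt χ (x j) * φ.1 (τ.asModuleEquiv (π (e j))) := by
    have hx : x = ∑ j, x j • e j := pi_eq_sum_univ' x
    conv_lhs => rw [hx]
    simp only [map_sum, map_smul, Representation.asModuleEquiv_map_smul]
    exact Finset.sum_congr rfl fun j _ => map_asAlgebraHom_eq τ χ ((hD _).mp φ.2) _ _
  let f : D →ₗ[ℂ] (Fin q → ℂ) :=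
    { toFun := fun φ j => φ.1 (τ.asModuleEquiv (π (e j)))
      map_add' := fun _ _ => rfl
      map_smul' := fun _ _ => rfl }
  have hf (φ : D) : f φ ∈ LinearMap.ker (Ω.map (evalAt χ)).mulVecLin := by
    refine funext fun i => ?_
    have hi : π (Ω i) = 0 := by
      rw [← LinearMap.mem_ker, hker]
      exact ⟨Pi.single i 1, Matrix.single_one_vecMul i Ω⟩
    have := hφπ φ (Ω i)
    rw [hi, map_zero, map_zero] at this
    exact this.symm
  refine ⟨LinearEquiv.ofBijective (f.codRestrict _ hf) ⟨?_, ?_⟩⟩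
  · intro φ ψ h
    refine Subtype.ext (LinearMap.ext fun v => ?_)
    obtain ⟨x, hx⟩ := hπ (τ.asModuleEquiv.symm v)
    have hv : v = τ.asModuleEquiv (π x) := by rw [hx, LinearEquiv.apply_symm_apply]
    have h' (j) : φ.1 (τ.asModuleEquiv (π (e j))) = ψ.1 (τ.asModuleEquiv (π (e j))) :=
      congrFun (congrArg Subtype.val h) j
    rw [hv, hφπ, hφπ]
    simp only [h']
  · rintro ⟨v, hv⟩
    let ψ : (Fin q → MonoidAlgebra ℂ G) →ₗ[ℂ] ℂ :=
      ∑ j, (LinearMap.mulRight ℂ (v j)).comp ((evalAt χ).toLinearMap.comp (LinearMap.proj j))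
    have hψ (x) : ψ x = ∑ j, evalAt χ (x j) * v j := by simp [ψ]
    let π' : (Fin q → MonoidAlgebra ℂ G) →ₗ[ℂ] V :=
      { toFun := fun x => τ.asModuleEquiv (π x)
        map_add' := fun x y => by rw [map_add, map_add]
        map_smul' := fun c x => by
          rw [algebra_compatible_smul (MonoidAlgebra ℂ G) c x, map_smul,
            Representation.asModuleEquiv_map_smul, AlgHom.commutes]
          rfl }
    have hπ' : Function.Surjective π' := τ.asModuleEquiv.surjective.comp hπ
    obtain ⟨φ, hφ⟩ := exists_factor_of_surjective hπ' ψ fun x hx => by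
      have hx' : x ∈ LinearMap.ker π := τ.asModuleEquiv.injective (hx.trans (map_zero _).symm)
      rw [hker] at hx'
      obtain ⟨y, rfl⟩ := hx'
      have hv' (i) : ∑ j, evalAt χ (Ω i j) * v j = 0 := congrFun hv i
      rw [hψ]
      simp only [Matrix.vecMulLinear_apply, Matrix.vecMul, dotProduct, map_sum, map_mul,
        Finset.sum_mul]
      rw [Finset.sum_comm]
      refine Finset.sum_eq_zero fun i _ => ?_
      simp only [mul_assoc]
      rw [← Finset.mul_sum, hv', mul_zero]
    refine ⟨⟨φ, (hD φ).mpr fun g v => ?_⟩, Subtype.ext (funext fun j => ?_)⟩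
    · obtain ⟨x, rfl⟩ := hπ' v
      have h1 : τ g (π' x) = π' (MonoidAlgebra.of ℂ G g • x) := by
        change _ = τ.asModuleEquiv (π _)
        rw [map_smul, Representation.asModuleEquiv_map_smul, Representation.asAlgebraHom_of]
        rfl
      rw [h1, hφ, hφ, hψ, hψ, Finset.mul_sum]
      refine Finset.sum_congr rfl fun j _ => ?_
      rw [Pi.smul_apply, smul_eq_mul, map_mul, ← mul_assoc]
      congr 2
      simp [evalAt]
    · change φ (π' (e j)) = v j
      rw [hφ, hψ, Finset.sum_eq_single j]
      · simp [e]
      · intro i _ hij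
        simp [e, Pi.single_eq_of_ne hij]
      · simp

/-- A character lies in the zero locus of the `k`-th Fitting ideal iff the space of linear forms on
which the group acts through it has dimension at least `k`. -/
theorem forall_fittingIdeal_iff [IsNoetherianRing (MonoidAlgebra ℂ G)]
    [Module.Finite (MonoidAlgebra ℂ G) τ.asModule]
    (D : Submodule ℂ (Module.Dual ℂ V)) (hD : ∀ φ, φ ∈ D ↔ ∀ g v, φ (τ g v) = χ g * φ v) (k : ℕ) :
    (∀ f ∈ fittingIdeal (MonoidAlgebra ℂ G) τ.asModule k, evalAt χ f = 0) ↔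
      (k : Cardinal) ≤ Module.rank ℂ D := by
  have key {p q : ℕ} (Ω : Matrix (Fin p) (Fin q) (MonoidAlgebra ℂ G))
      (π : (Fin q → MonoidAlgebra ℂ G) →ₗ[MonoidAlgebra ℂ G] τ.asModule)
      (hπ : Function.Surjective π) (hker : LinearMap.ker π = LinearMap.range Ω.vecMulLinear) :
      (k : Cardinal) ≤ Module.rank ℂ D ↔
        ∀ (r : Fin (q + 1 - k) → Fin p) (c : Fin (q + 1 - k) → Fin q),
          evalAt χ (Ω.submatrix r c).det = 0 := by
    obtain ⟨E⟩ := exists_equiv_ker τ χ Ω π hπ hker D hD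
    have h1 := (Ω.map (evalAt χ)).mulVecLin.finrank_range_add_finrank_ker
    rw [Module.finrank_fin_fun] at h1
    change (Ω.map (evalAt χ)).rank + _ = _ at h1
    have h2 (r : Fin (q + 1 - k) → Fin p) (c : Fin (q + 1 - k) → Fin q) :
        evalAt χ (Ω.submatrix r c).det = ((Ω.map (evalAt χ)).submatrix r c).det := by
      rw [AlgHom.map_det]
      rfl
    simp only [h2]
    rw [← rank_lt_iff_forall_minor, E.rank_eq, ← Module.finrank_eq_rank, Nat.cast_le]
    omega
  constructor
  · intro h
    obtain ⟨q, π, hπ⟩ := Module.Finite.exists_fin' (MonoidAlgebra ℂ G) τ.asModule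
    have hfg : (LinearMap.ker π).FG := IsNoetherian.noetherian _
    obtain ⟨p, s, hs⟩ := Submodule.fg_iff_exists_fin_generating_family.mp hfg
    let Ω : Matrix (Fin p) (Fin q) (MonoidAlgebra ℂ G) := Matrix.of s
    have hker : LinearMap.ker π = LinearMap.range Ω.vecMulLinear := by
      rw [range_vecMulLinear, ← hs]
      rfl
    exact (key Ω π hπ hker).mpr fun r c =>
      h _ (Ideal.subset_span ⟨p, q, Ω, π, hπ, hker, r, c, rfl⟩)
  · intro h f hf
    have hle : fittingIdeal (MonoidAlgebra ℂ G) τ.asModule k ≤ RingHom.ker (evalAt χ) := by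
      refine Ideal.span_le.mpr ?_
      rintro _ ⟨p, q, Ω, π, hπ, hker, r, c, rfl⟩
      exact (key Ω π hπ hker).mp h r c
    exact hle hf

end Fitting

lemma LineArrangement.mem_charVariety_iff {n : ℕ} (A : LineArrangement n) (x₀ : A.Complement)
    (ρ : DeckGroup A.Complement x₀ →* ℂˣ) (k : ℕ) :
    ρ ∈ charVariety A.Complement x₀ k ↔ (k : Cardinal) ≤ Module.rank ℂ (charDual x₀ ρ) :=
  forall_fittingIdeal_iff (deckRep x₀) ρ (charDual x₀ ρ) (fun _ => Iff.rfl) k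

/-! ### Invariant linear forms on the homology of the cover from cup products -/

namespace PathCharacter

variable {X : Type} [TopologicalSpace X] {x₀ : X} (χ χ' : PathCharacter X (Multiplicative ℤ))

/-- The value of an integral path character on the edge `[e₀, e₁]` of a simplex. -/
def edgeInt {q : ℕ} (σ : C(Simplex (q + 1), X)) : ℤ := (χ.onEdge σ).toAdd

/-- The function on the cover given by an integral path character. -/
def coverInt (e : MaxAbCover X x₀) : ℤ := (χ.onCover e).toAdd

/-- The homomorphism on the deck group given by an integral path character. -/
def deckInt (k : DeckGroup X x₀) : ℤ := (χ.deckHom x₀ k).toAdd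

lemma coverInt_deck (k : DeckGroup X x₀) (e : MaxAbCover X x₀) :
    χ.coverInt (deck x₀ k e) = χ.deckInt k + χ.coverInt e :=
  congrArg Multiplicative.toAdd (χ.onCover_deck k e)

lemma coverInt_vertex_one [UniqueLocalPaths X] {q : ℕ}
    (σ : C(Simplex (q + 1), MaxAbCover X x₀)) :
    χ.coverInt (σ (stdSimplex.vertex 1)) =
      χ.coverInt (σ (stdSimplex.vertex 0)) + χ.edgeInt ((MaxAbCover.proj X x₀).comp σ) :=
  congrArg Multiplicative.toAdd (χ.onCover_path σ (stdEdge q))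

lemma edgeInt_face (σ : C(Simplex 2, X)) :
    χ.edgeInt (face σ 1) = χ.edgeInt (face σ 2) + χ.edgeInt (face σ 0) :=
  congrArg Multiplicative.toAdd (χ.onEdge_face σ)

/-- The cup product of two integral path characters, as a singular `2`-cochain. -/
def cup (σ : C(Simplex 2, X)) : ℤ := χ.edgeInt (face σ 2) * χ'.edgeInt (face σ 0)

lemma exists_edgeInt_face_face (σ : C(Simplex 3, X)) : ∃ u : Fin 4 → ℤ, ∀ (i : Fin 4) (j : Fin 3)
    (a b : Fin 4), i.succAbove (j.succAbove 1) = a → i.succAbove (j.succAbove 0) = b →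
      χ.edgeInt (face (face σ i) j) = u a - u b := by
  obtain ⟨u, hu⟩ := χ.exists_onEdge_comp σ
  refine ⟨fun i => (u (stdSimplex.vertex i)).toAdd, ?_⟩
  rintro i j _ _ rfl rfl
  have := hu (face (face (ContinuousMap.id (Simplex 3)) i) j)
  rw [face_vertex, face_vertex, face_vertex, face_vertex] at this
  exact congrArg Multiplicative.toAdd this

lemma cup_bdry (σ : C(Simplex 3, X)) :
    ∑ i : Fin 4, (-1) ^ (i : ℕ) * cup χ χ' (face σ i) = 0 := by
  obtain ⟨u, hu⟩ := χ.exists_edgeInt_face_face σ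
  obtain ⟨v, hv⟩ := χ'.exists_edgeInt_face_face σ
  rw [Fin.sum_univ_four]
  simp only [cup]
  rw [hu 0 2 2 1 rfl rfl, hv 0 0 3 2 rfl rfl, hu 1 2 2 0 rfl rfl, hv 1 0 3 2 rfl rfl,
    hu 2 2 1 0 rfl rfl, hv 2 0 3 1 rfl rfl, hu 3 2 1 0 rfl rfl, hv 3 0 2 1 rfl rfl]
  simp
  ring

end PathCharacter

section CupForms

variable {X : Type} [TopologicalSpace X] {x₀ : X} {n : ℕ}
  (χ : Fin n → PathCharacter X (Multiplicative ℤ))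

/-- The pairs `i < j` of indices. -/
abbrev Pairs (n : ℕ) : Type := {p : Fin n × Fin n // p.1 < p.2}

/-- The cup products of the pairs `i < j` of characters, as a linear map on `2`-chains. -/
def cupChain : Chain ℤ 2 X →ₗ[ℤ] (Pairs n → ℤ) :=
  Finsupp.linearCombination ℤ fun σ p => (χ p.1.1).cup (χ p.1.2) σ

lemma cupChain_single (σ : C(Simplex 2, X)) (r : ℤ) (p : Pairs n) :
    cupChain χ (Finsupp.single σ r) p = r * (χ p.1.1).cup (χ p.1.2) σ := by
  simp [cupChain, Finsupp.linearCombination_single]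

lemma cupChain_bdry (c : Chain ℤ 3 X) : cupChain χ (Chain.bdry ℤ 2 X c) = 0 := by
  induction c using Finsupp.induction_linear with
  | zero => simp
  | add c d hc hd => rw [map_add, map_add, hc, hd, add_zero]
  | single σ r =>
    funext p
    rw [Chain.bdry_single, map_sum, Finset.sum_apply]
    simp only [cupChain_single, mul_assoc]
    rw [← Finset.mul_sum, PathCharacter.cup_bdry, mul_zero, Pi.zero_apply]

/-- A combination of cup products that vanishes on integral `2`-cycles is the coboundary of a
`1`-cochain, since `ℂ` is a divisible group. -/
lemma exists_primitive_cup (α : Pairs n → ℂ)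
    (hα : ∀ z, Chain.bdry ℤ 1 X z = 0 → ∑ p, α p * cupChain χ z p = 0) :
    ∃ c : C(Simplex 1, X) → ℂ, ∀ σ : C(Simplex 2, X),
      c (face σ 0) - c (face σ 1) + c (face σ 2) =
        ∑ p, α p * ((χ p.1.1).cup (χ p.1.2) σ : ℤ) := by
  let ψ : Chain ℤ 2 X →ₗ[ℤ] ℂ :=
    { toFun := fun z => ∑ p, α p * cupChain χ z p
      map_add' := fun z w => by
        simp only [map_add, Pi.add_apply, Int.cast_add, mul_add, Finset.sum_add_distrib]
      map_smul' := fun r z => by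
        simp only [map_smul, Pi.smul_apply, smul_eq_mul, Int.cast_mul, RingHom.id_apply,
          zsmul_eq_mul, Finset.mul_sum]
        exact Finset.sum_congr rfl fun p _ => by ring }
  obtain ⟨φ, hφ⟩ := exists_factor_of_surjective
    (LinearMap.surjective_rangeRestrict (Chain.bdry ℤ 1 X)) ψ
    fun z hz => hα z (congrArg Subtype.val hz)
  obtain ⟨h, hh⟩ := (Module.Baer.of_divisible ℂ).extension_property_addMonoidHom
    (LinearMap.range (Chain.bdry ℤ 1 X)).subtype.toAddMonoidHom Subtype.val_injective
    φ.toAddMonoidHom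
  refine ⟨fun σ => h (Finsupp.single σ 1), fun σ => ?_⟩
  have h1 : h (Chain.bdry ℤ 1 X (Finsupp.single σ 1)) = ψ (Finsupp.single σ 1) := by
    rw [← hφ]
    exact congrArg (fun f : _ →+ ℂ => f ((Chain.bdry ℤ 1 X).rangeRestrict (Finsupp.single σ 1))) hh
  have h2 : ψ (Finsupp.single σ 1) = ∑ p, α p * ((χ p.1.1).cup (χ p.1.2) σ : ℤ) := by
    simp only [ψ, LinearMap.coe_mk, AddHom.coe_mk, cupChain_single, one_mul]
  rw [← h2, ← h1, Chain.bdry_single, Fin.sum_univ_three]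
  have h3 (r : ℤ) (τ : C(Simplex 1, X)) :
      h (Finsupp.single τ r) = r * h (Finsupp.single τ 1) := by
    rw [← zsmul_eq_mul, ← map_zsmul]
    simp
  rw [map_add, map_add, h3, h3 (1 * _), h3 (1 * _)]
  simp
  ring

variable [UniqueLocalPaths X]

/-- From a combination `∑ αₚ χᵢ ∪ χⱼ = δc` one gets the linear form `c - ∑ αₚ fᵢ χⱼ` on the chains of
the cover, where `χᵢ = δfᵢ`; it vanishes on boundaries. -/
lemma exists_form (α : Pairs n → ℂ)
    (hα : ∀ z, Chain.bdry ℤ 1 X z = 0 → ∑ p, α p * cupChain χ z p = 0) :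
    ∃ ψ : Chain ℂ 1 (MaxAbCover X x₀) →ₗ[ℂ] ℂ, (∀ c, ψ (Chain.bdry ℂ 1 _ c) = 0) ∧
      ∀ k σ, ψ (deckChain x₀ 1 k (Finsupp.single σ 1)) = ψ (Finsupp.single σ 1) -
        ∑ p, α p * (((χ p.1.1).deckInt k : ℤ) *
          ((χ p.1.2).edgeInt ((MaxAbCover.proj X x₀).comp σ) : ℤ)) := by
  obtain ⟨c, hc⟩ := exists_primitive_cup χ α hα
  let v (σ : C(Simplex 1, MaxAbCover X x₀)) : ℂ := c ((MaxAbCover.proj X x₀).comp σ) -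
    ∑ p, α p * (((χ p.1.1).coverInt (σ (stdSimplex.vertex 0)) : ℤ) *
      ((χ p.1.2).edgeInt ((MaxAbCover.proj X x₀).comp σ) : ℤ))
  let ψ : Chain ℂ 1 (MaxAbCover X x₀) →ₗ[ℂ] ℂ := Finsupp.linearCombination ℂ v
  have hψ (σ) (r : ℂ) : ψ (Finsupp.single σ r) = r * v σ := by
    simp only [ψ, Finsupp.linearCombination_single, smul_eq_mul]
  refine ⟨ψ, fun d => ?_, fun k σ => ?_⟩
  · induction d using Finsupp.induction_linear with
    | zero => simp
    | add c d hc hd => rw [map_add, map_add, hc, hd, add_zero]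
    | single σ r =>
      have hface (i : Fin 3) : (MaxAbCover.proj X x₀).comp (face σ i) =
        face ((MaxAbCover.proj X x₀).comp σ) i := rfl
      have h0 : face σ 0 (stdSimplex.vertex 0) = face σ 2 (stdSimplex.vertex 1) := by
        rw [face_vertex, face_vertex]
        rfl
      have h1 : face σ 1 (stdSimplex.vertex 0) = face σ 2 (stdSimplex.vertex 0) := by
        rw [face_vertex, face_vertex]
        rfl
      have key : v (face σ 0) - v (face σ 1) + v (face σ 2) = 0 := by
        have h2 := hc ((MaxAbCover.proj X x₀).comp σ)
        simp only [v, hface, h0, h1, PathCharacter.coverInt_vertex_one, PathCharacter.edgeInt_face]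
        rw [sub_sub_sub_comm, sub_add_sub_comm, h2, ← Finset.sum_sub_distrib,
          ← Finset.sum_add_distrib, ← Finset.sum_sub_distrib]
        refine Finset.sum_eq_zero fun p _ => ?_
        simp only [PathCharacter.cup]
        push_cast
        ring
      rw [Chain.bdry_single, map_sum, Fin.sum_univ_three, hψ, hψ, hψ]
      simp
      linear_combination r * key
  · have h0 : ((deck x₀ k).comp σ) (stdSimplex.vertex 0) = deck x₀ k (σ (stdSimplex.vertex 0)) :=
      rfl
    rw [Chain.map_single, hψ, hψ, one_mul, one_mul]
    simp only [v, h0, PathCharacter.coverInt_deck, ← ContinuousMap.comp_assoc,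
      MaxAbCover.proj_comp_deck]
    rw [sub_sub, ← Finset.sum_add_distrib]
    congr 1
    refine Finset.sum_congr rfl fun p _ => ?_
    push_cast
    ring

end CupForms

/-! ### Lifted commutators of loops -/

section LiftedLoops

variable {X : Type} [TopologicalSpace X] [PathConnectedSpace X] (x₀ : X) {n : ℕ}

/-- Lifts of loops to the cover, all starting at the same point. -/
lemma exists_lifted_loops (γ : Fin n → Path x₀ x₀) :
    ∃ (e : MaxAbCover X x₀) (g : Fin n → DeckGroup X x₀)
    (s : Fin n → C(Simplex 1, MaxAbCover X x₀)), ∀ i,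
      (MaxAbCover.proj X x₀).comp (s i) = simplexOfPath (γ i) ∧
        s i (stdSimplex.vertex 0) = e ∧ s i (stdSimplex.vertex 1) = deck x₀ (g i) e := by
  let e : MaxAbCover X x₀ := MaxAbCover.mk (Path.Homotopic.Quotient.refl x₀)
  have h (i) : ∃ (g : DeckGroup X x₀) (s : C(Simplex 1, MaxAbCover X x₀)),
      (MaxAbCover.proj X x₀).comp s = simplexOfPath (γ i) ∧
        s (stdSimplex.vertex 0) = e ∧ s (stdSimplex.vertex 1) = deck x₀ g e := by
    obtain ⟨s', hs'⟩ := MaxAbCover.exists_lift_simplex (x₀ := x₀) (simplexOfPath (γ i))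
    have hp (t) : MaxAbCover.proj X x₀ (s' t) = simplexOfPath (γ i) t :=
      congrArg (fun f : C(Simplex 1, X) => f t) hs'
    obtain ⟨k, hk⟩ := MaxAbCover.exists_deck_eq (x₀ := x₀) (e := s' (stdSimplex.vertex 0)) (e' := e)
      ((hp _).trans (simplexOfPath_vertex_zero _))
    obtain ⟨g, hg⟩ := MaxAbCover.exists_deck_eq (x₀ := x₀) (e := e)
      (e' := deck x₀ k (s' (stdSimplex.vertex 1)))
      ((hp _).trans (simplexOfPath_vertex_one _)).symm
    exact ⟨g, (deck x₀ k).comp s',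
      by rw [← ContinuousMap.comp_assoc, MaxAbCover.proj_comp_deck, hs'],
      hk, hg.symm⟩
  choose g s hs using h
  exact ⟨e, g, s, hs⟩

end LiftedLoops

section CommutatorCycles

variable {X : Type} [TopologicalSpace X] {x₀ : X} {n : ℕ}
  (χ : Fin n → PathCharacter X (Multiplicative ℤ)) [UniqueLocalPaths X]

/-- The pullback of an integral path character to the cover is exact. -/
lemma edgeInt_cycle (χ : PathCharacter X (Multiplicative ℤ))
    (z : Chain.cycles ℂ 0 (MaxAbCover X x₀)) :
    Finsupp.linearCombination ℂ (fun σ : C(Simplex 1, MaxAbCover X x₀) =>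
      ((χ.edgeInt ((MaxAbCover.proj X x₀).comp σ) : ℤ) : ℂ)) z.1 = 0 := by
  let F : Chain ℂ 0 (MaxAbCover X x₀) →ₗ[ℂ] ℂ :=
    Finsupp.linearCombination ℂ fun σ => ((χ.coverInt (σ (stdSimplex.vertex 0)) : ℤ) : ℂ)
  have hF (σ) (r : ℂ) :
      F (Finsupp.single σ r) = r * (χ.coverInt (σ (stdSimplex.vertex 0)) : ℤ) := by
    simp only [F, Finsupp.linearCombination_single, smul_eq_mul]
  have h (c : Chain ℂ 1 (MaxAbCover X x₀)) :
      Finsupp.linearCombination ℂ (fun σ : C(Simplex 1, MaxAbCover X x₀) =>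
        ((χ.edgeInt ((MaxAbCover.proj X x₀).comp σ) : ℤ) : ℂ)) c = F (Chain.bdry ℂ 0 _ c) := by
    induction c using Finsupp.induction_linear with
    | zero => simp
    | add c d hc hd => simp only [map_add, hc, hd]
    | single σ r =>
      rw [bdry_edge, map_sub, hF, hF, Finsupp.linearCombination_single, smul_eq_mul]
      change _ = r * (χ.coverInt (σ (stdSimplex.vertex 1)) : ℤ) -
        r * (χ.coverInt (σ (stdSimplex.vertex 0)) : ℤ)
      rw [χ.coverInt_vertex_one]
      push_cast
      ring
  have hz : Chain.bdry ℂ 0 _ z.1 = 0 := z.2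
  rw [h, hz, map_zero]

/-- The form of a combination of cup products that vanishes on `2`-cycles descends to a
`K`-invariant linear form on the homology of the cover. -/
lemma exists_mem_charDual (α : Pairs n → ℂ)
    (hα : ∀ z, Chain.bdry ℤ 1 X z = 0 → ∑ p, α p * cupChain χ z p = 0) :
    ∃ ψ : Chain ℂ 1 (MaxAbCover X x₀) →ₗ[ℂ] ℂ, ∃ φ ∈ charDual x₀ 1,
      (∀ z, φ (homologyClass _ z) = ψ z) ∧
      ∀ k σ, ψ (deckChain x₀ 1 k (Finsupp.single σ 1)) = ψ (Finsupp.single σ 1) -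
        ∑ p, α p * (((χ p.1.1).deckInt k : ℤ) *
          ((χ p.1.2).edgeInt ((MaxAbCover.proj X x₀).comp σ) : ℤ)) := by
  obtain ⟨ψ, hb, hk⟩ := exists_form (x₀ := x₀) χ α hα
  obtain ⟨φ, hφ⟩ := exists_descend ψ hb
  refine ⟨ψ, φ, mem_charDual_iff.mpr fun k z => ?_, hφ, hk⟩
  have key (c : Chain ℂ 1 (MaxAbCover X x₀)) : ψ (deckChain x₀ 1 k c) = ψ c -
      ∑ p : Pairs n, α p * (((χ p.1.1).deckInt k : ℤ) *
        Finsupp.linearCombination ℂ (fun σ : C(Simplex 1, MaxAbCover X x₀) =>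
          (((χ p.1.2).edgeInt ((MaxAbCover.proj X x₀).comp σ) : ℤ) : ℂ)) c) := by
    induction c using Finsupp.induction_linear with
    | zero => simp
    | add c d hc hd =>
      simp only [map_add, hc, hd, mul_add, Finset.sum_add_distrib]
      ring
    | single σ r =>
      have hr : Finsupp.single σ r = r • Finsupp.single σ (1 : ℂ) := by simp
      rw [hr, map_smul, map_smul, map_smul, hk, smul_sub, Finset.smul_sum]
      congr 1
      refine Finset.sum_congr rfl fun p _ => ?_
      rw [map_smul, Finsupp.linearCombination_single, smul_eq_mul, smul_eq_mul, smul_eq_mul]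
      ring
  have h1 : φ (homologyClass _ (deckCycle k z)) = ψ (deckChain x₀ 1 k z) := hφ _
  rw [h1, key, hφ]
  simp only [edgeInt_cycle, mul_zero, Finset.sum_const_zero, sub_zero]
  simp

variable [PathConnectedSpace X] (γ : Fin n → Path x₀ x₀)

/-- If loops `γⱼ` are dual to the characters `χᵢ`, the coefficients of a combination of cup products
that vanishes on `2`-cycles are the values of an invariant linear form on the cycles that lift the
commutators of the loops. -/
lemma exists_commutator_classes
    (hγ : ∀ i j, ((χ i).val (Path.Homotopic.Quotient.mk (γ j))).toAdd = if i = j then 1 else 0) :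
    ∃ a : Pairs n → singularHomology ℂ 1 (MaxAbCover X x₀), ∀ α : Pairs n → ℂ,
      (∀ z, Chain.bdry ℤ 1 X z = 0 → ∑ p, α p * cupChain χ z p = 0) →
        ∃ φ ∈ charDual x₀ 1, ∀ p, φ (a p) = α p := by
  obtain ⟨e, g, s, hs⟩ := exists_lifted_loops x₀ γ
  have hedge (i j) :
      (χ i).edgeInt ((MaxAbCover.proj X x₀).comp (s j)) = if i = j then 1 else 0 := by
    rw [← hγ i j, (hs j).1]
    exact congrArg Multiplicative.toAdd ((χ i).onEdge_simplexOfPath _)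
  have hdeck (i j) : (χ i).deckInt (g j) = if i = j then 1 else 0 := by
    have h := (χ i).coverInt_vertex_one (s j)
    rw [(hs j).2.2, (hs j).2.1, (χ i).coverInt_deck, hedge, add_comm] at h
    exact add_left_cancel h
  let S (i : Fin n) : Chain ℂ 1 (MaxAbCover X x₀) := Finsupp.single (s i) 1
  let P (k : DeckGroup X x₀) : Chain ℂ 0 (MaxAbCover X x₀) := Finsupp.single (pt (deck x₀ k e)) 1
  have hS (k) (i) : Chain.bdry ℂ 0 _ (deckChain x₀ 1 k (S i)) = P (k * g i) - P k := by
    have h1 : (deck x₀ k).comp (s i) (stdSimplex.vertex 0) = deck x₀ k e := by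
      rw [← (hs i).2.1]; rfl
    have h2 : (deck x₀ k).comp (s i) (stdSimplex.vertex 1) = deck x₀ (k * g i) e := by
      rw [MaxAbCover.deck_mul_apply, ← (hs i).2.2]; rfl
    simp only [S]
    rw [Chain.map_single, bdry_edge, h1, h2]
  have hS1 (i) : Chain.bdry ℂ 0 _ (S i) = P (g i) - P 1 := by
    simp only [S, P]
    rw [bdry_edge, (hs i).2.1, (hs i).2.2, MaxAbCover.deck_one_apply]
  let z (p : Pairs n) : Chain ℂ 1 (MaxAbCover X x₀) :=
    deckChain x₀ 1 (g p.1.2) (S p.1.1) - S p.1.1 - (deckChain x₀ 1 (g p.1.1) (S p.1.2) - S p.1.2)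
  have hz (p) : z p ∈ Chain.cycles ℂ 0 (MaxAbCover X x₀) := by
    rw [Chain.cycles, LinearMap.mem_ker]
    simp only [z, map_sub, hS, hS1]
    rw [mul_comm (g p.1.2)]
    abel
  refine ⟨fun p => homologyClass _ ⟨z p, hz p⟩, fun α hα => ?_⟩
  obtain ⟨ψ, φ, hφ, hφψ, hψ⟩ := exists_mem_charDual χ α hα
  refine ⟨φ, hφ, fun p => ?_⟩
  rw [hφψ]
  have hsum (i j : Fin n) : ∑ p : Pairs n, α p * (((χ p.1.1).deckInt (g i) : ℤ) *
      ((χ p.1.2).edgeInt ((MaxAbCover.proj X x₀).comp (s j)) : ℤ)) =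
        if h : i < j then α ⟨(i, j), h⟩ else 0 := by
    simp only [hedge, hdeck]
    split_ifs with h
    · rw [Finset.sum_eq_single ⟨(i, j), h⟩]
      · simp
      · rintro ⟨⟨a, b⟩, hab⟩ _ hne
        have : ¬(a = i ∧ b = j) := fun ⟨h1, h2⟩ => hne (by subst h1 h2; rfl)
        by_cases ha : a = i
        · have hb : b ≠ j := fun hb => this ⟨ha, hb⟩
          simp [hb]
        · simp [ha]
      · simp
    · refine Finset.sum_eq_zero ?_
      rintro ⟨⟨a, b⟩, hab⟩ _
      by_cases ha : a = i
      · have hb : b ≠ j := fun hb => h (ha ▸ hb ▸ hab)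
        simp [hb]
      · simp [ha]
  change ψ (z p) = α p
  simp only [z, S, map_sub, hψ]
  rw [hsum, hsum, dif_pos p.2, dif_neg p.2.not_gt]
  simp

end CommutatorCycles

/-! ### The trivial character -/

section Trivial

variable {X : Type} [TopologicalSpace X] {x₀ : X} {n : ℕ}
  (χ : Fin n → PathCharacter X (Multiplicative ℤ)) (γ : Fin n → Path x₀ x₀)

lemma card_pairs (n : ℕ) : Fintype.card (Pairs n) = n.choose 2 := by
  let E : Pairs n ≃ Σ j : Fin n, Fin j :=
    { toFun := fun p => ⟨p.1.2, ⟨p.1.1, p.2⟩⟩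
      invFun := fun q => ⟨(⟨q.2, q.2.2.trans q.1.2⟩, q.1), q.2.2⟩
      left_inv := fun _ => rfl
      right_inv := fun _ => rfl }
  rw [Fintype.card_congr E, Fintype.card_sigma]
  simp only [Fintype.card_fin]
  rw [Fin.sum_univ_eq_sum_range (fun i => i) n, Finset.sum_range_id, Nat.choose_two_right]

/-- The relations between the cup products of the characters `χᵢ` span a space of dimension at least
`n.choose 2 - b₂`, and each of them gives an invariant linear form. -/
theorem le_rank_charDual_one [PathConnectedSpace X] [UniqueLocalPaths X]
    [Module.Finite ℤ (singularHomology ℤ 2 X)]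
    (hγ : ∀ i j, ((χ i).val (Path.Homotopic.Quotient.mk (γ j))).toAdd = if i = j then 1 else 0)
    {k : ℕ} (hk : k + bettiNumber 2 X ≤ n.choose 2) :
    (k : Cardinal) ≤ Module.rank ℂ (charDual x₀ 1) := by
  obtain ⟨Φ, hΦ⟩ := exists_descend (cupChain χ) (cupChain_bdry χ)
  have hr : Module.finrank ℤ (LinearMap.range Φ) ≤ bettiNumber 2 X := LinearMap.finrank_range_le Φ
  let b := Module.finBasis ℤ (LinearMap.range Φ)
  let T : (Pairs n → ℂ) →ₗ[ℂ] (Fin (Module.finrank ℤ (LinearMap.range Φ)) → ℂ) :=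
    (Matrix.of fun k p => (((b k).1 p : ℤ) : ℂ)).mulVecLin
  have hT (α) (hα : T α = 0) (z) (hz : Chain.bdry ℤ 1 X z = 0) :
      ∑ p, α p * cupChain χ z p = 0 := by
    let f : LinearMap.range Φ →ₗ[ℤ] ℂ :=
      { toFun := fun x => ∑ p, α p * (x.1 p : ℤ)
        map_add' := fun x y => by
          simp only [Submodule.coe_add, Pi.add_apply, Int.cast_add, mul_add,
            Finset.sum_add_distrib]
        map_smul' := fun r x => by
          simp only [SetLike.val_smul, Pi.smul_apply, smul_eq_mul, Int.cast_mul, RingHom.id_apply,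
            zsmul_eq_mul, Finset.mul_sum]
          exact Finset.sum_congr rfl fun p _ => by ring }
    have hf : f = 0 := by
      refine b.ext fun i => ?_
      have := congrFun hα i
      simp only [T, Matrix.mulVecLin_apply, Matrix.mulVec, dotProduct, Matrix.of_apply,
        Pi.zero_apply] at this
      refine Eq.trans (Finset.sum_congr rfl fun p _ => mul_comm _ _) this
    have := congrArg (fun f : LinearMap.range Φ →ₗ[ℤ] ℂ =>
      f ⟨Φ (Chain.toHomology ℤ 1 X ⟨z, hz⟩), LinearMap.mem_range_self _ _⟩) hf
    refine Eq.trans ?_ this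
    simp only [f, LinearMap.coe_mk, AddHom.coe_mk, hΦ]
  obtain ⟨a, ha⟩ := exists_commutator_classes χ γ hγ
  let Ev : charDual x₀ 1 →ₗ[ℂ] (Pairs n → ℂ) :=
    { toFun := fun φ p => φ.1 (a p)
      map_add' := fun _ _ => rfl
      map_smul' := fun _ _ => rfl }
  have hle : LinearMap.ker T ≤ LinearMap.range Ev := by
    intro α hα
    obtain ⟨φ, hφ, h⟩ := ha α (hT α hα)
    exact ⟨⟨φ, hφ⟩, funext h⟩
  have h1 := T.finrank_range_add_finrank_ker
  have h2 : Module.finrank ℂ (LinearMap.range T) ≤ Module.finrank ℤ (LinearMap.range Φ) :=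
    (Submodule.finrank_le _).trans (Module.finrank_fin_fun ℂ).le
  rw [Module.finrank_fintype_fun_eq_card, card_pairs] at h1
  have h3 : k ≤ Module.finrank ℂ (LinearMap.ker T) := by omega
  calc (k : Cardinal) ≤ Module.finrank ℂ (LinearMap.ker T) := by exact_mod_cast h3
    _ = Module.rank ℂ (LinearMap.ker T) := Module.finrank_eq_rank _ _
    _ ≤ Module.rank ℂ (LinearMap.range Ev) := Submodule.rank_mono hle
    _ ≤ _ := rank_range_le Ev

/-- The first cohomology of a trivial local system has at least the rank of a family of integral
characters with dual loops. -/
theorem le_rank_H1_of_transport_eq_one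
    (hγ : ∀ i j, ((χ i).val (Path.Homotopic.Quotient.mk (γ j))).toAdd = if i = j then 1 else 0)
    (L : RankOneLocalSystem X)
    (hL : ∀ {x y : X} (p : Path.Homotopic.Quotient x y), L.transport p = 1) :
    (n : Cardinal) ≤ Module.rank ℂ L.H1 := by
  have hδ (q) (c : L.Cochain q) (σ) : L.coboundary q c σ = c (face σ 0) +
      ∑ i : Fin (q + 1), (-1) ^ ((i : ℕ) + 1) * c (face σ i.succ) := by
    change (L.transport _ : ℂ) * _ + _ = _
    rw [hL, Units.val_one, one_mul]
  let c : (Fin n → ℂ) →ₗ[ℂ] L.Cochain 1 :=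
    { toFun := fun α σ => ∑ i, α i * ((χ i).edgeInt σ : ℤ)
      map_add' := fun α β => by
        funext σ
        simp only [Pi.add_apply, add_mul, Finset.sum_add_distrib]
      map_smul' := fun r α => by
        funext σ
        simp only [Pi.smul_apply, smul_eq_mul, mul_assoc, Finset.mul_sum, RingHom.id_apply] }
  have hc (α σ) : c α σ = ∑ i, α i * ((χ i).edgeInt σ : ℤ) := rfl
  have hcδ (α) : L.coboundary 1 (c α) = 0 := by
    funext σ
    rw [hδ, Fin.sum_univ_two]
    change c α (face σ 0) + (_ * c α (face σ 1) + _ * c α (face σ 2)) = 0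
    rw [hc, hc, hc, Finset.mul_sum, Finset.mul_sum, ← Finset.sum_add_distrib,
      ← Finset.sum_add_distrib]
    refine Finset.sum_eq_zero fun i _ => ?_
    rw [PathCharacter.edgeInt_face]
    simp
    ring
  let f : (Fin n → ℂ) →ₗ[ℂ] L.H1 := (Submodule.mkQ _).comp (c.codRestrict _ hcδ)
  have hf : Function.Injective f := by
    rw [injective_iff_map_eq_zero]
    intro α hα
    have h0 : (⟨c α, hcδ α⟩ : LinearMap.ker (L.coboundary 1)) ∈
        (LinearMap.range (L.coboundary 0)).submoduleOf (LinearMap.ker (L.coboundary 1)) :=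
      (Submodule.Quotient.mk_eq_zero _).mp hα
    obtain ⟨d, hd'⟩ := h0
    have hd : L.coboundary 0 d = c α := hd'
    funext j
    have h1 := congrFun hd (simplexOfPath (γ j))
    rw [hδ, Fin.sum_univ_one, hc, eq_pt (face _ 0)] at h1
    rw [face_vertex] at h1
    change _ + _ * d (face _ 1) = _ at h1
    rw [eq_pt (face _ 1), face_vertex] at h1
    change d (pt (simplexOfPath (γ j) (stdSimplex.vertex 1))) +
      _ * d (pt (simplexOfPath (γ j) (stdSimplex.vertex 0))) = _ at h1
    rw [simplexOfPath_vertex_zero, simplexOfPath_vertex_one] at h1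
    have h2 (i) : (χ i).edgeInt (simplexOfPath (γ j)) = if i = j then 1 else 0 := by
      rw [← hγ i j]
      exact congrArg Multiplicative.toAdd ((χ i).onEdge_simplexOfPath _)
    simp only [h2] at h1
    simpa using h1.symm
  have := LinearMap.rank_le_of_injective f hf
  rwa [rank_fin_fun] at this

end Trivial

/-! ### Winding numbers of circles -/

/-- The winding number of a positively oriented circle around `0`. -/
lemma wind_circle {ε : ℝ} {x : {z : ℂ // z ≠ 0}} (γ : Path x x)
    (hγ : ∀ s, (γ s : ℂ) = ε * Complex.exp (2 * Real.pi * Complex.I * (s : ℝ))) :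
    wind (Path.Homotopic.Quotient.mk γ) = 1 := by
  have hx : (x : ℂ) = ε := by
    rw [← γ.source, hγ]
    simp
  have hlog : Complex.exp (Complex.log x) = ε := by rw [Complex.exp_log x.2, hx]
  refine two_pi_I_cancel (z := Complex.log x) ?_
  rw [← wind_spec]
  have h0 : γ 0 = expCover (Complex.log x) := γ.source.trans (expCover_log x).symm
  have key : (fun s : unitInterval => Complex.log x + 2 * Real.pi * Complex.I * ((s : ℝ) : ℂ)) =
      expCover_cov.liftPath γ.toContinuousMap (Complex.log x) h0 := by
    rw [expCover_cov.eq_liftPath_iff]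
    refine ⟨by fun_prop, ?_, by simp⟩
    funext s
    refine Subtype.ext ?_
    change Complex.exp (_ + _) = (γ s : ℂ)
    rw [hγ, Complex.exp_add, hlog]
  refine (congrFun key 1).symm.trans ?_
  simp

lemma wind_eq_zero_of_mem_ball {c : ℂ} {r : ℝ} (h0 : (0 : ℂ) ∉ Metric.ball c r)
    {x : {z : ℂ // z ≠ 0}} (γ : Path x x) (hγ : ∀ s, (γ s : ℂ) ∈ Metric.ball c r) :
    wind (Path.Homotopic.Quotient.mk γ) = 0 := by
  have h : Path.Homotopic γ (Path.refl x) :=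
    homotopic_of_convex (P := fun z : ℂ => z ≠ 0) (convex_ball c r)
      (fun v hv (h : v = 0) => h0 (h ▸ hv)) γ (Path.refl x) hγ fun _ => by simpa using hγ 0
  rw [Path.Homotopic.Quotient.eq.mpr h, Path.Homotopic.Quotient.mk_refl, wind_refl]

namespace LineArrangement

variable {n : ℕ} (A : LineArrangement n)

/-! ### Meridians -/

/-- The winding number around `Hᵢ` as a path character. -/
def windCharacter (i : Fin n) : PathCharacter A.Complement (Multiplicative ℤ) where
  val γ := Multiplicative.ofAdd (wind (Path.Homotopic.Quotient.map γ (A.form i)))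
  val_trans γ δ := by rw [MaxAbCover.map_trans, wind_trans, ofAdd_add]

/-- The linear part of the equation of `Hᵢ`. -/
def linearPart (i : Fin n) (v : ℂ × ℂ) : ℂ := A.a i * v.1 + A.b i * v.2

/-- The equation of `Hᵢ`. -/
def equation (i : Fin n) (v : ℂ × ℂ) : ℂ := A.a i * v.1 + A.b i * v.2 + A.c i

lemma equation_add_smul (i : Fin n) (v w : ℂ × ℂ) (z : ℂ) :
    A.equation i (v + z • w) = A.equation i v + z * A.linearPart i w := by
  simp only [equation, linearPart, Prod.fst_add, Prod.snd_add, Prod.smul_fst, Prod.smul_snd,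
    smul_eq_mul]
  ring

lemma exists_linearPart_eq_one (i : Fin n) : ∃ v, A.linearPart i v = 1 := by
  rcases A.nontrivial i with h | h
  · exact ⟨((A.a i)⁻¹, 0), by simp [linearPart, h]⟩
  · exact ⟨(0, (A.b i)⁻¹), by simp [linearPart, h]⟩

lemma exists_equation_eq_zero (i : Fin n) : ∃ v, A.equation i v = 0 := by
  obtain ⟨v, hv⟩ := A.exists_linearPart_eq_one i
  refine ⟨0 + (-A.c i) • v, ?_⟩
  rw [equation_add_smul, hv]
  simp [equation]

/-- A point of `Hⱼ` that lies on no other line. -/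
lemma exists_generic_point (j : Fin n) :
    ∃ p, A.equation j p = 0 ∧ ∀ i, i ≠ j → A.equation i p ≠ 0 := by
  obtain ⟨p₀, hp₀⟩ := A.exists_equation_eq_zero j
  let d : ℂ × ℂ := (-A.b j, A.a j)
  have hd : A.linearPart j d = 0 := by
    simp only [linearPart, d]
    ring
  have hfin : (⋃ i : {i // i ≠ j}, {z : ℂ | A.equation i (p₀ + z • d) = 0}).Finite := by
    refine Set.finite_iUnion fun i => Set.Subsingleton.finite fun z hz z' hz' => ?_
    by_contra hne
    simp only [Set.mem_ofPred_eq, equation_add_smul] at hz hz'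
    have h1 : (z - z') * A.linearPart i d = 0 := by linear_combination hz - hz'
    have h2 : A.linearPart i d = 0 := (mul_eq_zero.mp h1).resolve_left (sub_ne_zero.mpr hne)
    rw [h2, mul_zero, add_zero] at hz
    -- the lines `Hᵢ` and `Hⱼ` are parallel and meet in `p₀`, hence agree
    simp only [linearPart, d] at h2
    simp only [equation] at hz hp₀
    refine i.2 (A.distinct (Set.ext fun v => ?_))
    have key (a b a' b' x y : ℂ) (h : a * -b' + b * a' = 0) (ha : a ≠ 0 ∨ b ≠ 0)
        (hxy : a * x + b * y = 0) : a' * x + b' * y = 0 := by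
      rcases ha with ha | ha
      · refine (mul_eq_zero.mp ?_).resolve_left ha
        linear_combination a' * hxy - y * h
      · refine (mul_eq_zero.mp ?_).resolve_left ha
        linear_combination b' * hxy + x * h
    simp only [Set.mem_ofPred_eq]
    constructor
    · intro hv
      have h3 := key (A.a i) (A.b i) (A.a j) (A.b j) (v.1 - p₀.1) (v.2 - p₀.2) h2
        (A.nontrivial i) (by linear_combination hv - hz)
      linear_combination h3 + hp₀
    · intro hv
      have h3 := key (A.a j) (A.b j) (A.a i) (A.b i) (v.1 - p₀.1) (v.2 - p₀.2)
        (by linear_combination -h2) (A.nontrivial j) (by linear_combination hv - hp₀)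
      linear_combination h3 + hz
  obtain ⟨z, hz⟩ := hfin.infinite_compl.nonempty
  refine ⟨p₀ + z • d, by rw [equation_add_smul, hp₀, hd, mul_zero, add_zero], fun i hi h => hz ?_⟩
  exact Set.mem_iUnion.mpr ⟨⟨i, hi⟩, h⟩

/-- A small circle around `Hⱼ` in a transversal complex line is a meridian of `Hⱼ`. -/
lemma exists_meridian (j : Fin n) : ∃ (x : A.Complement) (γ : Path x x), ∀ i,
    (A.windCharacter i).val (Path.Homotopic.Quotient.mk γ) =
      Multiplicative.ofAdd (if i = j then 1 else 0) := by
  obtain ⟨p, hp, hpi⟩ := A.exists_generic_point j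
  obtain ⟨v, hv⟩ := A.exists_linearPart_eq_one j
  obtain ⟨ε, hε, hεi⟩ : ∃ ε : ℝ, 0 < ε ∧
      ∀ i, i ≠ j → ε * ‖A.linearPart i v‖ < ‖A.equation i p‖ := by
    have h (i : Fin n) : ∀ᶠ ε : ℝ in nhdsWithin 0 (Set.Ioi 0),
        i ≠ j → ε * ‖A.linearPart i v‖ < ‖A.equation i p‖ := by
      by_cases hi : i = j
      · exact Filter.Eventually.of_forall fun ε h => absurd hi h
      · have hc : Continuous fun ε : ℝ => ε * ‖A.linearPart i v‖ := by fun_prop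
        have := (hc.tendsto 0).eventually_lt_const
          (by simpa using hpi i hi : 0 * ‖A.linearPart i v‖ < ‖A.equation i p‖)
        exact (this.filter_mono nhdsWithin_le_nhds).mono fun ε h _ => h
    obtain ⟨ε, h1, h2⟩ := ((Filter.eventually_all.mpr h).and self_mem_nhdsWithin).exists
    exact ⟨ε, h2, h1⟩
  let u (s : ℝ) : ℂ := ε * Complex.exp (2 * Real.pi * Complex.I * s)
  have hu (s) : ‖u s‖ = ε := by
    have : (2 * Real.pi * Complex.I * s : ℂ) = ((2 * Real.pi * s : ℝ) : ℂ) * Complex.I := by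
      push_cast
      ring
    simp only [u]
    rw [norm_mul, this, Complex.norm_exp_ofReal_mul_I, mul_one, Complex.norm_real,
      Real.norm_of_nonneg hε.le]
  have hu01 : u 1 = u 0 := by simp [u]
  have hu0 (s) : u s ≠ 0 := by
    rw [← norm_ne_zero_iff, hu]
    exact hε.ne'
  have hj (s) : A.equation j (p + u s • v) = u s := by rw [equation_add_smul, hp, hv]; ring
  have hi (i) (hij : i ≠ j) (s) :
      A.equation i (p + u s • v) ∈ Metric.ball (A.equation i p) ‖A.equation i p‖ := by
    rw [equation_add_smul, mem_ball_iff_norm, add_sub_cancel_left, norm_mul, hu]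
    exact hεi i hij
  have h0 (i : Fin n) : (0 : ℂ) ∉ Metric.ball (A.equation i p) ‖A.equation i p‖ := by
    simp
  have hmem (s) : p + u s • v ∉ ⋃ i, A.line i := by
    refine (A.notMem_iUnion_line _).mpr fun i => ?_
    change A.equation i (p + u s • v) ≠ 0
    by_cases hij : i = j
    · rw [hij, hj]
      exact hu0 s
    · exact fun h => h0 i (h ▸ hi i hij s)
  let γ : Path (⟨p + u 0 • v, hmem 0⟩ : A.Complement) ⟨p + u 0 • v, hmem 0⟩ :=
    { toFun := fun s => ⟨p + u s • v, hmem s⟩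
      continuous_toFun := by fun_prop
      source' := by simp
      target' := by simp [hu01] }
  refine ⟨_, γ, fun i => ?_⟩
  refine congrArg Multiplicative.ofAdd ?_
  change wind (Path.Homotopic.Quotient.mk (γ.map (A.form i).continuous)) = _
  split_ifs with hij
  · subst hij
    exact wind_circle _ fun s => hj s
  · exact wind_eq_zero_of_mem_ball (h0 i) _ fun s => hi i hij s

lemma exists_meridian_at (x₀ : A.Complement) (j : Fin n) : ∃ γ : Path x₀ x₀, ∀ i,
    (A.windCharacter i).val (Path.Homotopic.Quotient.mk γ) =
      Multiplicative.ofAdd (if i = j then 1 else 0) := by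
  obtain ⟨x, γ, hγ⟩ := A.exists_meridian j
  obtain ⟨δ⟩ := A.joined x₀ x
  refine ⟨(δ.trans γ).trans δ.symm, fun i => ?_⟩
  rw [Path.Homotopic.Quotient.mk_trans, Path.Homotopic.Quotient.mk_trans,
    Path.Homotopic.Quotient.mk_symm, PathCharacter.val_trans, PathCharacter.val_trans,
    PathCharacter.val_symm, mul_right_comm, mul_inv_cancel, one_mul, hγ]

lemma transport_localSystem (t : Fin n → ℂˣ) {x y : A.Complement}
    (γ : Path.Homotopic.Quotient x y) :
    (A.localSystem t).transport γ = ∏ i, t i ^ ((A.windCharacter i).val γ).toAdd := rfl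

lemma eq_one_of_character_eq_one (x₀ : A.Complement) (t : Fin n → ℂˣ)
    (h : (A.localSystem t).character x₀ = 1) : t = 1 := by
  funext j
  obtain ⟨γ, hγ⟩ := A.exists_meridian_at x₀ j
  have h1 : (A.localSystem t).transport (Path.Homotopic.Quotient.mk γ) = 1 :=
    DFunLike.congr_fun h (Abelianization.of (FundamentalGroup.fromPath
      (Path.Homotopic.Quotient.mk γ)))
  rw [transport_localSystem] at h1
  simp only [hγ] at h1
  simpa using h1

lemma transport_localSystem_one {x y : A.Complement} (γ : Path.Homotopic.Quotient x y) :
    (A.localSystem 1).transport γ = 1 := by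
  rw [transport_localSystem]
  simp

lemma character_localSystem_one (x₀ : A.Complement) : (A.localSystem 1).character x₀ = 1 := by
  refine MonoidHom.ext fun k => ?_
  obtain ⟨g, rfl⟩ : ∃ g, Abelianization.of g = k := QuotientGroup.mk_surjective k
  exact A.transport_localSystem_one _

end LineArrangement

end CharVar

end

theorem mainTheorem10 (n : ℕ) (A : CharVar.LineArrangement n) (x₀ : A.Complement)
    (hB : Nontrivial (CharVar.singularHomology ℤ 1 (CharVar.MaxAbCover A.Complement x₀)))
    (k : ℕ) (hk : 1 ≤ k)
    (hkN : (k : ℤ) ≤ min (n : ℤ) ((n.choose 2 : ℤ) - (CharVar.bettiNumber 2 A.Complement : ℤ))) :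
    A.V x₀ k = A.W k := by
  have : Nonempty A.Complement := ⟨x₀⟩
  ext t
  refine (A.mem_charVariety_iff x₀ _ k).trans ?_
  change _ ↔ (k : Cardinal) ≤ Module.rank ℂ (A.localSystem t).H1
  by_cases ht : t = 1
  · -- at the trivial character both ranks are large
    subst ht
    rw [A.character_localSystem_one]
    choose γ hγ using A.exists_meridian_at x₀
    have hγ' (i j) : ((A.windCharacter i).val (Path.Homotopic.Quotient.mk (γ j))).toAdd =
        if i = j then 1 else 0 := congrArg Multiplicative.toAdd (hγ j i)
    have := A.finite_singularHomology 1
    have h1 : k ≤ n := by exact_mod_cast hkN.trans (min_le_left _ _)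
    have h2 := hkN.trans (min_le_right _ _)
    refine iff_of_true (CharVar.le_rank_charDual_one A.windCharacter γ hγ' (by omega)) ?_
    exact le_trans (by exact_mod_cast h1)
      (CharVar.le_rank_H1_of_transport_eq_one A.windCharacter γ hγ' _ A.transport_localSystem_one)
  · rw [CharVar.rank_H1_eq_of_ne_one (x₀ := x₀) _
      fun h => ht (A.eq_one_of_character_eq_one x₀ t h)]
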